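/- Let $(X_n)_{n\in\mathbb Z}$ be a stationary and ergodic Markov chain on a probability space $(\Omega,\mathcal A,P)$ with values in a measurable space $\mathcal X$ and transition kernel $Q$. Thus $P(X_{n+1}\in B\mid\mathcal F_n)=Q(X_n;B)$ a.s., where $\mathcal F_n=\sigma(\dots,X_{n-1},X_n)$. Let $\pi$ be the law of $X_0$ and $\pi_1$ the law of $(X_0,X_1)$, write $Qh(x)=\int h(y)\,Q(x;dy)$, and let $P^x$ denote a regular conditional probability given $X_0=x$. Let $g:\mathcal X\to\mathbb R$ be measurable with $g\in L^p(\pi)$ for some $p>2$ and $\int g\,d\pi=0$. Put $S_n=\sum_{i=1}^n g(X_i)$, $\sigma_n^2=E(S_n^2)$, and let $\|\cdot\|$ be the $L^2$ norm. Suppose that $$\|E(S_n\mid X_0)\|=o\big(\sqrt n\,\log^{-q}n\big)\quad (n\to\infty)$$ for some real $q\ge 2$. For $n\ge1$ let $$h_n=\frac1n\sum_{k=1}^n\sum_{j=0}^{k-1}Q^jg,\qquad H_n(x_0,x_1)=h_n(x_1)-Qh_n(x_0).$$ Then $\sigma^2=\lim_{n\to\infty}\sigma_n^2/n$ exists (and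 is finite). Moreover $H=\lim_n H_n$ exists in $L^2(\pi_1)$; and, with $M_n=\sum_{k=1}^nH(X_{k-1},X_k)$, the sequence $(M_n)$ is a martingale with respect to $(\mathcal F_n)$ with stationary increments, and $\|S_n-M_n\|=o(\sqrt n\,\log^{1-q}n)$. The remainder $R_n=S_n-M_n$ satisfies $$\lim_{n\to\infty}P\Big[\max_{j\le n}|R_j|\ge\varepsilon\sqrt n\Big]=0\quad\text{for each }\varepsilon>0 .$$ If $q>5/2$, then, for $\pi$-almost every $x$, $$\lim_{n\to\infty}P^x\Big[\max_{j\le n}|R_j|\ge\varepsilon\sqrt n\Big]=0\quad\text{for each }\varepsilon>0 .$$ -/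

import Mathlib

open MeasureTheory ProbabilityTheory Filter Topology Asymptotics

noncomputable section

namespace MartApprox

variable {Ω 𝒳 : Type*} [MeasurableSpace 𝒳]

/-- The left shift on two-sided paths. -/
def shift (x : ℤ → 𝒳) : ℤ → 𝒳 := fun n => x (n + 1)

/-- The past `σ(…, X_{n-1}, X_n)` up to time `n`. -/
abbrev past (X : ℤ → Ω → 𝒳) (n : ℤ) : MeasurableSpace Ω :=
  ⨆ i : ℤ, ⨆ _ : i ≤ n, MeasurableSpace.comap (X i) inferInstance

lemma past_mono (X : ℤ → Ω → 𝒳) {m n : ℤ} (h : m ≤ n) : past X m ≤ past X n :=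
  iSup_mono fun _ => iSup_mono' fun hi => ⟨hi.trans h, le_rfl⟩

lemma past_le [mΩ : MeasurableSpace Ω] {X : ℤ → Ω → 𝒳} (hX : ∀ n, Measurable (X n)) (n : ℤ) :
    past X n ≤ mΩ :=
  iSup_le fun i => iSup_le fun _ => (hX i).comap_le

/-- The filtration of the pasts `σ(…, X_{n-1}, X_n)`, `n = 0, 1, 2, …`. -/
def pastFiltration [mΩ : MeasurableSpace Ω] (X : ℤ → Ω → 𝒳) (hX : ∀ n, Measurable (X n)) :
    Filtration ℕ mΩ where
  seq n := past X (n : ℤ)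
  mono' _ _ h := past_mono X (by exact_mod_cast h)
  le' n := past_le hX n

/-- `(X_n)_{n ∈ ℤ}` is a stationary and ergodic Markov chain with transition kernel `Q`.
`Ergodic` comprises the invariance of the law of the chain under the shift, that is,
stationarity. -/
structure IsStationaryErgodicMarkovChain [MeasurableSpace Ω] (P : Measure Ω)
    (X : ℤ → Ω → 𝒳) (Q : Kernel 𝒳 𝒳) : Prop where
  measurable : ∀ n, Measurable (X n)
  ergodic : Ergodic (shift (𝒳 := 𝒳)) (P.map fun ω n => X n ω)
  markov : ∀ (n : ℤ) (B : Set 𝒳), MeasurableSet B →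
    P[(X (n + 1) ⁻¹' B).indicator (fun _ => (1 : ℝ)) | past X n]
      =ᵐ[P] fun ω => (Q (X n ω)).real B

/-- `Q h (x) = ∫ h(y) Q(x; dy)`. -/
def transOp (Q : Kernel 𝒳 𝒳) (h : 𝒳 → ℝ) : 𝒳 → ℝ := fun x => ∫ y, h y ∂(Q x)

/-- `h_n^o = g + Q g + ⋯ + Q^{n-1} g`. -/
def potential (Q : Kernel 𝒳 𝒳) (g : 𝒳 → ℝ) (n : ℕ) : 𝒳 → ℝ :=
  fun x => ∑ j ∈ Finset.range n, ((transOp Q)^[j] g) x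

/-- `h_n = (h_1^o + ⋯ + h_n^o) / n`, the approximate solution of Poisson's equation. -/
def poissonApprox (Q : Kernel 𝒳 𝒳) (g : 𝒳 → ℝ) (n : ℕ) : 𝒳 → ℝ :=
  fun x => (∑ k ∈ Finset.Icc 1 n, potential Q g k x) / (n : ℝ)

/-- `H_n(x₀, x₁) = h_n(x₁) - Q h_n(x₀)`. -/
def poissonDiff (Q : Kernel 𝒳 𝒳) (g : 𝒳 → ℝ) (n : ℕ) : 𝒳 × 𝒳 → ℝ :=
  fun z => poissonApprox Q g n z.2 - transOp Q (poissonApprox Q g n) z.1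

/-- `H` is (a measurable version of) the limit of `H_n` in `L²(π₁)`, where `π₁` is a probability
measure on pairs of states. -/
structure IsLimitDiff (π₁ : Measure (𝒳 × 𝒳)) (Q : Kernel 𝒳 𝒳) (g : 𝒳 → ℝ)
    (H : 𝒳 × 𝒳 → ℝ) : Prop where
  measurable : Measurable H
  memLp : MemLp H 2 π₁
  tendsto : Tendsto (fun n : ℕ => eLpNorm (poissonDiff Q g n - H) 2 π₁) atTop (𝓝 0)

/-- The one-sided path `(X_0, X_1, X_2, …)`. -/
def future (X : ℤ → Ω → 𝒳) (ω : Ω) : ℕ → 𝒳 := fun k => X (k : ℤ) ω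

/-- `S_n = g(x_1) + ⋯ + g(x_n)` along a path `x_0, x_1, …`. -/
def pathS (g : 𝒳 → ℝ) (n : ℕ) (x : ℕ → 𝒳) : ℝ := ∑ k ∈ Finset.Icc 1 n, g (x k)

/-- `M_n = H(x_0, x_1) + ⋯ + H(x_{n-1}, x_n)` along a path `x_0, x_1, …`. -/
def pathM (H : 𝒳 × 𝒳 → ℝ) (n : ℕ) (x : ℕ → 𝒳) : ℝ :=
  ∑ k ∈ Finset.Icc 1 n, H (x (k - 1), x k)

/-- `max_{j ≤ n} |S_j - M_j|` along a path (the term `j = 0` is `0`). -/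
def pathMaxR (g : 𝒳 → ℝ) (H : 𝒳 × 𝒳 → ℝ) (n : ℕ) (x : ℕ → 𝒳) : ℝ :=
  (Finset.range (n + 1)).sup' Finset.nonempty_range_add_one
    fun j => |pathS g j x - pathM H j x|

/-- The increments of `M_0, M_1, M_2, …` form a stationary sequence. -/
def HasStationaryIncrements [MeasurableSpace Ω] (P : Measure Ω) (M : ℕ → Ω → ℝ) : Prop :=
  ∀ m : ℕ, P.map (fun ω (k : ℕ) => M (m + k + 1) ω - M (m + k) ω)
    = P.map (fun ω (k : ℕ) => M (k + 1) ω - M k ω)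

/-- `x ↦ P^x` is a regular conditional distribution of `(X_0, X_1, X_2, …)` given `X_0 = x`.
If `x ↦ P^x` is a regular conditional probability given `X_0 = x` on the larger sigma-algebra
`σ(X_n, n ∈ ℤ)`, then the image of `P^x` under `(X_0, X_1, X_2, …)` is of this kind. -/
def IsRegularCondLaw [MeasurableSpace Ω] (P : Measure Ω) (X : ℤ → Ω → 𝒳)
    (Px : Kernel 𝒳 (ℕ → 𝒳)) : Prop :=
  (P.map (X 0)) ⊗ₘ Px = P.map fun ω => (X 0 ω, future X ω)

end MartApprox

end

/-! Let π₁ = π ⊗ Q be the law of (X_0, X_1) and V_n = Qg + ⋯ + Qⁿg. Then V_n(X_0) = E(S_n | X_0), so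
the hypothesis says ‖V_n‖ = o(√n log^{-q} n). The map J h(x₀, x₁) = h(x₁) − Qh(x₀) produces
martingale differences, and Pythagoras gives ‖Jh‖² = ‖h‖² − ‖Qh‖² ≤ 2‖h‖‖h − Qh‖ (`norm_diffLp_sq`,
`norm_map_le`). The Cesàro potentials satisfy ‖h_n‖ = o(√n log^{-q} n) and h_n − Qh_n = g − V_n/n.
For n ≤ m ≤ 2n the function h_n − h_m is thus of moderate size and nearly Q-invariant, which yields
‖H_n − H_m‖ = o(log^{-q} n). Adding these bounds over powers of two costs one logarithm: H_n
converges, and ‖H_n − H‖ = o(log^{1-q} n).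

Telescoping gives R_n = Qh_n(X_0) − Qh_n(X_n) + n⁻¹ ∑ V_n(X_k) + ∑ (H_n − H)(X_{k-1}, X_k), whose
terms have norms at most ‖h_n‖ (twice), ‖V_n‖ and √n ‖H_n − H‖ (`l2_pathR_le`). This is the rate for
R_n. Since ‖M_n‖ = √n ‖H‖, it also gives σ² = ‖H‖².

For the maximum up to 2^d, cut time into blocks of length 2^r with r = ⌊d/L⌋ (`pathMaxR_subset`). At
block endpoints, dyadic chaining bounds the probability by the square of ∑_{r≤s≤d}
‖R_{2^s}‖/2^{s/2}, which is o(d^{4-2q}): it vanishes for q ≥ 2 and is summable in d for q > 5/2.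
Inside a block, S moves by at most 2^r max |g|, and a moment of order p > 2 makes this geometrically
small once L is large. The martingale has only two moments, so its increments are truncated at a
level c: fourth moments handle the bounded part, and the remainder is controlled by averages of Q^k
applied to a conditional tail second moment.

Under P^x, endpoints and jumps follow from summability, as in Borel–Cantelli. The oscillation inside
blocks is not treated by summability: its bound holds on every event {X_0 ∈ B}, hence under P^x for
almost every x, and the maximal ergodic inequality for Q makes the tail averages small uniformly in
time. -/

noncomputable section

namespace MartApprox

/-! ### The rate √n log^{-q} n. -/

section Rate

/-- The rate `√n log^{-q} n`. -/
def logRate (q : ℝ) (n : ℕ) : ℝ := √(n : ℝ) * Real.log n ^ (-q)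

lemma logRate_nonneg (q : ℝ) (n : ℕ) : 0 ≤ logRate q n :=
  mul_nonneg (Real.sqrt_nonneg _) (Real.rpow_nonneg (Real.log_natCast_nonneg n) _)

lemma logRate_eq {q : ℝ} (hq : 0 < q) {x : ℝ} (hx : 1 < x) :
    √x * Real.log x ^ (-q) = ((Real.log x / x ^ (1 / (2 * q))) ^ q)⁻¹ := by
  have hl := Real.log_pos hx
  have hx0 : 0 < x := by linarith
  rw [Real.div_rpow hl.le (by positivity), ← Real.rpow_mul hx0.le,
    show 1 / (2 * q) * q = 1 / 2 by field_simp, Real.rpow_neg hl.le, ← Real.sqrt_eq_rpow, inv_div]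
  rfl

/-- By `logRate_eq` the rate is the inverse q-th power of log x / x^{1/(2q)}, which decreases from x
= e^{2q} on; this is the threshold for N. -/
lemma exists_logRate_mono {q : ℝ} (hq : 0 < q) :
    ∃ N : ℕ, ∀ k n : ℕ, N ≤ k → k ≤ n → logRate q k ≤ logRate q n := by
  obtain ⟨N, hN⟩ := exists_nat_ge (Real.exp (1 / (1 / (2 * q))))
  refine ⟨N, fun k n hk hkn => ?_⟩
  have hk1 : Real.exp (1 / (1 / (2 * q))) ≤ (k : ℝ) := hN.trans (by exact_mod_cast hk)
  have hkn' : (k : ℝ) ≤ n := by exact_mod_cast hkn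
  have h1 : 1 < (k : ℝ) := lt_of_lt_of_le (Real.one_lt_exp_iff.2 (by positivity)) hk1
  have h1n : 1 < (n : ℝ) := h1.trans_le hkn'
  unfold logRate
  rw [logRate_eq hq h1, logRate_eq hq h1n]
  have hln := Real.log_pos h1n
  have hanti := Real.log_div_self_rpow_antitoneOn (a := 1 / (2 * q)) (by positivity)
    (by simpa using hk1) (by simpa using hk1.trans hkn') hkn'
  have : 0 < Real.log (n : ℝ) / (n : ℝ) ^ (1 / (2 * q)) := by positivity
  gcongr

lemma tendsto_logRate (q : ℝ) : Tendsto (logRate q) atTop atTop := by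
  have h : (fun x : ℝ => Real.log x ^ q) =o[atTop] fun x : ℝ => x ^ (1 / 2 : ℝ) :=
    isLittleO_log_rpow_rpow_atTop q (by norm_num)
  have h2 : Tendsto (fun x : ℝ => x ^ (1 / 2 : ℝ) / Real.log x ^ q) atTop atTop := by
    have h3 := h.tendsto_div_nhds_zero
    have h4 : Tendsto (fun x : ℝ => Real.log x ^ q / x ^ (1 / 2 : ℝ)) atTop (𝓝[>] 0) := by
      refine tendsto_nhdsWithin_iff.2 ⟨h3, ?_⟩
      filter_upwards [eventually_gt_atTop 1] with x hx
      have := Real.log_pos hx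
      have : 0 < x := by linarith
      exact Set.mem_Ioi.2 (by positivity)
    refine h4.inv_tendsto_nhdsGT_zero.congr fun x => ?_
    simp [inv_div]
  refine (h2.comp tendsto_natCast_atTop_atTop).congr' ?_
  filter_upwards [eventually_gt_atTop 1] with n hn
  have hl : 0 < Real.log (n : ℝ) := Real.log_pos (by exact_mod_cast hn)
  simp only [logRate, Function.comp, Real.rpow_neg hl.le, Real.sqrt_eq_rpow]
  rfl

/-- Running maxima of a sequence that is `o(√n log^{-q} n)` are of the same order. -/
lemma exists_forall_le_logRate {q : ℝ} (hq : 0 < q) {a : ℕ → ℝ} (ha0 : ∀ n, 0 ≤ a n)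
    (ha : a =o[atTop] logRate q) (c : ℝ) {η : ℝ} (hη : 0 < η) :
    ∃ N : ℕ, ∀ n, N ≤ n → ∀ k, k ≤ n → c + a k ≤ η * logRate q n := by
  obtain ⟨N₀, hN₀⟩ := exists_logRate_mono hq
  obtain ⟨N₁, hN₁⟩ := eventually_atTop.1 (ha.bound (half_pos hη))
  have ht : ∀ C : ℝ, ∀ᶠ n in atTop, C ≤ η / 2 * logRate q n := fun C =>
    ((tendsto_logRate q).const_mul_atTop (half_pos hη)).eventually_ge_atTop C
  obtain ⟨N₂, hN₂⟩ := eventually_atTop.1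
    ((ht (∑ k ∈ Finset.range (max N₀ N₁), a k)).and (ht c))
  refine ⟨N₂, fun n hn k hk => ?_⟩
  have hc := (hN₂ n hn).2
  suffices a k ≤ η / 2 * logRate q n by linarith
  by_cases hkN : k < max N₀ N₁
  · exact (Finset.single_le_sum (f := a) (fun i _ => ha0 i) (Finset.mem_range.2 hkN)).trans
      (hN₂ n hn).1
  · push Not at hkN
    have h1 := hN₁ k ((le_max_right _ _).trans hkN)
    rw [Real.norm_of_nonneg (ha0 k), Real.norm_of_nonneg (logRate_nonneg _ _)] at h1
    have h2 := hN₀ k n ((le_max_left _ _).trans hkN) hk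
    nlinarith

/-- Splitting j^{-q} = j^{2-q} j^{-2}, the first factor is at most k^{2-q} because q ≥ 2, and the
inverse squares from k on sum to at most 2/k. This sum is where the dyadic argument loses one
logarithm. -/
lemma sum_Ico_rpow_neg_le {q : ℝ} (hq : 2 ≤ q) {k : ℕ} (hk : 2 ≤ k) (l : ℕ) :
    ∑ j ∈ Finset.Ico k l, (j : ℝ) ^ (-q) ≤ 2 * (k : ℝ) ^ (1 - q) := by
  have hk0 : (0 : ℝ) < k := by positivity
  have h1 : ∀ j ∈ Finset.Ico k l, (j : ℝ) ^ (-q) ≤ (k : ℝ) ^ (2 - q) * ((j : ℝ) ^ 2)⁻¹ := by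
    intro j hj
    have hkj : (k : ℝ) ≤ j := by exact_mod_cast (Finset.mem_Ico.1 hj).1
    have hj0 : (0 : ℝ) < j := hk0.trans_le hkj
    have : (j : ℝ) ^ (-q) = (j : ℝ) ^ (2 - q) * ((j : ℝ) ^ 2)⁻¹ := by
      rw [← Real.rpow_natCast, ← Real.rpow_neg hj0.le, ← Real.rpow_add hj0]
      congr 1; push_cast; ring
    rw [this]
    exact mul_le_mul_of_nonneg_right (Real.rpow_le_rpow_of_nonpos hk0 hkj (by linarith))
      (by positivity)
  have h2 : ∑ j ∈ Finset.Ico k l, ((j : ℝ) ^ 2)⁻¹ ≤ 2 / k := by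
    have := sum_Ioo_inv_sq_le (α := ℝ) (k - 1) l
    have e : Finset.Ioo (k - 1) l = Finset.Ico k l := by
      ext j; simp only [Finset.mem_Ioo, Finset.mem_Ico]; omega
    rw [e] at this
    rwa [Nat.cast_sub (by omega), Nat.cast_one, sub_add_cancel] at this
  calc _ ≤ ∑ j ∈ Finset.Ico k l, (k : ℝ) ^ (2 - q) * ((j : ℝ) ^ 2)⁻¹ := Finset.sum_le_sum h1
    _ = (k : ℝ) ^ (2 - q) * ∑ j ∈ Finset.Ico k l, ((j : ℝ) ^ 2)⁻¹ := by rw [Finset.mul_sum]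
    _ ≤ (k : ℝ) ^ (2 - q) * (2 / k) := by gcongr
    _ = 2 * (k : ℝ) ^ (1 - q) := by
      rw [show (1 - q) = (2 - q) - 1 by ring, Real.rpow_sub_one hk0.ne']; ring

lemma log_le_two_mul_log_two {n : ℕ} (hn : 2 ≤ n) : Real.log n ≤ 2 * (Nat.log 2 n : ℝ) := by
  have h1 : n < 2 ^ (Nat.log 2 n + 1) := Nat.lt_pow_succ_log_self (by norm_num) n
  have h2 : 1 ≤ Nat.log 2 n := Nat.log_pos (by norm_num) hn
  have h3 : Real.log n ≤ Real.log ((2 : ℝ) ^ (Nat.log 2 n + 1)) :=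
    Real.log_le_log (by positivity) (by exact_mod_cast h1.le)
  rw [Real.log_pow] at h3
  have h4 : Real.log 2 ≤ 1 := by linarith [Real.log_two_lt_d9]
  have h5 : (1 : ℝ) ≤ Nat.log 2 n := by exact_mod_cast h2
  push_cast at h3
  nlinarith

end Rate

/-! ### Approximate solutions of Poisson's equation in a Hilbert space. -/

section Abstract

variable {E F : Type*} [NormedAddCommGroup E] [InnerProductSpace ℝ E]
  [NormedAddCommGroup F] [NormedSpace ℝ F]

/-- `T g + ⋯ + Tⁿ g`. -/
def orbitSum (T : E →ₗ[ℝ] E) (g : E) (n : ℕ) : E := ∑ i ∈ Finset.range n, (T ^ (i + 1)) g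

/-- `g + T g + ⋯ + T^{n-1} g`. -/
def opPotential (T : E →ₗ[ℝ] E) (g : E) (n : ℕ) : E := ∑ i ∈ Finset.range n, (T ^ i) g

/-- The Cesàro means of the potentials. -/
def opPoisson (T : E →ₗ[ℝ] E) (g : E) (n : ℕ) : E :=
  (n : ℝ)⁻¹ • ∑ k ∈ Finset.Icc 1 n, opPotential T g k

variable (T : E →ₗ[ℝ] E) (g : E)

lemma opPotential_succ (k : ℕ) : opPotential T g (k + 1) = g + orbitSum T g k := by
  rw [opPotential, Finset.sum_range_succ', orbitSum, add_comm]; simp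

lemma opPotential_sub (k : ℕ) : opPotential T g k - T (opPotential T g k) = g - (T ^ k) g := by
  have : T (opPotential T g k) = orbitSum T g k := by
    simp [opPotential, orbitSum, map_sum, pow_succ']
  rw [this]
  cases k with
  | zero => simp [opPotential, orbitSum]
  | succ k => rw [opPotential_succ, orbitSum, orbitSum, Finset.sum_range_succ]; abel

/-- Each potential telescopes under 1 − T to g − T^k g; averaging over k = 1, …, n gives the error
in Poisson's equation as the mean of the T^k g. -/
lemma opPoisson_sub {n : ℕ} (hn : n ≠ 0) :
    opPoisson T g n - T (opPoisson T g n) = g - (n : ℝ)⁻¹ • orbitSum T g n := by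
  have hn' : (n : ℝ) ≠ 0 := by exact_mod_cast hn
  rw [opPoisson, map_smul, map_sum, ← smul_sub, ← Finset.sum_sub_distrib]
  simp_rw [opPotential_sub, Finset.sum_sub_distrib]
  rw [smul_sub, Finset.sum_const, Nat.card_Icc, Nat.add_sub_cancel, ← Nat.cast_smul_eq_nsmul ℝ,
    smul_smul, inv_mul_cancel₀ hn', one_smul, orbitSum, Finset.range_eq_Ico,
    Finset.sum_Ico_add' (fun i => (T ^ i) g) 0 n 1]
  rfl

lemma norm_opPoisson_le {n : ℕ} (hn : n ≠ 0) {b : ℝ}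
    (hb : ∀ k ≤ n, ‖g‖ + ‖orbitSum T g k‖ ≤ b) : ‖opPoisson T g n‖ ≤ b := by
  have hn' : (0 : ℝ) < n := by positivity
  rw [opPoisson, norm_smul, norm_inv, Real.norm_of_nonneg hn'.le]
  have : ‖∑ k ∈ Finset.Icc 1 n, opPotential T g k‖ ≤ ∑ k ∈ Finset.Icc 1 n, b := by
    refine norm_sum_le_of_le _ fun k hk => ?_
    obtain ⟨h1, h2⟩ := Finset.mem_Icc.1 hk
    obtain ⟨k, rfl⟩ : ∃ j, k = j + 1 := ⟨k - 1, by omega⟩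
    rw [opPotential_succ]
    exact (norm_add_le _ _).trans (hb k (by omega))
  rw [Finset.sum_const, Nat.card_Icc, Nat.add_sub_cancel, nsmul_eq_mul] at this
  calc _ ≤ (n : ℝ)⁻¹ * (n * b) := by gcongr
    _ = b := by field_simp

variable {T g}

lemma norm_le_of_norm_sq_eq {J : E →ₗ[ℝ] F} (hJ : ∀ h, ‖J h‖ ^ 2 = ‖h‖ ^ 2 - ‖T h‖ ^ 2) (h : E) :
    ‖T h‖ ≤ ‖h‖ :=
  le_of_sq_le_sq (by nlinarith [hJ h, sq_nonneg ‖J h‖]) (norm_nonneg _)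

/-- Factor the difference of squares: ‖h‖ − ‖Th‖ ≤ ‖h − Th‖ and, T being a contraction, ‖h‖ + ‖Th‖ ≤
2‖h‖. -/
lemma norm_map_le {J : E →ₗ[ℝ] F} (hJ : ∀ h, ‖J h‖ ^ 2 = ‖h‖ ^ 2 - ‖T h‖ ^ 2) (h : E) :
    ‖J h‖ ^ 2 ≤ ‖h - T h‖ * (2 * ‖h‖) := by
  have h1 : ‖h‖ - ‖T h‖ ≤ ‖h - T h‖ := norm_sub_norm_le _ _
  have h2 := norm_le_of_norm_sq_eq hJ h
  rw [hJ]
  nlinarith [norm_nonneg h, norm_nonneg (T h)]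

/-- For h = h_n − h_m the vector g cancels in h − Th, which leaves two averages of norm at most b/n,
while ‖h‖ ≤ 2b. Hence ‖Jh‖² ≤ 8b²/n, rounded up to the square (3b/√n)². -/
lemma norm_map_opPoisson_sub_le {J : E →ₗ[ℝ] F} (hJ : ∀ h, ‖J h‖ ^ 2 = ‖h‖ ^ 2 - ‖T h‖ ^ 2)
    {n m : ℕ} (hn : n ≠ 0) (hnm : n ≤ m) (hm : m ≤ 2 * n)
    {b : ℝ} (hb : ∀ k ≤ 2 * n, ‖g‖ + ‖orbitSum T g k‖ ≤ b) :
    ‖J (opPoisson T g n) - J (opPoisson T g m)‖ ≤ 3 * b / √n := by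
  have hm0 : m ≠ 0 := by omega
  have hn' : (0 : ℝ) < n := by positivity
  have hb0 : 0 ≤ b := (by positivity : 0 ≤ ‖g‖ + ‖orbitSum T g 0‖).trans (hb 0 (by omega))
  have h1 := norm_opPoisson_le T g hn fun k hk => hb k (by omega)
  have h2 := norm_opPoisson_le T g hm0 fun k hk => hb k (by omega)
  have hV : ∀ k ≠ 0, n ≤ k → k ≤ 2 * n → ‖(k : ℝ)⁻¹ • orbitSum T g k‖ ≤ b / n := by
    intro k hk0 hnk hk
    rw [norm_smul, norm_inv, Real.norm_natCast, div_eq_inv_mul]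
    have : ‖orbitSum T g k‖ ≤ b := by linarith [hb k hk, norm_nonneg g]
    have : (n : ℝ) ≤ k := by exact_mod_cast hnk
    gcongr
  have h3 : ‖(opPoisson T g n - opPoisson T g m) - T (opPoisson T g n - opPoisson T g m)‖
      ≤ b / n + b / n := by
    rw [map_sub, sub_sub_sub_comm, opPoisson_sub T g hn, opPoisson_sub T g hm0,
      sub_sub_sub_cancel_left]
    exact (norm_sub_le _ _).trans (add_le_add (hV m hm0 hnm hm) (hV n hn le_rfl (by omega)))
  have h4 : ‖opPoisson T g n - opPoisson T g m‖ ≤ b + b := (norm_sub_le _ _).trans (add_le_add h1 h2)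
  rw [← map_sub]
  refine abs_le_of_sq_le_sq' ?_ (by positivity) |>.2
  calc _ ≤ _ := norm_map_le hJ _
    _ ≤ (b / n + b / n) * (2 * (b + b)) := by gcongr
    _ = 8 * b ^ 2 / n := by ring
    _ ≤ 9 * b ^ 2 / n := by gcongr; norm_num
    _ = (3 * b / √n) ^ 2 := by rw [div_pow, Real.sq_sqrt hn'.le]; ring

/-- A Cauchy estimate with a rate: between consecutive powers of two the increment is of order
k^{-q}, and these increments are summed from k on. -/
lemma exists_forall_norm_map_opPoisson_sub_le {J : E →ₗ[ℝ] F}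
    (hJ : ∀ h, ‖J h‖ ^ 2 = ‖h‖ ^ 2 - ‖T h‖ ^ 2) {q : ℝ} (hq : 2 ≤ q)
    (ha : (fun n => ‖orbitSum T g n‖) =o[atTop] logRate q) {η : ℝ} (hη : 0 < η) :
    ∃ K : ℕ, ∀ k, K ≤ k → ∀ n m, 2 ^ k ≤ n → 2 ^ k ≤ m →
      ‖J (opPoisson T g n) - J (opPoisson T g m)‖ ≤ η * (k : ℝ) ^ (1 - q) := by
  obtain ⟨C, hC0, hC⟩ : ∃ C : ℝ, 0 < C ∧ ∀ k : ℕ, 1 ≤ k →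
      logRate q (2 * 2 ^ k) ≤ C * (√((2 ^ k : ℕ) : ℝ) * (k : ℝ) ^ (-q)) := by
    refine ⟨√2 * Real.log 2 ^ (-q), by have := Real.log_pos one_lt_two; positivity,
      fun k hk => ?_⟩
    have hl2 := Real.log_pos one_lt_two
    have hk0 : (0 : ℝ) < k := by exact_mod_cast hk
    unfold logRate
    push_cast
    rw [Real.sqrt_mul (by norm_num), Real.log_mul (by norm_num) (by positivity), Real.log_pow]
    calc _ ≤ √2 * √(2 ^ k) * (Real.log 2 * k) ^ (-q) := by
          refine mul_le_mul_of_nonneg_left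
            (Real.rpow_le_rpow_of_nonpos (by positivity) ?_ (by linarith)) (by positivity)
          nlinarith
      _ = _ := by rw [Real.mul_rpow hl2.le hk0.le]; ring
  -- The 3 comes from the bound 3b/√n and C from rewriting the rate at 2·2^k in terms of k. The 12
  -- leaves η/12 per dyadic step, so the series bound below gives η/6, inside the required η/2.
  set δ := η / (12 * 3 * C) with hδ
  have hδ0 : 0 < δ := by positivity
  obtain ⟨N, hN⟩ := exists_forall_le_logRate (by linarith) (fun n => norm_nonneg _) ha ‖g‖ hδ0
  have step : ∀ k, max N 2 ≤ k → ∀ m, 2 ^ k ≤ m → m ≤ 2 * 2 ^ k →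
      ‖J (opPoisson T g (2 ^ k)) - J (opPoisson T g m)‖ ≤ η / 12 * (k : ℝ) ^ (-q) := by
    intro k hk m h1 h2
    have hkN : N ≤ k := (le_max_left _ _).trans hk
    have hk2 : 2 ≤ k := (le_max_right _ _).trans hk
    have hkk : k < 2 ^ k := Nat.lt_two_pow_self
    refine (norm_map_opPoisson_sub_le hJ (by positivity) h1 h2
      (fun j hj => hN (2 * 2 ^ k) (by omega) j hj)).trans ?_
    have hs : 0 < √((2 ^ k : ℕ) : ℝ) := by positivity
    rw [div_le_iff₀ hs]
    calc _ ≤ 3 * (δ * (C * (√((2 ^ k : ℕ) : ℝ) * (k : ℝ) ^ (-q)))) := by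
          gcongr; exact hC k (by omega)
      _ = _ := by rw [hδ]; field_simp
  have dyad : ∀ k, max N 2 ≤ k → ∀ l, k ≤ l →
      ‖J (opPoisson T g (2 ^ k)) - J (opPoisson T g (2 ^ l))‖
        ≤ η / 12 * ∑ j ∈ Finset.Ico k l, (j : ℝ) ^ (-q) := by
    intro k hk l hl
    induction l, hl using Nat.le_induction with
    | base => simp
    | succ l hl ih =>
      rw [Finset.sum_Ico_succ_top hl, mul_add]
      refine (norm_sub_le_norm_sub_add_norm_sub _ _ _).trans
        (add_le_add ih (step l (hk.trans hl) _ ?_ ?_)) <;> rw [pow_succ] <;> omega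
  refine ⟨max N 2, fun k hk => ?_⟩
  have hk2 : 2 ≤ k := (le_max_right _ _).trans hk
  have hk0 : (0 : ℝ) < k := by positivity
  suffices h : ∀ n, 2 ^ k ≤ n → ‖J (opPoisson T g (2 ^ k)) - J (opPoisson T g n)‖
      ≤ η / 2 * (k : ℝ) ^ (1 - q) by
    intro n m hn hm
    refine (norm_sub_le_norm_sub_add_norm_sub _ (J (opPoisson T g (2 ^ k))) _).trans ?_
    rw [norm_sub_rev]
    linarith [h n hn, h m hm]
  intro n hn
  have hn0 : n ≠ 0 := by have := Nat.two_pow_pos k; omega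
  have hkl : k ≤ Nat.log 2 n := Nat.le_log_of_pow_le (by norm_num) hn
  have h1 := dyad k hk _ hkl
  have h2 := step (Nat.log 2 n) (hk.trans hkl) n (Nat.pow_log_le_self 2 hn0)
    (by have := Nat.lt_pow_succ_log_self (b := 2) (by norm_num) n; rw [pow_succ] at this; omega)
  -- Going one index beyond `Nat.log 2 n` makes the sum also cover the last, incomplete step from
  -- 2^{log₂ n} to n.
  have h3 := sum_Ico_rpow_neg_le hq hk2 (Nat.log 2 n + 1)
  rw [Finset.sum_Ico_succ_top hkl] at h3
  refine (norm_sub_le_norm_sub_add_norm_sub _ _ _).trans ((add_le_add h1 h2).trans ?_)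
  have : 0 ≤ (k : ℝ) ^ (1 - q) := by positivity
  nlinarith

/-- The martingale-difference parts of the approximate solutions of Poisson's equation converge. -/
lemma cauchySeq_map_opPoisson {J : E →ₗ[ℝ] F} (hJ : ∀ h, ‖J h‖ ^ 2 = ‖h‖ ^ 2 - ‖T h‖ ^ 2)
    {q : ℝ} (hq : 2 ≤ q) (ha : (fun n => ‖orbitSum T g n‖) =o[atTop] logRate q) :
    CauchySeq fun n => J (opPoisson T g n) := by
  refine Metric.cauchySeq_iff.2 fun ε hε => ?_
  obtain ⟨K, hK⟩ := exists_forall_norm_map_opPoisson_sub_le hJ hq ha (half_pos hε)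
  refine ⟨2 ^ (max K 1), fun m hm n hn => ?_⟩
  rw [dist_eq_norm]
  refine (hK (max K 1) (le_max_left _ _) m n hm hn).trans_lt ?_
  have h1 : (1 : ℝ) ≤ (max K 1 : ℕ) := by exact_mod_cast le_max_right _ _
  have : ((max K 1 : ℕ) : ℝ) ^ (1 - q) ≤ 1 := Real.rpow_le_one_of_one_le_of_nonpos h1 (by linarith)
  nlinarith

lemma isLittleO_map_opPoisson_sub {J : E →ₗ[ℝ] F} (hJ : ∀ h, ‖J h‖ ^ 2 = ‖h‖ ^ 2 - ‖T h‖ ^ 2)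
    {q : ℝ} (hq : 2 ≤ q) (ha : (fun n => ‖orbitSum T g n‖) =o[atTop] logRate q) {y : F}
    (hy : Tendsto (fun n => J (opPoisson T g n)) atTop (𝓝 y)) :
    (fun n => ‖J (opPoisson T g n) - y‖) =o[atTop] fun n : ℕ => Real.log n ^ (1 - q) := by
  refine isLittleO_iff.2 fun c hc => ?_
  -- The divisor compensates the passage from ⌊log₂ n⌋ to log n, for which ⌊log₂ n⌋ ≥ (log n)/2 is
  -- used.
  obtain ⟨K, hK⟩ := exists_forall_norm_map_opPoisson_sub_le hJ hq ha
    (η := c / (2⁻¹ : ℝ) ^ (1 - q)) (by positivity)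
  filter_upwards [eventually_ge_atTop (2 ^ (max K 1))] with n hn
  have hn0 : n ≠ 0 := by have := Nat.two_pow_pos (max K 1); omega
  have hkl : max K 1 ≤ Nat.log 2 n := Nat.le_log_of_pow_le (by norm_num) hn
  have hn2 : 2 ≤ n := by
    by_contra h
    have : n = 1 := by omega
    subst this
    simp at hkl
  have hlog : 0 < Real.log n := Real.log_pos (by exact_mod_cast hn2)
  have h1 : ‖J (opPoisson T g n) - y‖ ≤
      c / (2⁻¹ : ℝ) ^ (1 - q) * (Nat.log 2 n : ℝ) ^ (1 - q) := by
    -- Let m → ∞ in the Cauchy estimate with n fixed.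
    refine le_of_tendsto ((tendsto_const_nhds.sub hy).norm) ?_
    filter_upwards [eventually_ge_atTop n] with m hm
    exact hK _ ((le_max_left _ _).trans hkl) n m (Nat.pow_log_le_self 2 hn0)
      ((Nat.pow_log_le_self 2 hn0).trans hm)
  have h2 : (Nat.log 2 n : ℝ) ^ (1 - q) ≤ (2⁻¹ * Real.log n) ^ (1 - q) :=
    Real.rpow_le_rpow_of_nonpos (by positivity)
      (by linarith [log_le_two_mul_log_two hn2]) (by linarith)
  rw [Real.mul_rpow (by norm_num) hlog.le] at h2
  rw [norm_norm, Real.norm_of_nonneg (by positivity)]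
  calc _ ≤ _ := h1
    _ ≤ c / (2⁻¹ : ℝ) ^ (1 - q) * ((2⁻¹ : ℝ) ^ (1 - q) * Real.log n ^ (1 - q)) := by gcongr
    _ = _ := by field_simp

lemma isLittleO_opPoisson {q : ℝ} (hq : 0 < q)
    (ha : (fun n => ‖orbitSum T g n‖) =o[atTop] logRate q) :
    (fun n => ‖opPoisson T g n‖) =o[atTop] logRate q := by
  refine isLittleO_iff.2 fun c hc => ?_
  obtain ⟨N, hN⟩ := exists_forall_le_logRate hq (fun n => norm_nonneg _) ha ‖g‖ hc
  filter_upwards [eventually_ge_atTop (max N 1)] with n hn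
  rw [norm_norm, Real.norm_of_nonneg (logRate_nonneg _ _)]
  exact norm_opPoisson_le T g (by have := (le_max_right _ _).trans hn; omega)
    fun k hk => hN n ((le_max_left _ _).trans hn) k hk

end Abstract

/-! ### The transition operator and the difference map on L²(π). -/

section Invariant

variable {𝒳 : Type*} [MeasurableSpace 𝒳]

lemma measurable_transOp (Q : Kernel 𝒳 𝒳) {f : 𝒳 → ℝ} (hf : Measurable f) :
    Measurable (transOp Q f) :=
  (StronglyMeasurable.integral_kernel hf.stronglyMeasurable).measurable

lemma measurable_transOp_iterate (Q : Kernel 𝒳 𝒳) {f : 𝒳 → ℝ} (hf : Measurable f) (j : ℕ) :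
    Measurable ((transOp Q)^[j] f) := by
  induction j with
  | zero => exact hf
  | succ j ih => rw [Function.iterate_succ_apply']; exact measurable_transOp Q ih

lemma ae_ae_of_invariant {Q : Kernel 𝒳 𝒳} {π : Measure 𝒳} (hQ : Kernel.Invariant Q π)
    {p : 𝒳 → Prop} (h : ∀ᵐ x ∂π, p x) :
    ∀ᵐ x ∂π, ∀ᵐ y ∂(Q x), p y := by
  rw [← hQ.def] at h
  exact Measure.ae_ae_of_ae_comp h

variable {Q : Kernel 𝒳 𝒳} [IsMarkovKernel Q] {π : Measure 𝒳} [IsProbabilityMeasure π]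

lemma measurePreserving_fst_compProd (π : Measure 𝒳) [IsProbabilityMeasure π]
    (Q : Kernel 𝒳 𝒳) [IsMarkovKernel Q] : MeasurePreserving Prod.fst (π ⊗ₘ Q) π :=
  ⟨measurable_fst, Measure.fst_compProd π Q⟩

lemma measurePreserving_snd_compProd (hQ : Kernel.Invariant Q π) :
    MeasurePreserving Prod.snd (π ⊗ₘ Q) π :=
  ⟨measurable_snd, (Measure.snd_compProd π Q).trans hQ⟩

omit [IsMarkovKernel Q] [IsProbabilityMeasure π] in
lemma transOp_congr_ae (hQ : Kernel.Invariant Q π) {f f' : 𝒳 → ℝ} (h : f =ᵐ[π] f') :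
    transOp Q f =ᵐ[π] transOp Q f' := by
  filter_upwards [ae_ae_of_invariant hQ h] with x hx using integral_congr_ae hx

lemma ae_integrable_of_invariant (hQ : Kernel.Invariant Q π) {f : 𝒳 → ℝ} (hf : Integrable f π) :
    ∀ᵐ x ∂π, Integrable f (Q x) := by
  have h : Integrable (f ∘ Prod.snd) (π ⊗ₘ Q) :=
    (measurePreserving_snd_compProd hQ).integrable_comp_of_integrable hf
  exact ((Measure.integrable_compProd_iff h.aestronglyMeasurable).1 h).1

-- Jensen's inequality under each Q x gives |Qf|² ≤ Q(f²) pointwise, and invariance of π integrates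
-- the right side to ‖f‖².
omit [IsProbabilityMeasure π] in
lemma eLpNorm_transOp_le (hQ : Kernel.Invariant Q π) {f : 𝒳 → ℝ} (hf : Measurable f) :
    eLpNorm (transOp Q f) 2 π ≤ eLpNorm f 2 π := by
  have key : ∀ x, ‖transOp Q f x‖ₑ ^ (2 : ℝ) ≤ ∫⁻ y, ‖f y‖ₑ ^ (2 : ℝ) ∂(Q x) := by
    intro x
    have h1 : ‖transOp Q f x‖ₑ ≤ eLpNorm f 1 (Q x) := by
      rw [eLpNorm_one_eq_lintegral_enorm]; exact enorm_integral_le_lintegral_enorm _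
    have h2 := h1.trans (eLpNorm_le_eLpNorm_of_exponent_le (p := 1) (q := 2) (by norm_num)
      hf.aestronglyMeasurable)
    rw [eLpNorm_eq_lintegral_rpow_enorm_toReal (by norm_num) (by norm_num)] at h2
    simp only [ENNReal.toReal_ofNat] at h2
    calc _ ≤ _ := ENNReal.rpow_le_rpow h2 (by norm_num)
      _ = _ := by rw [← ENNReal.rpow_mul]; norm_num
  rw [eLpNorm_eq_lintegral_rpow_enorm_toReal (by norm_num) (by norm_num),
    eLpNorm_eq_lintegral_rpow_enorm_toReal (by norm_num) (by norm_num)]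
  simp only [ENNReal.toReal_ofNat]
  refine ENNReal.rpow_le_rpow ?_ (by norm_num)
  calc _ ≤ ∫⁻ x, ∫⁻ y, ‖f y‖ₑ ^ (2 : ℝ) ∂(Q x) ∂π := lintegral_mono key
    _ = ∫⁻ y, ‖f y‖ₑ ^ (2 : ℝ) ∂(Q ∘ₘ π) :=
      (Measure.lintegral_bind Q.aemeasurable (by fun_prop)).symm
    _ = _ := by rw [hQ.def]

lemma memLp_transOp (hQ : Kernel.Invariant Q π) {f : 𝒳 → ℝ} (hf : Measurable f)
    (h2 : MemLp f 2 π) : MemLp (transOp Q f) 2 π :=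
  ⟨(measurable_transOp Q hf).aestronglyMeasurable, (eLpNorm_transOp_le hQ hf).trans_lt h2.2⟩

lemma memLp_transOp_iterate (hQ : Kernel.Invariant Q π) {f : 𝒳 → ℝ} (hf : Measurable f)
    (h2 : MemLp f 2 π) (j : ℕ) : MemLp ((transOp Q)^[j] f) 2 π := by
  induction j with
  | zero => exact h2
  | succ j ih =>
    rw [Function.iterate_succ_apply']; exact memLp_transOp hQ (measurable_transOp_iterate Q hf j) ih

lemma memLp_transOp_coe (hQ : Kernel.Invariant Q π) (f : Lp ℝ 2 π) :
    MemLp (transOp Q f) 2 π :=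
  memLp_transOp hQ (Lp.stronglyMeasurable f).measurable (Lp.memLp f)

/-- The transition operator on `L²(π)`, for an invariant probability measure `π`. -/
def transLp (hQ : Kernel.Invariant Q π) : Lp ℝ 2 π →ₗ[ℝ] Lp ℝ 2 π where
  toFun f := (memLp_transOp_coe hQ f).toLp
  map_add' f f' := by
    rw [← MemLp.toLp_add, MemLp.toLp_eq_toLp_iff]
    refine (transOp_congr_ae hQ (Lp.coeFn_add f f')).trans ?_
    filter_upwards [ae_integrable_of_invariant hQ ((Lp.memLp f).integrable one_le_two),
      ae_integrable_of_invariant hQ ((Lp.memLp f').integrable one_le_two)] with x h1 h2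
    exact integral_add h1 h2
  map_smul' c f := by
    rw [RingHom.id_apply, ← MemLp.toLp_const_smul, MemLp.toLp_eq_toLp_iff]
    refine (transOp_congr_ae hQ (Lp.coeFn_smul c f)).trans (Eventually.of_forall fun x => ?_)
    exact integral_const_mul c _

lemma transLp_toLp (hQ : Kernel.Invariant Q π) {f : 𝒳 → ℝ} (hf : Measurable f)
    (h2 : MemLp f 2 π) : transLp hQ h2.toLp = (memLp_transOp hQ hf h2).toLp :=
  (MemLp.toLp_eq_toLp_iff (memLp_transOp_coe hQ _) _).2 (transOp_congr_ae hQ h2.coeFn_toLp)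

lemma transLp_pow_toLp (hQ : Kernel.Invariant Q π) {f : 𝒳 → ℝ} (hf : Measurable f)
    (h2 : MemLp f 2 π) (j : ℕ) :
    (transLp hQ ^ j) h2.toLp = (memLp_transOp_iterate hQ hf h2 j).toLp := by
  induction j with
  | zero => rfl
  | succ j ih =>
    rw [pow_succ', Module.End.mul_apply, ih, transLp_toLp hQ (measurable_transOp_iterate Q hf j),
      MemLp.toLp_eq_toLp_iff, Function.iterate_succ_apply']

/-- The martingale-difference map `h ↦ h(x₁) - Q h(x₀)` on `L²(π)`. -/
def diffLp (hQ : Kernel.Invariant Q π) : Lp ℝ 2 π →ₗ[ℝ] Lp ℝ 2 (π ⊗ₘ Q) :=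
  Lp.compMeasurePreservingₗ ℝ Prod.snd (measurePreserving_snd_compProd hQ)
    - (Lp.compMeasurePreservingₗ ℝ Prod.fst (measurePreserving_fst_compProd π Q)) ∘ₗ transLp hQ

lemma memLp_diff (hQ : Kernel.Invariant Q π) {f : 𝒳 → ℝ} (hf : Measurable f)
    (h2 : MemLp f 2 π) : MemLp (fun z : 𝒳 × 𝒳 => f z.2 - transOp Q f z.1) 2 (π ⊗ₘ Q) :=
  (h2.comp_measurePreserving (measurePreserving_snd_compProd hQ)).sub
    ((memLp_transOp hQ hf h2).comp_measurePreserving (measurePreserving_fst_compProd π Q))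

lemma diffLp_toLp (hQ : Kernel.Invariant Q π) {f : 𝒳 → ℝ} (hf : Measurable f)
    (h2 : MemLp f 2 π) : diffLp hQ h2.toLp = (memLp_diff hQ hf h2).toLp := by
  rw [diffLp, LinearMap.sub_apply, LinearMap.comp_apply, transLp_toLp hQ hf h2]
  change Lp.compMeasurePreserving Prod.snd _ _ - Lp.compMeasurePreserving Prod.fst _ _ = _
  rw [Lp.toLp_compMeasurePreserving, Lp.toLp_compMeasurePreserving, ← MemLp.toLp_sub]
  rfl

/-- Under π ⊗ Q, Qf(x₀) is the conditional mean of f(x₁), so their inner product is ‖Qf‖². Both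
marginals are π, so expanding the square leaves ‖f‖² − 2‖Qf‖² + ‖Qf‖². -/
lemma norm_diffLp_sq (hQ : Kernel.Invariant Q π) (f : Lp ℝ 2 π) :
    ‖diffLp hQ f‖ ^ 2 = ‖f‖ ^ 2 - ‖transLp hQ f‖ ^ 2 := by
  have hf : Measurable f := (Lp.stronglyMeasurable f).measurable
  have h2 := Lp.memLp f
  have hT := memLp_transOp hQ hf h2
  have hs := measurePreserving_snd_compProd hQ
  have hfst := measurePreserving_fst_compProd π Q
  obtain ⟨u, hu⟩ : ∃ u, u = Lp.compMeasurePreserving Prod.snd hs f := ⟨_, rfl⟩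
  obtain ⟨v, hv⟩ : ∃ v, v = Lp.compMeasurePreserving Prod.fst hfst (transLp hQ f) := ⟨_, rfl⟩
  have hJ : diffLp hQ f = u - v := by rw [hu, hv]; rfl
  have hun : ‖u‖ = ‖f‖ := by rw [hu]; exact Lp.norm_compMeasurePreserving _ _
  have hvn : ‖v‖ = ‖transLp hQ f‖ := by rw [hv]; exact Lp.norm_compMeasurePreserving _ _
  have hTn : ‖transLp hQ f‖ ^ 2 = ∫ x, transOp Q f x * transOp Q f x ∂π := by
    rw [← real_inner_self_eq_norm_sq, L2.inner_def]
    refine integral_congr_ae ?_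
    filter_upwards [(memLp_transOp_coe hQ f).coeFn_toLp] with x hx
    simp only [RCLike.inner_apply, conj_trivial]
    change ((memLp_transOp_coe hQ f).toLp : 𝒳 → ℝ) x * ((memLp_transOp_coe hQ f).toLp : 𝒳 → ℝ) x = _
    rw [hx]
  have huv : inner ℝ u v = ∫ x, transOp Q f x * transOp Q f x ∂π := by
    rw [L2.inner_def]
    have e : (fun z => inner ℝ ((u : 𝒳 × 𝒳 → ℝ) z) ((v : 𝒳 × 𝒳 → ℝ) z)) =ᵐ[π ⊗ₘ Q]
        fun z => transOp Q f z.1 * f z.2 := by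
      have h1 := Lp.coeFn_compMeasurePreserving f hs
      have h3 := Lp.coeFn_compMeasurePreserving (transLp hQ f) hfst
      have h4 := hfst.quasiMeasurePreserving.ae_eq_comp (memLp_transOp_coe hQ f).coeFn_toLp
      filter_upwards [h1, h3, h4] with z h1 h3 h4
      simp only [RCLike.inner_apply, conj_trivial]
      rw [hu, hv, h1, h3]
      exact congrArg₂ _ h4 rfl
    have hint : Integrable (fun z : 𝒳 × 𝒳 => transOp Q f z.1 * f z.2) (π ⊗ₘ Q) :=
      (hT.comp_measurePreserving hfst).integrable_mul (h2.comp_measurePreserving hs)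
    rw [integral_congr_ae e, Measure.integral_compProd hint]
    refine integral_congr_ae (Eventually.of_forall fun x => ?_)
    simp only [integral_const_mul]
    rfl
  rw [hJ, norm_sub_sq_real, hun, hvn, huv, ← hTn]
  ring

lemma measurable_potential (Q : Kernel 𝒳 𝒳) {g : 𝒳 → ℝ} (hg : Measurable g) (n : ℕ) :
    Measurable (potential Q g n) :=
  Finset.measurable_sum _ fun j _ => measurable_transOp_iterate Q hg j

lemma measurable_poissonApprox (Q : Kernel 𝒳 𝒳) {g : 𝒳 → ℝ} (hg : Measurable g) (n : ℕ) :
    Measurable (poissonApprox Q g n) :=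
  (Finset.measurable_sum _ fun k _ => measurable_potential Q hg k).div_const _

lemma memLp_potential (hQ : Kernel.Invariant Q π) {g : 𝒳 → ℝ} (hg : Measurable g)
    (h2 : MemLp g 2 π) (n : ℕ) : MemLp (potential Q g n) 2 π :=
  memLp_finsetSum _ fun j _ => memLp_transOp_iterate hQ hg h2 j

lemma memLp_poissonApprox (hQ : Kernel.Invariant Q π) {g : 𝒳 → ℝ} (hg : Measurable g)
    (h2 : MemLp g 2 π) (n : ℕ) : MemLp (poissonApprox Q g n) 2 π := by
  have := (memLp_finsetSum (Finset.Icc 1 n) fun k _ => memLp_potential hQ hg h2 k).mul_const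
    (n : ℝ)⁻¹
  simp only [← div_eq_mul_inv] at this
  exact this

lemma toLp_finset_sum {α ι : Type*} [MeasurableSpace α] {μ : Measure α} {f : ι → α → ℝ}
    (hf : ∀ i, MemLp (f i) 2 μ) (s : Finset ι) :
    (memLp_finsetSum s fun i _ => hf i).toLp = ∑ i ∈ s, (hf i).toLp := by
  classical
  rw [Lp.ext_iff]
  refine (MemLp.coeFn_toLp _).trans ?_
  refine EventuallyEq.trans ?_ (Lp.coeFn_finsetSum s _).symm
  have : ∀ᵐ x ∂μ, ∀ i ∈ s, ((hf i).toLp : α → ℝ) x = f i x :=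
    (ae_ball_iff s.countable_toSet).2 fun i _ => (hf i).coeFn_toLp
  filter_upwards [this] with x hx
  rw [Finset.sum_apply]
  exact (Finset.sum_congr rfl hx).symm

lemma toLp_poissonApprox (hQ : Kernel.Invariant Q π) {g : 𝒳 → ℝ} (hg : Measurable g)
    (h2 : MemLp g 2 π) (n : ℕ) :
    (memLp_poissonApprox hQ hg h2 n).toLp = opPoisson (transLp hQ) h2.toLp n := by
  have h1 : ∀ k, (memLp_potential hQ hg h2 k).toLp = opPotential (transLp hQ) h2.toLp k := by
    intro k
    simp only [opPotential, transLp_pow_toLp hQ hg h2]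
    exact toLp_finset_sum (fun j => memLp_transOp_iterate hQ hg h2 j) _
  rw [opPoisson]
  simp only [← h1]
  rw [← toLp_finset_sum (fun k => memLp_potential hQ hg h2 k), ← MemLp.toLp_const_smul,
    MemLp.toLp_eq_toLp_iff]
  refine Eventually.of_forall fun x => ?_
  simp [poissonApprox, div_eq_inv_mul]

end Invariant

/-! ### Consequences of stationarity and of the Markov property. -/

lemma measurable_past {Ω 𝒳 : Type*} [MeasurableSpace 𝒳] (X : ℤ → Ω → 𝒳) {i n : ℤ} (h : i ≤ n) :
    Measurable[past X n] (X i) :=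
  Measurable.of_comap_le (le_iSup₂_of_le i h le_rfl)

namespace IsStationaryErgodicMarkovChain

variable {Ω 𝒳 : Type*} [MeasurableSpace Ω] [MeasurableSpace 𝒳] {P : Measure Ω}
  {X : ℤ → Ω → 𝒳} {Q : Kernel 𝒳 𝒳}

lemma map_shift (hX : IsStationaryErgodicMarkovChain P X Q) (m : ℕ) :
    P.map (fun ω (n : ℤ) => X (n + m) ω) = P.map fun ω n => X n ω := by
  have hm : ∀ j : ℤ, Measurable fun ω (n : ℤ) => X (n + j) ω := fun j =>
    measurable_pi_lambda _ fun n => hX.measurable _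
  have hs : Measurable (shift (𝒳 := 𝒳)) := hX.ergodic.measurable
  induction m with
  | zero => simp
  | succ m ih =>
    have h2 := hX.ergodic.toMeasurePreserving.map_eq
    conv_rhs at h2 => rw [← ih]
    conv_lhs at h2 => rw [← ih]
    rw [Measure.map_map hs (hm m), ih] at h2
    rw [← h2]
    congr 1
    funext ω n
    simp only [Function.comp, shift]
    push_cast
    congr 1
    ring

lemma map_comp_shift (hX : IsStationaryErgodicMarkovChain P X Q) (m : ℕ) {β : Type*}
    [MeasurableSpace β] {φ : (ℤ → 𝒳) → β} (hφ : Measurable φ) :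
    P.map (fun ω => φ fun n => X (n + m) ω) = P.map fun ω => φ fun n => X n ω := by
  have h := congrArg (Measure.map φ) (hX.map_shift m)
  rwa [Measure.map_map hφ (measurable_pi_lambda _ fun n => hX.measurable _),
    Measure.map_map hφ (measurable_pi_lambda _ fun n => hX.measurable _)] at h

lemma map_eq (hX : IsStationaryErgodicMarkovChain P X Q) (m : ℕ) :
    P.map (X m) = P.map (X 0) := by
  have := hX.map_comp_shift m (φ := fun x => x 0) (measurable_pi_apply 0)
  simpa using this

lemma map_pair (hX : IsStationaryErgodicMarkovChain P X Q) (m : ℕ) :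
    P.map (fun ω => (X m ω, X (m + 1) ω)) = P.map fun ω => (X 0 ω, X 1 ω) := by
  have := hX.map_comp_shift m (φ := fun x => (x 0, x 1)) (by fun_prop)
  simpa [add_comm] using this

lemma map_future (hX : IsStationaryErgodicMarkovChain P X Q) (m : ℕ) :
    P.map (fun ω (k : ℕ) => X ((m + k : ℕ) : ℤ) ω) = P.map (future X) := by
  have := hX.map_comp_shift m (φ := fun x (k : ℕ) => x k) (by fun_prop)
  have e : future X = fun ω (k : ℕ) => X (k : ℤ) ω := rfl
  rw [e]
  simpa [add_comm] using this

lemma measurable_future (hX : IsStationaryErgodicMarkovChain P X Q) : Measurable (future X) :=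
  measurable_pi_lambda _ fun _ => hX.measurable _

lemma measurePreserving (hX : IsStationaryErgodicMarkovChain P X Q) (m : ℕ) :
    MeasurePreserving (X m) P (P.map (X 0)) :=
  ⟨hX.measurable _, hX.map_eq m⟩

variable [IsProbabilityMeasure P]

lemma isProbabilityMeasure_map (hX : IsStationaryErgodicMarkovChain P X Q) :
    IsProbabilityMeasure (P.map (X 0)) :=
  Measure.isProbabilityMeasure_map (hX.measurable 0).aemeasurable

variable [IsMarkovKernel Q]

/-- The Markov property, as an identity between laws of pairs of consecutive states. -/
lemma map_restrict_pair (hX : IsStationaryErgodicMarkovChain P X Q) (k : ℤ) {B : Set Ω}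
    (hB : MeasurableSet[past X k] B) :
    (P.restrict B).map (fun ω => (X k ω, X (k + 1) ω)) = ((P.restrict B).map (X k)) ⊗ₘ Q := by
  have hk := hX.measurable k
  have hk1 := hX.measurable (k + 1)
  have hpast := past_le hX.measurable k
  have : IsFiniteMeasure ((P.restrict B).map (X k)) := by infer_instance
  refine Measure.ext_prod fun {S S'} hS hS' => ?_
  rw [Measure.compProd_apply_prod hS hS', Measure.map_apply (by fun_prop) (hS.prod hS'),
    setLIntegral_map hS (Q.measurable_coe hS') hk,
    Measure.restrict_restrict (hk hS), Measure.restrict_apply ((hk.prodMk hk1) (hS.prod hS'))]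
  have hC : MeasurableSet[past X k] (X k ⁻¹' S ∩ B) := (measurable_past X le_rfl hS).inter hB
  have e : (fun ω => (X k ω, X (k + 1) ω)) ⁻¹' S ×ˢ S' ∩ B
      = X (k + 1) ⁻¹' S' ∩ (X k ⁻¹' S ∩ B) := by
    ext ω; simp only [Set.mem_inter_iff, Set.mem_preimage, Set.mem_prod]; tauto
  rw [e]
  -- The Markov property on the past event {X_k ∈ S} ∩ B: integrating Q(X_k; S') over it gives the
  -- probability of its intersection with {X_{k+1} ∈ S'}.
  have h1 := setIntegral_condExp hpast
    (((integrable_const (μ := P) (1 : ℝ)).indicator (hk1 hS'))) hC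
  rw [setIntegral_congr_ae (hpast _ hC) ((hX.markov k S' hS').mono fun ω hω _ => hω),
    setIntegral_indicator (hk1 hS'), setIntegral_const, smul_eq_mul, mul_one,
    Set.inter_comm _ (X (k + 1) ⁻¹' S'), measureReal_def] at h1
  have h2 : ∫⁻ ω in X k ⁻¹' S ∩ B, Q (X k ω) S' ∂P
      = ENNReal.ofReal (∫ ω in X k ⁻¹' S ∩ B, (Q (X k ω)).real S' ∂P) := by
    rw [ofReal_integral_eq_lintegral_ofReal]
    · simp [measureReal_def]
    · refine Integrable.of_bound (C := 1) ?_ (Eventually.of_forall fun ω => ?_)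
      · exact ((Q.measurable_coe hS').comp hk).ennreal_toReal.aestronglyMeasurable
      · rw [Real.norm_of_nonneg measureReal_nonneg]
        exact measureReal_le_one
    · exact Eventually.of_forall fun ω => measureReal_nonneg
  rw [h2, h1, ENNReal.ofReal_toReal (measure_ne_top _ _)]

lemma map_pair_zero (hX : IsStationaryErgodicMarkovChain P X Q) :
    P.map (fun ω => (X 0 ω, X 1 ω)) = (P.map (X 0)) ⊗ₘ Q := by
  simpa using hX.map_restrict_pair 0 MeasurableSet.univ

lemma invariant (hX : IsStationaryErgodicMarkovChain P X Q) :
    Kernel.Invariant Q (P.map (X 0)) := by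
  have := hX.isProbabilityMeasure_map
  have h := congrArg Measure.snd hX.map_pair_zero
  rw [Measure.snd_compProd, Measure.snd_map_prodMk (hX.measurable 0)] at h
  rw [Kernel.Invariant, ← h]
  exact_mod_cast hX.map_eq 1

lemma measurePreserving_pair (hX : IsStationaryErgodicMarkovChain P X Q) (m : ℕ) :
    MeasurePreserving (fun ω => (X m ω, X (m + 1) ω)) P ((P.map (X 0)) ⊗ₘ Q) :=
  ⟨(hX.measurable _).prodMk (hX.measurable _), (hX.map_pair m).trans hX.map_pair_zero⟩

lemma setLIntegral_pair (hX : IsStationaryErgodicMarkovChain P X Q) (k : ℤ) {B : Set Ω}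
    (hB : MeasurableSet[past X k] B) {F : 𝒳 × 𝒳 → ENNReal} (hF : Measurable F) :
    ∫⁻ ω in B, F (X k ω, X (k + 1) ω) ∂P = ∫⁻ ω in B, ∫⁻ y, F (X k ω, y) ∂(Q (X k ω)) ∂P := by
  have hp : Measurable fun ω => (X k ω, X (k + 1) ω) :=
    (hX.measurable _).prodMk (hX.measurable _)
  rw [← lintegral_map (f := F) hF hp, hX.map_restrict_pair k hB, Measure.lintegral_compProd hF,
    lintegral_map (Measurable.lintegral_kernel_prod_right' hF) (hX.measurable k)]

/-- The increments `h(X_{k+1}) - Q h(X_k)` have zero mean on events of the past. -/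
lemma setIntegral_diff_eq_zero (hX : IsStationaryErgodicMarkovChain P X Q) (k : ℕ) {B : Set Ω}
    (hB : MeasurableSet[past X k] B) {h : 𝒳 → ℝ} (hh : Measurable h)
    (hh2 : MemLp h 2 (P.map (X 0))) :
    ∫ ω in B, (h (X (k + 1) ω) - transOp Q h (X k ω)) ∂P = 0 := by
  have := hX.isProbabilityMeasure_map
  have hp : Measurable fun ω => (X k ω, X (k + 1) ω) :=
    (hX.measurable _).prodMk (hX.measurable _)
  have hD : Measurable fun z : 𝒳 × 𝒳 => h z.2 - transOp Q h z.1 :=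
    (hh.comp measurable_snd).sub ((measurable_transOp Q hh).comp measurable_fst)
  have hint : Integrable (fun z : 𝒳 × 𝒳 => h z.2 - transOp Q h z.1)
      (((P.restrict B).map (X k)) ⊗ₘ Q) := by
    rw [← hX.map_restrict_pair k hB, integrable_map_measure hD.aestronglyMeasurable
      hp.aemeasurable]
    exact ((hX.measurePreserving_pair k).integrable_comp_of_integrable
      ((memLp_diff hX.invariant hh hh2).integrable one_le_two)).restrict
  have e := integral_map (μ := P.restrict B) hp.aemeasurable hD.aestronglyMeasurable
  rw [hX.map_restrict_pair k hB, Measure.integral_compProd hint] at e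
  rw [← e]
  refine integral_eq_zero_of_ae ?_
  have h1 : ∀ᵐ x ∂(P.map (X 0)), Integrable h (Q x) :=
    ae_integrable_of_invariant hX.invariant (hh2.integrable one_le_two)
  have h2 : ∀ᵐ x ∂((P.restrict B).map (X k)), Integrable h (Q x) := by
    rw [← hX.map_eq k] at h1
    exact (Measure.absolutelyContinuous_of_le
      (Measure.map_mono Measure.restrict_le_self (hX.measurable k))).ae_le h1
  filter_upwards [h2] with x hx
  simp [integral_sub hx (integrable_const _), transOp]

end IsStationaryErgodicMarkovChain

/-! ### Moment and maximal inequalities for martingale differences. -/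

section MartingaleDiff

variable {Ω : Type*} {mΩ : MeasurableSpace Ω} {P : Measure Ω}

/-- Square-integrable martingale differences: `D k` is known at time `k + 1` and has conditional
mean `0` given the past at time `k`. -/
structure IsMartingaleDiff (𝓕 : Filtration ℕ mΩ) (D : ℕ → Ω → ℝ) (P : Measure Ω) : Prop where
  adapted : ∀ k, StronglyMeasurable[𝓕 (k + 1)] (D k)
  memLp : ∀ k, MemLp (D k) 2 P
  condExp_eq : ∀ k, P[D k | 𝓕 k] =ᵐ[P] 0

/-- The partial sums `D_0 + ⋯ + D_{n-1}`. -/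
def psum (D : ℕ → Ω → ℝ) (n : ℕ) : Ω → ℝ := fun ω => ∑ k ∈ Finset.range n, D k ω

lemma psum_succ (D : ℕ → Ω → ℝ) (n : ℕ) : psum D (n + 1) = fun ω => psum D n ω + D n ω :=
  funext fun _ => Finset.sum_range_succ _ _

/-- The filtration shifted by `j`. -/
def shiftFiltration (𝓕 : Filtration ℕ mΩ) (j : ℕ) : Filtration ℕ mΩ where
  seq n := 𝓕 (j + n)
  mono' _ _ h := 𝓕.mono (by omega)
  le' n := 𝓕.le _

lemma integral_mul_eq_zero_of_condExp {m : MeasurableSpace Ω} (hm : m ≤ mΩ) [IsFiniteMeasure P]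
    {Y D : Ω → ℝ} (hY : StronglyMeasurable[m] Y) (hD : Integrable D P)
    (hYD : Integrable (fun ω => Y ω * D ω) P) (h0 : P[D | m] =ᵐ[P] 0) :
    ∫ ω, Y ω * D ω ∂P = 0 := by
  rw [← integral_condExp hm]
  refine integral_eq_zero_of_ae ?_
  have h := condExp_mul_of_stronglyMeasurable_left (μ := P) (f := Y) (g := D) hY hYD hD
  refine EventuallyEq.trans h ?_
  filter_upwards [h0] with ω hω
  simp [hω]

/-- Doob's maximal inequality, with the integral over the exceedance event enlarged to the whole
space. It is applied to second and fourth powers of martingales. -/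
lemma measure_exists_le_submartingale [IsFiniteMeasure P] {𝓕 : Filtration ℕ mΩ} {f : ℕ → Ω → ℝ}
    (hf : Submartingale f 𝓕 P) (h0 : 0 ≤ f) {r : ℝ} (hr : 0 < r) (n : ℕ) :
    P {ω | ∃ j ≤ n, r ≤ f j ω} ≤ ENNReal.ofReal ((∫ ω, f n ω ∂P) / r) := by
  have h := maximal_ineq hf h0 (ε := NNReal.mk r hr.le) n
  have hr' : ((NNReal.mk r hr.le : NNReal) : ENNReal) = ENNReal.ofReal r := by
    rw [ENNReal.ofReal, Real.toNNReal_of_nonneg hr.le]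
  rw [hr'] at h
  have hset : {ω | ∃ j ≤ n, r ≤ f j ω} = {ω | ((NNReal.mk r hr.le : NNReal) : ℝ) ≤
      (Finset.range (n + 1)).sup' Finset.nonempty_range_add_one fun k => f k ω} := by
    ext ω
    simp [Finset.le_sup'_iff]
  rw [hset, ENNReal.ofReal_div_of_pos hr, ENNReal.le_div_iff_mul_le (by simp [hr])
    (by simp), mul_comm]
  refine h.trans (ENNReal.ofReal_le_ofReal ?_)
  exact setIntegral_le_integral (hf.integrable n) (Eventually.of_forall fun ω => h0 n ω)

lemma submartingale_pow [IsFiniteMeasure P] {𝓕 : Filtration ℕ mΩ} {S : ℕ → Ω → ℝ}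
    (hS : Martingale S 𝓕 P) {l : ℕ} (hl : Even l) (hint : ∀ n, Integrable (fun ω => S n ω ^ l) P) :
    Submartingale (fun n ω => S n ω ^ l) 𝓕 P := by
  refine ⟨fun n => (hS.1 n).pow l, fun i j hij => ?_, hint⟩
  have h := (hl.convexOn_pow (𝕜 := ℝ)).map_condExp_le (𝓕.le i)
    ((continuous_pow l).lowerSemicontinuous.lowerSemicontinuousOn _)
    (Eventually.of_forall fun ω => Set.mem_univ (S j ω)) isClosed_univ (hS.integrable j)
    (hint j)
  filter_upwards [h, hS.2 i j hij] with ω h1 h2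
  rw [← h2]
  exact h1

namespace IsMartingaleDiff

variable {𝓕 : Filtration ℕ mΩ} {D : ℕ → Ω → ℝ}

lemma memLp_psum (hD : IsMartingaleDiff 𝓕 D P) (n : ℕ) : MemLp (psum D n) 2 P :=
  memLp_finsetSum _ fun k _ => hD.memLp k

lemma stronglyMeasurable_psum (hD : IsMartingaleDiff 𝓕 D P) (n : ℕ) :
    StronglyMeasurable[𝓕 n] (psum D n) :=
  Finset.stronglyMeasurable_fun_sum _ fun k hk =>
    (hD.adapted k).mono (𝓕.mono (by have := Finset.mem_range.1 hk; omega))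

lemma shift (hD : IsMartingaleDiff 𝓕 D P) (j : ℕ) :
    IsMartingaleDiff (shiftFiltration 𝓕 j) (fun k => D (j + k)) P where
  adapted k := hD.adapted (j + k)
  memLp k := hD.memLp (j + k)
  condExp_eq k := hD.condExp_eq (j + k)

variable [IsFiniteMeasure P]

lemma integrable (hD : IsMartingaleDiff 𝓕 D P) (k : ℕ) : Integrable (D k) P :=
  (hD.memLp k).integrable one_le_two

lemma martingale (hD : IsMartingaleDiff 𝓕 D P) : Martingale (psum D) 𝓕 P := by
  refine martingale_of_condExp_sub_eq_zero_nat hD.stronglyMeasurable_psum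
    (fun n => (hD.memLp_psum n).integrable one_le_two) fun n => ?_
  have : psum D (n + 1) - psum D n = D n := by
    rw [psum_succ]; ext ω; simp
  rw [this]
  exact hD.condExp_eq n

lemma integral_psum_sq (hD : IsMartingaleDiff 𝓕 D P) (n : ℕ) :
    ∫ ω, psum D n ω ^ 2 ∂P = ∑ k ∈ Finset.range n, ∫ ω, D k ω ^ 2 ∂P := by
  induction n with
  | zero => simp [psum]
  | succ n ih =>
    have h1 : Integrable (fun ω => psum D n ω * D n ω) P :=
      (hD.memLp_psum n).integrable_mul (hD.memLp n)
    have h2 := integral_mul_eq_zero_of_condExp (𝓕.le n) (hD.stronglyMeasurable_psum n)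
      (hD.integrable n) h1 (hD.condExp_eq n)
    have e : (fun ω => psum D (n + 1) ω ^ 2)
        = fun ω => psum D n ω ^ 2 + (2 * (psum D n ω * D n ω) + D n ω ^ 2) := by
      rw [psum_succ]; ext ω; ring
    have h3 : Integrable (fun ω => 2 * (psum D n ω * D n ω) + D n ω ^ 2) P :=
      (h1.const_mul 2).add (hD.memLp n).integrable_sq
    rw [e, integral_add (hD.memLp_psum n).integrable_sq h3,
      integral_add (h1.const_mul 2) (hD.memLp n).integrable_sq, integral_const_mul, h2, ih,
      Finset.sum_range_succ]
    ring

lemma indicator (hD : IsMartingaleDiff 𝓕 D P) {B : Set Ω} (hB : MeasurableSet[𝓕 0] B) :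
    IsMartingaleDiff 𝓕 (fun k => B.indicator (D k)) P where
  adapted k := (hD.adapted k).indicator (𝓕.mono (Nat.zero_le _) _ hB)
  memLp k := (hD.memLp k).indicator (𝓕.le 0 _ hB)
  condExp_eq k := by
    refine (condExp_indicator (hD.integrable k) (𝓕.mono (Nat.zero_le k) _ hB)).trans ?_
    filter_upwards [hD.condExp_eq k] with ω hω
    by_cases h : ω ∈ B <;> simp [h, hω]

/-- Kolmogorov's inequality. -/
lemma measure_exists_le_psum (hD : IsMartingaleDiff 𝓕 D P) {r : ℝ} (hr : 0 < r) (n : ℕ) :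
    P {ω | ∃ j ≤ n, r ≤ |psum D j ω|}
      ≤ ENNReal.ofReal ((∑ k ∈ Finset.range n, ∫ ω, D k ω ^ 2 ∂P) / r ^ 2) := by
  have h := measure_exists_le_submartingale (submartingale_pow hD.martingale even_two
    fun n => (hD.memLp_psum n).integrable_sq) (fun n ω => sq_nonneg (psum D n ω))
    (pow_pos hr 2) n
  rw [hD.integral_psum_sq] at h
  refine (measure_mono fun ω => ?_).trans h
  rintro ⟨j, hj, h⟩
  exact ⟨j, hj, by rw [← sq_abs (psum D j ω)]; gcongr⟩

/-- The fourth moment of a martingale with bounded increments that live on an event `B`. -/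
lemma integral_psum_pow_four_le (hD : IsMartingaleDiff 𝓕 D P) {c : ℝ} (hc : 0 ≤ c) {B : Set Ω}
    (hB : MeasurableSet B) (hDc : ∀ k, ∀ᵐ ω ∂P, |D k ω| ≤ B.indicator (fun _ => c) ω) (n : ℕ) :
    Integrable (fun ω => psum D n ω ^ 4) P ∧
      ∫ ω, psum D n ω ^ 4 ∂P ≤ 7 * (n : ℝ) ^ 2 * c ^ 4 * P.real B := by
  have hDc' : ∀ k, ∀ᵐ ω ∂P, |D k ω| ≤ c := fun k => (hDc k).mono fun ω h => h.trans <| by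
    by_cases hω : ω ∈ B <;> simp [hω, hc]
  have hb : ∀ n, ∀ᵐ ω ∂P, |psum D n ω| ≤ n * c := fun n => by
    filter_upwards [ae_all_iff.2 hDc'] with ω h
    refine (Finset.abs_sum_le_sum_abs _ _).trans ((Finset.sum_le_sum fun k _ => h k).trans ?_)
    simp
  have hm : ∀ n, AEStronglyMeasurable (psum D n) P := fun n => (hD.memLp_psum n).1
  have hi : ∀ n i j : ℕ, Integrable (fun ω => psum D n ω ^ i * D n ω ^ j) P := fun n i j => by
    refine Integrable.of_bound (C := (n * c) ^ i * c ^ j)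
      (((hm n).pow i).mul ((hD.memLp n).1.pow j)) ?_
    filter_upwards [hb n, hDc' n] with ω h1 h2
    rw [norm_mul, norm_pow, norm_pow, Real.norm_eq_abs, Real.norm_eq_abs]
    gcongr
  have hi4 : ∀ n, Integrable (fun ω => psum D n ω ^ 4) P := fun n => by
    simpa using hi n 4 0
  refine ⟨hi4 n, ?_⟩
  have hsq : ∀ k, ∫ ω, D k ω ^ 2 ∂P ≤ c ^ 2 * P.real B := fun k => by
    calc ∫ ω, D k ω ^ 2 ∂P ≤ ∫ ω, B.indicator (fun _ => c ^ 2) ω ∂P := by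
          refine integral_mono_ae (hD.memLp k).integrable_sq
            ((integrable_const _).indicator hB) ?_
          filter_upwards [hDc k] with ω h
          by_cases hω : ω ∈ B
          · simp only [hω, Set.indicator_of_mem] at h ⊢
            rw [← sq_abs]; gcongr
          · simp only [hω, not_false_eq_true, Set.indicator_of_notMem] at h ⊢
            simp [abs_nonpos_iff.1 h]
      _ = c ^ 2 * P.real B := by
          rw [integral_indicator hB, setIntegral_const, smul_eq_mul, mul_comm]
  have hsq' : ∀ n : ℕ, ∫ ω, psum D n ω ^ 2 ∂P ≤ n * (c ^ 2 * P.real B) := fun n => by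
    rw [hD.integral_psum_sq]
    refine (Finset.sum_le_sum fun k _ => hsq k).trans ?_
    simp
  induction n with
  | zero => simp [psum]
  | succ n ih =>
    have h0 : ∫ ω, psum D n ω ^ 3 * D n ω ∂P = 0 := by
      refine integral_mul_eq_zero_of_condExp (𝓕.le n) ((hD.stronglyMeasurable_psum n).pow 3)
        (hD.integrable n) ?_ (hD.condExp_eq n)
      simpa using hi n 3 1
    have hi31 : Integrable (fun ω => psum D n ω ^ 3 * D n ω) P := by simpa using hi n 3 1
    have hS2 := (hD.memLp_psum n).integrable_sq
    have hD2 := (hD.memLp n).integrable_sq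
    have hA : Integrable (fun ω => 8 * c ^ 2 * psum D n ω ^ 2 + 3 * c ^ 2 * D n ω ^ 2) P :=
      (hS2.const_mul _).add (hD2.const_mul _)
    have hA' : Integrable (fun ω => 4 * (psum D n ω ^ 3 * D n ω) +
        (8 * c ^ 2 * psum D n ω ^ 2 + 3 * c ^ 2 * D n ω ^ 2)) P := (hi31.const_mul 4).add hA
    -- In the expansion of (s + d)⁴, use 4sd³ ≤ 2d²s² + 2d⁴ and d² ≤ c². The cubic term 4s³d has
    -- mean zero, so the step adds at most (8n + 3)c⁴ P(B), below 7((n+1)² − n²)c⁴ P(B).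
    have hle : ∫ ω, psum D (n + 1) ω ^ 4 ∂P ≤ ∫ ω, (psum D n ω ^ 4 +
        (4 * (psum D n ω ^ 3 * D n ω) + (8 * c ^ 2 * psum D n ω ^ 2
          + 3 * c ^ 2 * D n ω ^ 2))) ∂P := by
      refine integral_mono_ae (hi4 _) ((hi4 n).add hA') ?_
      filter_upwards [hDc' n] with ω h
      simp only [psum_succ]
      have h2 : D n ω ^ 2 ≤ c ^ 2 := by rw [← sq_abs]; gcongr
      generalize psum D n ω = s at *
      generalize D n ω = d at *
      have h3 : d ^ 2 * s ^ 2 ≤ c ^ 2 * s ^ 2 := by gcongr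
      have h4 : d ^ 2 * d ^ 2 ≤ c ^ 2 * d ^ 2 := by gcongr
      nlinarith [mul_nonneg (sq_nonneg d) (sq_nonneg (s - d))]
    rw [integral_add (hi4 n) hA', integral_add (hi31.const_mul 4) hA, integral_add (hS2.const_mul _)
        (hD2.const_mul _), integral_const_mul, integral_const_mul, integral_const_mul, h0] at hle
    have h5 := mul_le_mul_of_nonneg_left (hsq' n) (by positivity : 0 ≤ 8 * c ^ 2)
    have h6 := mul_le_mul_of_nonneg_left (hsq n) (by positivity : 0 ≤ 3 * c ^ 2)
    have hp : 0 ≤ c ^ 4 * P.real B := by positivity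
    have hn : (0 : ℝ) ≤ n := by positivity
    push_cast
    nlinarith

/-- Doob's inequality for the fourth power. The factor P B is retained so that the estimate can
later be disintegrated over X_0. -/
lemma measure_exists_le_psum_of_bounded (hD : IsMartingaleDiff 𝓕 D P) {c : ℝ} (hc : 0 ≤ c)
    {B : Set Ω} (hB : MeasurableSet B)
    (hDc : ∀ k, ∀ᵐ ω ∂P, |D k ω| ≤ B.indicator (fun _ => c) ω) {r : ℝ} (hr : 0 < r) (n : ℕ) :
    P {ω | ∃ j ≤ n, r ≤ |psum D j ω|}
      ≤ ENNReal.ofReal (7 * (n : ℝ) ^ 2 * c ^ 4 / r ^ 4) * P B := by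
  have hev : Even 4 := ⟨2, rfl⟩
  have h := measure_exists_le_submartingale (submartingale_pow hD.martingale hev
    fun n => (hD.integral_psum_pow_four_le hc hB hDc n).1) (fun n ω => hev.pow_nonneg (psum D n ω))
    (pow_pos hr 4) n
  refine ((measure_mono fun ω => ?_).trans h).trans ?_
  · rintro ⟨j, hj, h⟩
    exact ⟨j, hj, by rw [← hev.pow_abs (psum D j ω)]; gcongr⟩
  · rw [← ofReal_measureReal, ← ENNReal.ofReal_mul (by positivity)]
    refine ENNReal.ofReal_le_ofReal ?_
    rw [div_mul_eq_mul_div]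
    gcongr
    exact (hD.integral_psum_pow_four_le hc hB hDc n).2

end IsMartingaleDiff

end MartingaleDiff

/-! ### The L² norm as a real number. -/

section L2

variable {α : Type*} [MeasurableSpace α] {μ : Measure α}

/-- The `L²` norm, as a real number. -/
def l2 (μ : Measure α) (f : α → ℝ) : ℝ := (eLpNorm f 2 μ).toReal

lemma l2_nonneg (f : α → ℝ) : 0 ≤ l2 μ f := ENNReal.toReal_nonneg

lemma l2_eq_norm {f : α → ℝ} (hf : MemLp f 2 μ) : l2 μ f = ‖hf.toLp‖ := (Lp.norm_toLp f hf).symm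

lemma l2_sq {f : α → ℝ} (hf : MemLp f 2 μ) : l2 μ f ^ 2 = ∫ x, f x ^ 2 ∂μ := by
  rw [l2_eq_norm hf, ← real_inner_self_eq_norm_sq, L2.inner_def]
  refine integral_congr_ae ?_
  filter_upwards [hf.coeFn_toLp] with x hx
  simp [hx, pow_two]

lemma l2_add_le {f g : α → ℝ} (hf : MemLp f 2 μ) (hg : MemLp g 2 μ) :
    l2 μ (fun x => f x + g x) ≤ l2 μ f + l2 μ g := by
  have : l2 μ (fun x => f x + g x) = ‖hf.toLp + hg.toLp‖ := by
    rw [← MemLp.toLp_add]; exact l2_eq_norm (hf.add hg)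
  rw [this, l2_eq_norm hf, l2_eq_norm hg]
  exact norm_add_le _ _

lemma l2_sub_le {f g : α → ℝ} (hf : MemLp f 2 μ) (hg : MemLp g 2 μ) :
    l2 μ (fun x => f x - g x) ≤ l2 μ f + l2 μ g := by
  have : l2 μ (fun x => f x - g x) = ‖hf.toLp - hg.toLp‖ := by
    rw [← MemLp.toLp_sub]; exact l2_eq_norm (hf.sub hg)
  rw [this, l2_eq_norm hf, l2_eq_norm hg]
  exact norm_sub_le _ _

lemma abs_l2_sub_l2_le {f g : α → ℝ} (hf : MemLp f 2 μ) (hg : MemLp g 2 μ) :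
    |l2 μ f - l2 μ g| ≤ l2 μ (fun x => f x - g x) := by
  have : l2 μ (fun x => f x - g x) = ‖hf.toLp - hg.toLp‖ := by
    rw [← MemLp.toLp_sub]; exact l2_eq_norm (hf.sub hg)
  rw [this, l2_eq_norm hf, l2_eq_norm hg]
  exact abs_norm_sub_norm_le _ _

lemma l2_sum_le {ι : Type*} {f : ι → α → ℝ} (hf : ∀ i, MemLp (f i) 2 μ) (s : Finset ι) :
    l2 μ (fun x => ∑ i ∈ s, f i x) ≤ ∑ i ∈ s, l2 μ (f i) := by
  rw [l2_eq_norm (memLp_finsetSum s fun i _ => hf i), toLp_finset_sum hf]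
  simp only [fun i => l2_eq_norm (hf i)]
  exact norm_sum_le _ _

lemma l2_comp {β : Type*} [MeasurableSpace β] {ν : Measure β} {φ : α → β}
    (hφ : MeasurePreserving φ μ ν) {f : β → ℝ} (hf : AEStronglyMeasurable f ν) :
    l2 μ (fun x => f (φ x)) = l2 ν f := by
  rw [l2, l2, ← eLpNorm_comp_measurePreserving hf hφ]; rfl

end L2

/-! ### Sums along paths and their martingale–coboundary decomposition. -/

section Paths

variable {𝒳 : Type*} [MeasurableSpace 𝒳]

omit [MeasurableSpace 𝒳] in
lemma pathS_eq (g : 𝒳 → ℝ) (n : ℕ) (x : ℕ → 𝒳) :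
    pathS g n x = ∑ k ∈ Finset.range n, g (x (k + 1)) := by
  rw [pathS, Finset.range_eq_Ico, Finset.sum_Ico_add' (fun k => g (x k)) 0 n 1]
  rfl

omit [MeasurableSpace 𝒳] in
lemma pathM_eq (H : 𝒳 × 𝒳 → ℝ) (n : ℕ) (x : ℕ → 𝒳) :
    pathM H n x = ∑ k ∈ Finset.range n, H (x k, x (k + 1)) := by
  have h := Finset.sum_Ico_add' (fun k => H (x (k - 1), x k)) 0 n 1
  rw [Finset.range_eq_Ico]
  exact h.symm

lemma pathS_add (g : 𝒳 → ℝ) (m n : ℕ) (x : ℕ → 𝒳) :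
    pathS g (m + n) x = pathS g m x + pathS g n fun k => x (m + k) := by
  simp [pathS_eq, Finset.sum_range_add, add_assoc]

lemma pathM_add (H : 𝒳 × 𝒳 → ℝ) (m n : ℕ) (x : ℕ → 𝒳) :
    pathM H (m + n) x = pathM H m x + pathM H n fun k => x (m + k) := by
  simp [pathM_eq, Finset.sum_range_add, add_assoc]

@[fun_prop]
lemma measurable_pathS {g : 𝒳 → ℝ} (hg : Measurable g) (n : ℕ) : Measurable (pathS g n) := by
  unfold pathS; fun_prop

@[fun_prop]
lemma measurable_pathM {H : 𝒳 × 𝒳 → ℝ} (hH : Measurable H) (n : ℕ) : Measurable (pathM H n) := by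
  unfold pathM; fun_prop

/-- The sum `S_n` is a martingale plus a coboundary plus a small remainder. -/
lemma pathS_sub_pathM_poissonDiff (Q : Kernel 𝒳 𝒳) (g : 𝒳 → ℝ) (l n : ℕ) (x : ℕ → 𝒳) :
    pathS g n x - pathM (poissonDiff Q g l) n x =
      (transOp Q (poissonApprox Q g l) (x 0) - transOp Q (poissonApprox Q g l) (x n))
      + ∑ k ∈ Finset.range n, (g (x (k + 1)) - (poissonApprox Q g l (x (k + 1))
        - transOp Q (poissonApprox Q g l) (x (k + 1)))) := by
  rw [pathS_eq, pathM_eq]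
  induction n with
  | zero => simp
  | succ n ih =>
    rw [Finset.sum_range_succ, Finset.sum_range_succ, Finset.sum_range_succ, add_sub_add_comm, ih]
    simp only [poissonDiff]
    ring

end Paths

/-- The sum `Q g + ⋯ + Qⁿ g`. -/
def orbitFun {𝒳 : Type*} [MeasurableSpace 𝒳] (Q : Kernel 𝒳 𝒳) (g : 𝒳 → ℝ) (n : ℕ) : 𝒳 → ℝ :=
  fun x => ∑ i ∈ Finset.range n, ((transOp Q)^[i + 1] g) x

section OrbitFun

variable {𝒳 : Type*} [MeasurableSpace 𝒳] {Q : Kernel 𝒳 𝒳} [IsMarkovKernel Q]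
  {π : Measure 𝒳} [IsProbabilityMeasure π]

lemma memLp_orbitFun (hQ : Kernel.Invariant Q π) {g : 𝒳 → ℝ} (hg : Measurable g)
    (h2 : MemLp g 2 π) (n : ℕ) : MemLp (orbitFun Q g n) 2 π :=
  memLp_finsetSum _ fun i _ => memLp_transOp_iterate hQ hg h2 (i + 1)

lemma toLp_orbitFun (hQ : Kernel.Invariant Q π) {g : 𝒳 → ℝ} (hg : Measurable g)
    (h2 : MemLp g 2 π) (n : ℕ) :
    (memLp_orbitFun hQ hg h2 n).toLp = orbitSum (transLp hQ) h2.toLp n := by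
  simp only [orbitSum, transLp_pow_toLp hQ hg h2]
  exact toLp_finset_sum (fun i => memLp_transOp_iterate hQ hg h2 (i + 1)) _

/-- The identity `opPoisson_sub` read for functions: the error in Poisson's equation is V_n/n. -/
lemma l2_sub_poissonApprox (hQ : Kernel.Invariant Q π) {g : 𝒳 → ℝ} (hg : Measurable g)
    (h2 : MemLp g 2 π) {n : ℕ} (hn : n ≠ 0) :
    n * l2 π (fun x => g x - (poissonApprox Q g n x - transOp Q (poissonApprox Q g n) x))
      = l2 π (orbitFun Q g n) := by
  have hp := memLp_poissonApprox hQ hg h2 n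
  have hT := memLp_transOp hQ (measurable_poissonApprox Q hg n) hp
  have e := opPoisson_sub (transLp hQ) h2.toLp hn
  rw [← toLp_poissonApprox hQ hg h2, transLp_toLp hQ (measurable_poissonApprox Q hg n) hp,
    ← toLp_orbitFun hQ hg h2, eq_sub_iff_add_eq', ← eq_sub_iff_add_eq] at e
  have hsub : MemLp (fun x => g x - (poissonApprox Q g n x - transOp Q (poissonApprox Q g n) x))
    2 π := h2.sub (hp.sub hT)
  have e2 : hsub.toLp = h2.toLp - (hp.toLp - hT.toLp) := by
    rw [← MemLp.toLp_sub, ← MemLp.toLp_sub]; rfl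
  have hn' : (n : ℝ) ≠ 0 := by exact_mod_cast hn
  rw [l2_eq_norm hsub, l2_eq_norm (memLp_orbitFun hQ hg h2 n), e2, ← e, norm_smul, norm_inv,
    Real.norm_natCast, mul_inv_cancel_left₀ hn']

end OrbitFun

/-- The increments `H(X_k, X_{k+1})` of the martingale. -/
def pairSeq {Ω 𝒳 : Type*} (X : ℤ → Ω → 𝒳) (H : 𝒳 × 𝒳 → ℝ) (k : ℕ) : Ω → ℝ :=
  fun ω => H (X k ω, X (k + 1) ω)

lemma pathM_future {Ω 𝒳 : Type*} [MeasurableSpace 𝒳] (X : ℤ → Ω → 𝒳) (H : 𝒳 × 𝒳 → ℝ) (n : ℕ)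
    (ω : Ω) : pathM H n (future X ω) = psum (pairSeq X H) n ω := by
  rw [pathM_eq]
  simp [psum, pairSeq, future]

namespace IsStationaryErgodicMarkovChain

variable {Ω 𝒳 : Type*} [MeasurableSpace Ω] [MeasurableSpace 𝒳] {P : Measure Ω}
  [IsProbabilityMeasure P] {X : ℤ → Ω → 𝒳} {Q : Kernel 𝒳 𝒳} [IsMarkovKernel Q]

/-- The Markov property at time i replaces f(X_{i+1}) by Qf(X_i); B lies in the past of 0, hence in
that of i, so this can be repeated down to time 0. -/
lemma setIntegral_comp_eq (hX : IsStationaryErgodicMarkovChain P X Q) {B : Set Ω}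
    (hB : MeasurableSet[past X 0] B) (i : ℕ) {f : 𝒳 → ℝ} (hf : Measurable f)
    (h2 : MemLp f 2 (P.map (X 0))) :
    ∫ ω in B, f (X i ω) ∂P = ∫ ω in B, ((transOp Q)^[i] f) (X 0 ω) ∂P := by
  have := hX.isProbabilityMeasure_map
  induction i generalizing f with
  | zero => simp
  | succ i ih =>
    have hT := memLp_transOp hX.invariant hf h2
    rw [Function.iterate_succ_apply, ← ih (measurable_transOp Q hf) hT, ← sub_eq_zero,
      ← integral_sub]
    · exact_mod_cast hX.setIntegral_diff_eq_zero i (past_mono X (by positivity) B hB) hf h2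
    · exact ((h2.comp_measurePreserving (hX.measurePreserving (i + 1))).integrable
        one_le_two).restrict
    · exact ((hT.comp_measurePreserving (hX.measurePreserving i)).integrable one_le_two).restrict

omit [IsProbabilityMeasure P] [IsMarkovKernel Q] in
lemma memLp_pathS (hX : IsStationaryErgodicMarkovChain P X Q) {g : 𝒳 → ℝ}
    (h2 : MemLp g 2 (P.map (X 0))) (n : ℕ) :
    MemLp (fun ω => pathS g n (future X ω)) 2 P :=
  memLp_finsetSum _ fun k _ => h2.comp_measurePreserving (hX.measurePreserving k)

/-- This turns the probabilistic hypothesis on E(S_n | X_0) into one on the orbit sums of Q in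
L²(π). -/
lemma condExp_pathS (hX : IsStationaryErgodicMarkovChain P X Q) {g : 𝒳 → ℝ} (hg : Measurable g)
    (h2 : MemLp g 2 (P.map (X 0))) (n : ℕ) :
    P[fun ω => pathS g n (future X ω) | MeasurableSpace.comap (X 0) inferInstance]
      =ᵐ[P] fun ω => orbitFun Q g n (X 0 ω) := by
  have := hX.isProbabilityMeasure_map
  have hm : MeasurableSpace.comap (X 0) inferInstance ≤ past X 0 :=
    le_iSup₂_of_le (f := fun i (_ : i ≤ (0 : ℤ)) => MeasurableSpace.comap (X i) inferInstance)
      0 le_rfl le_rfl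
  have hmeas : Measurable (orbitFun Q g n) :=
    Finset.measurable_sum _ fun i _ => measurable_transOp_iterate Q hg (i + 1)
  have hi1 : ∀ i : ℕ, Integrable (fun ω => g (X (i : ℤ) ω)) P := fun i =>
    (h2.comp_measurePreserving (hX.measurePreserving i)).integrable one_le_two
  have hi2 : ∀ i : ℕ, Integrable (fun ω => ((transOp Q)^[i] g) (X 0 ω)) P := fun i =>
    ((memLp_transOp_iterate hX.invariant hg h2 i).comp_measurePreserving
      (hX.measurePreserving 0)).integrable one_le_two
  symm
  refine ae_eq_condExp_of_forall_setIntegral_eq (hX.measurable 0).comap_le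
    ((hX.memLp_pathS h2 n).integrable one_le_two) (fun s _ _ => ?_) (fun s hs _ => ?_) ?_
  · exact (((memLp_orbitFun hX.invariant hg h2 n).comp_measurePreserving
      (hX.measurePreserving 0)).integrable one_le_two).restrict
  · simp only [orbitFun, pathS_eq, future]
    rw [integral_finsetSum _ fun i _ => (hi2 (i + 1)).restrict,
      integral_finsetSum _ fun i _ => (hi1 (i + 1)).restrict]
    refine Finset.sum_congr rfl fun i _ => ?_
    exact (hX.setIntegral_comp_eq (hm s hs) (i + 1) hg h2).symm
  · exact (hmeas.comp (comap_measurable (X 0))).aestronglyMeasurable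

lemma l2_condExp_pathS (hX : IsStationaryErgodicMarkovChain P X Q) {g : 𝒳 → ℝ}
    (hg : Measurable g) (h2 : MemLp g 2 (P.map (X 0))) (n : ℕ) :
    (eLpNorm (P[fun ω => pathS g n (future X ω) |
      MeasurableSpace.comap (X 0) inferInstance]) 2 P).toReal = l2 (P.map (X 0)) (orbitFun Q g n) := by
  have := hX.isProbabilityMeasure_map
  rw [eLpNorm_congr_ae (hX.condExp_pathS hg h2 n)]
  exact l2_comp (hX.measurePreserving 0) (memLp_orbitFun hX.invariant hg h2 n).1

omit [IsProbabilityMeasure P] [IsMarkovKernel Q] in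
lemma stronglyMeasurable_pairSeq (hX : IsStationaryErgodicMarkovChain P X Q) {H : 𝒳 × 𝒳 → ℝ}
    (hH : Measurable H) (k : ℕ) :
    StronglyMeasurable[pastFiltration X hX.measurable (k + 1)] (pairSeq X H k) := by
  have h1 : Measurable[past X ((k + 1 : ℕ) : ℤ)] (X k) := measurable_past X (by simp)
  have h2 : Measurable[past X ((k + 1 : ℕ) : ℤ)] (X (k + 1)) := measurable_past X (by simp)
  exact (hH.comp (h1.prodMk h2)).stronglyMeasurable

lemma memLp_pairSeq (hX : IsStationaryErgodicMarkovChain P X Q) {H : 𝒳 × 𝒳 → ℝ}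
    (h2 : MemLp H 2 ((P.map (X 0)) ⊗ₘ Q)) (k : ℕ) : MemLp (pairSeq X H k) 2 P :=
  h2.comp_measurePreserving (hX.measurePreserving_pair k)

lemma isMartingaleDiff_of_setIntegral (hX : IsStationaryErgodicMarkovChain P X Q)
    {H : 𝒳 × 𝒳 → ℝ} (hH : Measurable H) (h2 : MemLp H 2 ((P.map (X 0)) ⊗ₘ Q))
    (h0 : ∀ (k : ℕ) (B : Set Ω), MeasurableSet[past X k] B → ∫ ω in B, pairSeq X H k ω ∂P = 0) :
    IsMartingaleDiff (pastFiltration X hX.measurable) (pairSeq X H) P where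
  adapted k := hX.stronglyMeasurable_pairSeq hH k
  memLp k := hX.memLp_pairSeq h2 k
  condExp_eq k := by
    symm
    refine ae_eq_condExp_of_forall_setIntegral_eq ((pastFiltration X hX.measurable).le k)
      ((hX.memLp_pairSeq h2 k).integrable one_le_two) (fun s _ _ => integrableOn_zero)
      (fun s hs _ => ?_) aestronglyMeasurable_zero
    rw [h0 k s hs]
    simp

lemma memLp_poissonDiff (hX : IsStationaryErgodicMarkovChain P X Q) {g : 𝒳 → ℝ}
    (hg : Measurable g) (h2 : MemLp g 2 (P.map (X 0))) (n : ℕ) :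
    MemLp (poissonDiff Q g n) 2 ((P.map (X 0)) ⊗ₘ Q) := by
  have := hX.isProbabilityMeasure_map
  exact memLp_diff hX.invariant (measurable_poissonApprox Q hg n)
    (memLp_poissonApprox hX.invariant hg h2 n)

lemma setIntegral_pairSeq_poissonDiff (hX : IsStationaryErgodicMarkovChain P X Q) {g : 𝒳 → ℝ}
    (hg : Measurable g) (h2 : MemLp g 2 (P.map (X 0))) (n k : ℕ) {B : Set Ω}
    (hB : MeasurableSet[past X k] B) : ∫ ω in B, pairSeq X (poissonDiff Q g n) k ω ∂P = 0 := by
  have := hX.isProbabilityMeasure_map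
  exact hX.setIntegral_diff_eq_zero k hB (measurable_poissonApprox Q hg n)
    (memLp_poissonApprox hX.invariant hg h2 n)

/-- The martingale property passes to the limit: H_n(X_k, X_{k+1}) has zero mean on past events and
converges to H(X_k, X_{k+1}) in L², hence in L¹. -/
lemma setIntegral_pairSeq_eq_zero (hX : IsStationaryErgodicMarkovChain P X Q) {g : 𝒳 → ℝ}
    (hg : Measurable g) (h2 : MemLp g 2 (P.map (X 0))) {H : 𝒳 × 𝒳 → ℝ}
    (hH : IsLimitDiff ((P.map (X 0)) ⊗ₘ Q) Q g H) (k : ℕ) {B : Set Ω}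
    (hB : MeasurableSet[past X k] B) : ∫ ω in B, pairSeq X H k ω ∂P = 0 := by
  have := hX.isProbabilityMeasure_map
  have hd := hX.memLp_poissonDiff hg h2
  have ht : Tendsto (fun n => eLpNorm (pairSeq X (poissonDiff Q g n) k - pairSeq X H k) 1 P)
      atTop (𝓝 0) := by
    refine tendsto_of_tendsto_of_tendsto_of_le_of_le tendsto_const_nhds hH.tendsto
      (fun _ => zero_le) fun n => ?_
    refine (eLpNorm_le_eLpNorm_of_exponent_le one_le_two
      ((hX.memLp_pairSeq (hd n) k).sub (hX.memLp_pairSeq hH.memLp k)).1).trans (le_of_eq ?_)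
    exact eLpNorm_comp_measurePreserving ((hd n).sub hH.memLp).1 (hX.measurePreserving_pair k)
  have h := tendsto_setIntegral_of_L1' (pairSeq X H k)
    (hX.memLp_pairSeq hH.memLp k).1
    (Eventually.of_forall fun n => (hX.memLp_pairSeq (hd n) k).integrable one_le_two) ht B
  simp only [hX.setIntegral_pairSeq_poissonDiff hg h2 _ k hB] at h
  exact tendsto_nhds_unique h tendsto_const_nhds

end IsStationaryErgodicMarkovChain

/-- The remainder `R_n = S_n - M_n` along a path. -/
def pathR {𝒳 : Type*} [MeasurableSpace 𝒳] (g : 𝒳 → ℝ) (H : 𝒳 × 𝒳 → ℝ) (n : ℕ) (x : ℕ → 𝒳) : ℝ :=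
  pathS g n x - pathM H n x

@[fun_prop]
lemma measurable_pathR {𝒳 : Type*} [MeasurableSpace 𝒳] {g : 𝒳 → ℝ} {H : 𝒳 × 𝒳 → ℝ}
    (hg : Measurable g) (hH : Measurable H) (n : ℕ) : Measurable (pathR g H n) := by
  unfold pathR; fun_prop

lemma pathR_add {𝒳 : Type*} [MeasurableSpace 𝒳] (g : 𝒳 → ℝ) (H : 𝒳 × 𝒳 → ℝ) (m n : ℕ)
    (x : ℕ → 𝒳) : pathR g H (m + n) x - pathR g H m x = pathR g H n fun k => x (m + k) := by
  simp only [pathR, pathS_add, pathM_add]; ring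

/-! ### The limit H and the L² size of the remainder. -/

section Existence

variable {𝒳 : Type*} [MeasurableSpace 𝒳] {Q : Kernel 𝒳 𝒳} [IsMarkovKernel Q]
  {π : Measure 𝒳} [IsProbabilityMeasure π] {g : 𝒳 → ℝ} {q : ℝ}

lemma isLittleO_norm_orbitSum (hQ : Kernel.Invariant Q π) (hg : Measurable g)
    (h2 : MemLp g 2 π) (ha : (fun n => l2 π (orbitFun Q g n)) =o[atTop] logRate q) :
    (fun n => ‖orbitSum (transLp hQ) h2.toLp n‖) =o[atTop] logRate q := by
  refine ha.congr_left fun n => ?_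
  rw [l2_eq_norm (memLp_orbitFun hQ hg h2 n), toLp_orbitFun hQ hg]

lemma diffLp_opPoisson (hQ : Kernel.Invariant Q π) (hg : Measurable g) (h2 : MemLp g 2 π) (n : ℕ) :
    ∃ h : MemLp (poissonDiff Q g n) 2 (π ⊗ₘ Q),
      diffLp hQ (opPoisson (transLp hQ) h2.toLp n) = h.toLp :=
  ⟨memLp_diff hQ (measurable_poissonApprox Q hg n) (memLp_poissonApprox hQ hg h2 n), by
    rw [← toLp_poissonApprox hQ hg h2, diffLp_toLp hQ (measurable_poissonApprox Q hg n)]; rfl⟩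

lemma exists_isLimitDiff (hQ : Kernel.Invariant Q π) (hg : Measurable g) (h2 : MemLp g 2 π)
    (hq : 2 ≤ q) (ha : (fun n => l2 π (orbitFun Q g n)) =o[atTop] logRate q) :
    ∃ H, IsLimitDiff (π ⊗ₘ Q) Q g H := by
  obtain ⟨y, hy⟩ := cauchySeq_tendsto_of_complete (cauchySeq_map_opPoisson (norm_diffLp_sq hQ) hq
    (isLittleO_norm_orbitSum hQ hg h2 ha))
  have hy2 := Lp.memLp y
  refine ⟨y, (Lp.stronglyMeasurable y).measurable, hy2, ?_⟩
  have h := (Lp.tendsto_Lp_iff_tendsto_eLpNorm' _ _).1 hy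
  refine h.congr fun n => ?_
  obtain ⟨hn, e⟩ := diffLp_opPoisson hQ hg h2 n
  rw [e]
  exact eLpNorm_congr_ae (hn.coeFn_toLp.sub (EventuallyEq.refl _ _))

lemma isLittleO_l2_poissonDiff_sub (hQ : Kernel.Invariant Q π) (hg : Measurable g)
    (h2 : MemLp g 2 π) (hq : 2 ≤ q)
    (ha : (fun n => l2 π (orbitFun Q g n)) =o[atTop] logRate q) {H : 𝒳 × 𝒳 → ℝ}
    (hH : IsLimitDiff (π ⊗ₘ Q) Q g H) :
    (fun n => l2 (π ⊗ₘ Q) (poissonDiff Q g n - H)) =o[atTop] fun n : ℕ => Real.log n ^ (1 - q) := by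
  have key : ∀ n, ‖diffLp hQ (opPoisson (transLp hQ) h2.toLp n) - hH.memLp.toLp‖
      = l2 (π ⊗ₘ Q) (poissonDiff Q g n - H) := by
    intro n
    obtain ⟨hn, e⟩ := diffLp_opPoisson hQ hg h2 n
    rw [e, ← MemLp.toLp_sub, l2_eq_norm (hn.sub hH.memLp)]
  refine (isLittleO_map_opPoisson_sub (norm_diffLp_sq hQ) hq
    (isLittleO_norm_orbitSum hQ hg h2 ha) (y := hH.memLp.toLp) ?_).congr_left key
  rw [tendsto_iff_norm_sub_tendsto_zero]
  simp only [key]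
  exact (ENNReal.tendsto_toReal ENNReal.zero_ne_top).comp hH.tendsto

lemma isLittleO_l2_poissonApprox (hQ : Kernel.Invariant Q π) (hg : Measurable g)
    (h2 : MemLp g 2 π) (hq : 0 < q)
    (ha : (fun n => l2 π (orbitFun Q g n)) =o[atTop] logRate q) :
    (fun n => l2 π (poissonApprox Q g n)) =o[atTop] logRate q := by
  refine (isLittleO_opPoisson hq (isLittleO_norm_orbitSum hQ hg h2 ha)).congr_left fun n => ?_
  rw [l2_eq_norm (memLp_poissonApprox hQ hg h2 n), toLp_poissonApprox hQ hg]

end Existence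

lemma logRate_isBigO (q : ℝ) :
    logRate q =O[atTop] fun n : ℕ => √(n : ℝ) * Real.log n ^ (1 - q) := by
  refine IsBigO.of_bound 1 ?_
  filter_upwards [eventually_ge_atTop 3] with n hn
  have h1 : 1 ≤ Real.log n := by
    rw [Real.le_log_iff_exp_le (by positivity)]
    exact Real.exp_one_lt_three.le.trans (by exact_mod_cast hn)
  have h0 : 0 < Real.log n := by linarith
  rw [Real.norm_of_nonneg (logRate_nonneg _ _), Real.norm_of_nonneg (by positivity), one_mul,
    logRate]
  gcongr
  linarith

namespace IsStationaryErgodicMarkovChain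

variable {Ω 𝒳 : Type*} [MeasurableSpace Ω] [MeasurableSpace 𝒳] {P : Measure Ω}
  [IsProbabilityMeasure P] {X : ℤ → Ω → 𝒳} {Q : Kernel 𝒳 𝒳} [IsMarkovKernel Q]
  {g : 𝒳 → ℝ} {H : 𝒳 × 𝒳 → ℝ} {q : ℝ}

lemma isMartingaleDiff (hX : IsStationaryErgodicMarkovChain P X Q) (hg : Measurable g)
    (h2 : MemLp g 2 (P.map (X 0))) (hH : IsLimitDiff ((P.map (X 0)) ⊗ₘ Q) Q g H) :
    IsMartingaleDiff (pastFiltration X hX.measurable) (pairSeq X H) P :=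
  hX.isMartingaleDiff_of_setIntegral hH.measurable hH.memLp
    fun k _ hB => hX.setIntegral_pairSeq_eq_zero hg h2 hH k hB

lemma martingale_pathM (hX : IsStationaryErgodicMarkovChain P X Q) (hg : Measurable g)
    (h2 : MemLp g 2 (P.map (X 0))) (hH : IsLimitDiff ((P.map (X 0)) ⊗ₘ Q) Q g H) :
    Martingale (fun (n : ℕ) ω => pathM H n (future X ω)) (pastFiltration X hX.measurable) P := by
  have h := (hX.isMartingaleDiff hg h2 hH).martingale
  have e : (fun (n : ℕ) ω => pathM H n (future X ω)) = psum (pairSeq X H) :=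
    funext fun n => funext fun ω => pathM_future X H n ω
  rwa [e]

-- The increment sequence from time m on is one fixed measurable function of the path shifted by m,
-- and the law of that path does not depend on m.
omit [IsProbabilityMeasure P] [IsMarkovKernel Q] in
lemma hasStationaryIncrements (hX : IsStationaryErgodicMarkovChain P X Q) (hH : Measurable H) :
    HasStationaryIncrements P (fun (n : ℕ) ω => pathM H n (future X ω)) := by
  intro m
  set φ : (ℕ → 𝒳) → ℕ → ℝ := fun x k => H (x k, x (k + 1)) with hφ
  have hφm : Measurable φ := by rw [hφ]; fun_prop
  have h := congrArg (Measure.map φ) (hX.map_future m)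
  rw [Measure.map_map hφm (measurable_pi_lambda _ fun n => hX.measurable _),
    Measure.map_map hφm hX.measurable_future] at h
  have e : ∀ m : ℕ, (fun ω (k : ℕ) => pathM H (m + k + 1) (future X ω)
      - pathM H (m + k) (future X ω)) = φ ∘ fun ω (k : ℕ) => X ((m + k : ℕ) : ℤ) ω := by
    intro m
    funext ω k
    rw [pathM_eq, pathM_eq, Finset.sum_range_succ, add_sub_cancel_left]
    simp [hφ, future, add_assoc]
  have e0 := e 0
  simp only [zero_add] at e0
  rw [e m, e0]
  exact h

lemma memLp_pathM (hX : IsStationaryErgodicMarkovChain P X Q)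
    (hH : MemLp H 2 ((P.map (X 0)) ⊗ₘ Q)) (n : ℕ) :
    MemLp (fun ω => pathM H n (future X ω)) 2 P := by
  simp only [pathM_future]
  exact memLp_finsetSum _ fun k _ => hX.memLp_pairSeq hH k

lemma memLp_pathR (hX : IsStationaryErgodicMarkovChain P X Q) (h2 : MemLp g 2 (P.map (X 0)))
    (hH : MemLp H 2 ((P.map (X 0)) ⊗ₘ Q)) (n : ℕ) :
    MemLp (fun ω => pathR g H n (future X ω)) 2 P :=
  (hX.memLp_pathS h2 n).sub (hX.memLp_pathM hH n)

lemma l2_psum_pairSeq (hX : IsStationaryErgodicMarkovChain P X Q)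
    (hH : MemLp H 2 ((P.map (X 0)) ⊗ₘ Q))
    (hD : IsMartingaleDiff (pastFiltration X hX.measurable) (pairSeq X H) P) (n : ℕ) :
    l2 P (psum (pairSeq X H) n) = √n * l2 ((P.map (X 0)) ⊗ₘ Q) H := by
  have h : ∀ k, ∫ ω, pairSeq X H k ω ^ 2 ∂P = l2 ((P.map (X 0)) ⊗ₘ Q) H ^ 2 := fun k => by
    rw [← l2_sq (hX.memLp_pairSeq hH k), ← l2_comp (hX.measurePreserving_pair k) hH.1]; rfl
  have e : l2 P (psum (pairSeq X H) n) ^ 2 = (√n * l2 ((P.map (X 0)) ⊗ₘ Q) H) ^ 2 := by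
    rw [l2_sq (hD.memLp_psum n), hD.integral_psum_sq]
    simp only [h]
    rw [Finset.sum_const, Finset.card_range, nsmul_eq_mul, mul_pow, Real.sq_sqrt (by positivity)]
  exact (pow_left_inj₀ (l2_nonneg _) (mul_nonneg (Real.sqrt_nonneg _) (l2_nonneg _))
    two_ne_zero).1 e

/-- Use the decomposition of S_n with the approximation index equal to n. The coboundary costs
2‖h_n‖ by contractivity, the n error terms V_n/n cost ‖V_n‖ by the triangle inequality, and
replacing H_n by H costs √n ‖H_n − H‖ by orthogonality. -/
lemma l2_pathR_le (hX : IsStationaryErgodicMarkovChain P X Q) (hg : Measurable g)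
    (h2 : MemLp g 2 (P.map (X 0))) (hH : IsLimitDiff ((P.map (X 0)) ⊗ₘ Q) Q g H) {n : ℕ}
    (hn : n ≠ 0) :
    l2 P (fun ω => pathR g H n (future X ω)) ≤ 2 * l2 (P.map (X 0)) (poissonApprox Q g n)
      + l2 (P.map (X 0)) (orbitFun Q g n)
      + √n * l2 ((P.map (X 0)) ⊗ₘ Q) (poissonDiff Q g n - H) := by
  have := hX.isProbabilityMeasure_map
  have hQ := hX.invariant
  have hhm := measurable_poissonApprox Q hg n
  have hh := memLp_poissonApprox hQ hg h2 n
  have hT := memLp_transOp hQ hhm hh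
  have hd := hX.memLp_poissonDiff hg h2 n
  have hDsub : MemLp (poissonDiff Q g n - H) 2 ((P.map (X 0)) ⊗ₘ Q) := hd.sub hH.memLp
  have hdm : Measurable (poissonDiff Q g n) :=
    (hhm.comp measurable_snd).sub ((measurable_transOp Q hhm).comp measurable_fst)
  have hDm : Measurable (poissonDiff Q g n - H) := hdm.sub hH.measurable
  have hD : IsMartingaleDiff (pastFiltration X hX.measurable)
      (pairSeq X (poissonDiff Q g n - H)) P := by
    refine hX.isMartingaleDiff_of_setIntegral hDm hDsub fun k B hB => ?_
    have e : (fun ω => pairSeq X (poissonDiff Q g n - H) k ω)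
        = fun ω => pairSeq X (poissonDiff Q g n) k ω - pairSeq X H k ω := rfl
    rw [e, integral_sub ((hX.memLp_pairSeq hd k).integrable one_le_two).restrict
      ((hX.memLp_pairSeq hH.memLp k).integrable one_le_two).restrict,
      hX.setIntegral_pairSeq_poissonDiff hg h2 n k hB,
      hX.setIntegral_pairSeq_eq_zero hg h2 hH k hB, sub_zero]
  have hTl : l2 (P.map (X 0)) (transOp Q (poissonApprox Q g n))
      ≤ l2 (P.map (X 0)) (poissonApprox Q g n) :=
    ENNReal.toReal_mono hh.2.ne (eLpNorm_transOp_le hQ hhm)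
  have hTk : ∀ k : ℕ, MemLp (fun ω => transOp Q (poissonApprox Q g n) (X k ω)) 2 P := fun k =>
    hT.comp_measurePreserving (hX.measurePreserving k)
  have hTk0 : MemLp (fun ω => transOp Q (poissonApprox Q g n) (X 0 ω)) 2 P := hTk 0
  have hrest : MemLp (fun x => g x - (poissonApprox Q g n x
      - transOp Q (poissonApprox Q g n) x)) 2 (P.map (X 0)) := h2.sub (hh.sub hT)
  have hmp : ∀ k : ℕ, MeasurePreserving (X (k + 1)) P (P.map (X 0)) := fun k => by
    exact_mod_cast hX.measurePreserving (k + 1)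
  have hrestk : ∀ k : ℕ, MemLp (fun ω => g (X (k + 1) ω) - (poissonApprox Q g n (X (k + 1) ω)
      - transOp Q (poissonApprox Q g n) (X (k + 1) ω))) 2 P := fun k =>
    hrest.comp_measurePreserving (hmp k)
  have e : (fun ω => pathR g H n (future X ω)) = fun ω =>
      ((transOp Q (poissonApprox Q g n) (X 0 ω) - transOp Q (poissonApprox Q g n) (X n ω))
      + ∑ k ∈ Finset.range n, (g (X (k + 1) ω) - (poissonApprox Q g n (X (k + 1) ω)
        - transOp Q (poissonApprox Q g n) (X (k + 1) ω))))
      + psum (pairSeq X (poissonDiff Q g n - H)) n ω := by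
    funext ω
    have h1 := pathS_sub_pathM_poissonDiff Q g n n (future X ω)
    have h3 : psum (pairSeq X (poissonDiff Q g n - H)) n ω
        = pathM (poissonDiff Q g n) n (future X ω) - pathM H n (future X ω) := by
      rw [pathM_future, pathM_future]
      simp [psum, pairSeq]
    simp only [future, Nat.cast_add, Nat.cast_one, Nat.cast_zero] at h1
    rw [h3, ← h1, pathR]
    abel
  have hsum : MemLp (fun ω => ∑ k ∈ Finset.range n, (g (X (k + 1) ω)
      - (poissonApprox Q g n (X (k + 1) ω)
        - transOp Q (poissonApprox Q g n) (X (k + 1) ω)))) 2 P := memLp_finsetSum _ fun k _ => hrestk k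
  rw [e]
  refine (l2_add_le ((hTk0.sub (hTk n)).add hsum) (hD.memLp_psum n)).trans ?_
  rw [hX.l2_psum_pairSeq hDsub hD]
  gcongr
  refine (l2_add_le (hTk0.sub (hTk n)) hsum).trans (add_le_add ?_ ?_)
  · refine (l2_sub_le hTk0 (hTk n)).trans ?_
    have e1 := l2_comp (hX.measurePreserving 0) hT.1
    have e2 := l2_comp (hX.measurePreserving n) hT.1
    have e1' : l2 P (fun ω => transOp Q (poissonApprox Q g n) (X 0 ω)) = _ := e1
    rw [e1', e2]
    linarith
  · refine (l2_sum_le hrestk _).trans (le_of_eq ?_)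
    rw [← l2_sub_poissonApprox hQ hg h2 hn]
    rw [← nsmul_eq_mul, ← Finset.card_range n, ← Finset.sum_const, Finset.card_range]
    obtain ⟨r, hr⟩ : ∃ r : 𝒳 → ℝ, r = fun x => g x - (poissonApprox Q g n x
      - transOp Q (poissonApprox Q g n) x) := ⟨_, rfl⟩
    rw [← hr] at hrest ⊢
    refine Finset.sum_congr rfl fun k _ => ?_
    rw [← l2_comp (hmp k) hrest.1, hr]

lemma isLittleO_l2_pathR (hX : IsStationaryErgodicMarkovChain P X Q) (hg : Measurable g)
    (h2 : MemLp g 2 (P.map (X 0))) (hq : 2 ≤ q)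
    (ha : (fun n => l2 (P.map (X 0)) (orbitFun Q g n)) =o[atTop] logRate q)
    (hH : IsLimitDiff ((P.map (X 0)) ⊗ₘ Q) Q g H) :
    (fun n => l2 P (fun ω => pathR g H n (future X ω)))
      =o[atTop] fun n : ℕ => √(n : ℝ) * Real.log n ^ (1 - q) := by
  have := hX.isProbabilityMeasure_map
  have h1 := ((isLittleO_l2_poissonApprox hX.invariant hg h2 (by linarith) ha).trans_isBigO
    (logRate_isBigO q)).const_mul_left 2
  have h3 := ha.trans_isBigO (logRate_isBigO q)
  have h4 := (isBigO_refl (fun n : ℕ => √(n : ℝ)) atTop).mul_isLittleO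
    (isLittleO_l2_poissonDiff_sub hX.invariant hg h2 hq ha hH)
  refine IsBigO.trans_isLittleO (IsBigO.of_bound 1 ?_) ((h1.add h3).add h4)
  filter_upwards [eventually_ne_atTop 0] with n hn
  rw [one_mul, Real.norm_of_nonneg (l2_nonneg _)]
  exact (hX.l2_pathR_le hg h2 hH hn).trans (le_abs_self _)

/-- `σ² = lim E(S_n²) / n`. -/
lemma tendsto_integral_pathS_sq (hX : IsStationaryErgodicMarkovChain P X Q) (hg : Measurable g)
    (h2 : MemLp g 2 (P.map (X 0))) (hq : 2 ≤ q)
    (ha : (fun n => l2 (P.map (X 0)) (orbitFun Q g n)) =o[atTop] logRate q)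
    (hH : IsLimitDiff ((P.map (X 0)) ⊗ₘ Q) Q g H) :
    Tendsto (fun n : ℕ => (∫ ω, pathS g n (future X ω) ^ 2 ∂P) / (n : ℝ)) atTop
      (𝓝 (l2 ((P.map (X 0)) ⊗ₘ Q) H ^ 2)) := by
  have hR : Tendsto (fun n : ℕ => l2 P (fun ω => pathR g H n (future X ω)) / √n) atTop (𝓝 0) := by
    refine IsLittleO.tendsto_div_nhds_zero ((hX.isLittleO_l2_pathR hg h2 hq ha hH).trans_isBigO
      (IsBigO.of_bound 1 ?_))
    filter_upwards [eventually_ge_atTop 3] with n hn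
    have h1 : 1 ≤ Real.log n := by
      rw [Real.le_log_iff_exp_le (by positivity)]
      exact Real.exp_one_lt_three.le.trans (by exact_mod_cast hn)
    have h3 : Real.log n ^ (1 - q) ≤ 1 := Real.rpow_le_one_of_one_le_of_nonpos h1 (by linarith)
    rw [one_mul, norm_mul, Real.norm_of_nonneg (Real.rpow_nonneg (by linarith) _)]
    exact mul_le_of_le_one_right (norm_nonneg _) h3
  have hS : Tendsto (fun n : ℕ => l2 P (fun ω => pathS g n (future X ω)) / √n) atTop
      (𝓝 (l2 ((P.map (X 0)) ⊗ₘ Q) H)) := by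
    rw [tendsto_iff_norm_sub_tendsto_zero]
    refine squeeze_zero' (Eventually.of_forall fun _ => norm_nonneg _) ?_ hR
    filter_upwards [eventually_ne_atTop 0] with n hn
    have hs : 0 < √(n : ℝ) := by positivity
    -- Martingale increments are orthogonal with equal norms, so ‖M_n‖/√n is exactly ‖H‖ and only
    -- R_n separates it from ‖S_n‖/√n.
    have hM : l2 P (fun ω => pathM H n (future X ω)) = √n * l2 ((P.map (X 0)) ⊗ₘ Q) H := by
      simp only [pathM_future]
      exact hX.l2_psum_pairSeq hH.memLp (hX.isMartingaleDiff hg h2 hH) n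
    have e : l2 P (fun ω => pathS g n (future X ω)) / √n - l2 ((P.map (X 0)) ⊗ₘ Q) H
        = (l2 P (fun ω => pathS g n (future X ω)) - l2 P (fun ω => pathM H n (future X ω))) / √n := by
      rw [hM]; field_simp
    rw [e, norm_div, Real.norm_of_nonneg hs.le]
    gcongr
    exact abs_l2_sub_l2_le (hX.memLp_pathS h2 n) (hX.memLp_pathM hH.memLp n)
  refine (hS.pow 2).congr fun n => ?_
  rw [div_pow, Real.sq_sqrt (by positivity), l2_sq (hX.memLp_pathS h2 n)]

end IsStationaryErgodicMarkovChain

/-! ### Dyadic chaining and the three exceptional events. -/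

/-- The Euclidean norm of the increments of `R` over the dyadic intervals of length `2^s` in
`[0, 2^d]`. -/
def dyadicNorm (R : ℕ → ℝ) (d s : ℕ) : ℝ :=
  √(∑ i ∈ Finset.range (2 ^ (d - s)), (R (i * 2 ^ s + 2 ^ s) - R (i * 2 ^ s)) ^ 2)

lemma abs_sub_le_dyadicNorm (R : ℕ → ℝ) {d s i : ℕ} (hi : i < 2 ^ (d - s)) :
    |R (i * 2 ^ s + 2 ^ s) - R (i * 2 ^ s)| ≤ dyadicNorm R d s := by
  rw [dyadicNorm, ← Real.sqrt_sq_eq_abs]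
  exact Real.sqrt_le_sqrt (Finset.single_le_sum
    (f := fun i => (R (i * 2 ^ s + 2 ^ s) - R (i * 2 ^ s)) ^ 2) (fun _ _ => sq_nonneg _)
    (Finset.mem_range.2 hi))

/-- Dyadic chaining. -/
lemma abs_le_sum_dyadicNorm (R : ℕ → ℝ) (h0 : R 0 = 0) {d r : ℕ} (hr : r ≤ d) :
    ∀ i ≤ 2 ^ (d - r), |R (i * 2 ^ r)| ≤ ∑ s ∈ Finset.Icc r d, dyadicNorm R d s := by
  have hnn : ∀ s, 0 ≤ dyadicNorm R d s := fun s => Real.sqrt_nonneg _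
  -- From the coarsest grid {0, 2^d} downwards: an even multiple of 2^r already lies on the grid of
  -- step 2^{r+1}, and an odd one is reached from its left neighbour by a single increment.
  induction hr using Nat.decreasingInduction with
  | self =>
    intro i hi
    simp only [Nat.sub_self, pow_zero] at hi
    simp only [Finset.Icc_self, Finset.sum_singleton]
    interval_cases i
    · simpa [h0] using hnn d
    · have := abs_sub_le_dyadicNorm R (d := d) (s := d) (i := 0) (by simp)
      simpa [h0] using this
  | of_succ r hr ih =>
    intro i hi
    have hsub : d - r = (d - (r + 1)) + 1 := by omega
    have hs : ∑ s ∈ Finset.Icc r d, dyadicNorm R d s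
        = dyadicNorm R d r + ∑ s ∈ Finset.Icc (r + 1) d, dyadicNorm R d s := by
      rw [← Finset.add_sum_Ioc_eq_sum_Icc (by omega), ← Finset.Icc_succ_left_eq_Ioc]
      rfl
    rw [hs]
    have h2 : 2 ^ (d - r) = 2 * 2 ^ (d - (r + 1)) := by rw [hsub, pow_succ]; ring
    obtain ⟨j, hj | hj⟩ := Nat.even_or_odd' i
    · have := ih j (by omega)
      rw [hj, show 2 * j * 2 ^ r = j * 2 ^ (r + 1) by rw [pow_succ]; ring]
      linarith [hnn r]
    · have h3 := ih j (by omega)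
      have h4 := abs_sub_le_dyadicNorm R (d := d) (s := r) (i := 2 * j) (by omega)
      rw [show 2 * j * 2 ^ r + 2 ^ r = i * 2 ^ r by rw [hj]; ring,
        show 2 * j * 2 ^ r = j * 2 ^ (r + 1) by rw [pow_succ]; ring] at h4
      have h5 := abs_sub_abs_le_abs_sub (R (i * 2 ^ r)) (R (j * 2 ^ (r + 1)))
      linarith

lemma measure_le_ofReal_l2_sq {α : Type*} [MeasurableSpace α] {μ : Measure α} [IsFiniteMeasure μ]
    {f : α → ℝ} (hf : MemLp f 2 μ) {c : ℝ} (hc : 0 < c) :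
    μ {x | c ≤ f x} ≤ ENNReal.ofReal (l2 μ f ^ 2 / c ^ 2) := by
  have h := mul_meas_ge_le_integral_of_nonneg (μ := μ) (f := fun x => f x ^ 2)
    (Eventually.of_forall fun x => sq_nonneg _) hf.integrable_sq (c ^ 2)
  rw [← l2_sq hf] at h
  have hsub : {x | c ≤ f x} ⊆ {x | c ^ 2 ≤ f x ^ 2} := fun x (hx : c ≤ f x) =>
    (by gcongr : c ^ 2 ≤ f x ^ 2)
  rw [← ofReal_measureReal]
  refine ENNReal.ofReal_le_ofReal ?_
  rw [le_div_iff₀ (by positivity), mul_comm]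
  refine le_trans ?_ h
  exact mul_le_mul_of_nonneg_left (measureReal_mono hsub) (by positivity)

/-- Paths whose remainder is large at some multiple of `2^r` up to `2^d`. -/
def coarseSet {𝒳 : Type*} [MeasurableSpace 𝒳] (g : 𝒳 → ℝ) (H : 𝒳 × 𝒳 → ℝ) (d r : ℕ) (c : ℝ) :
    Set (ℕ → 𝒳) :=
  {y | ∃ i ≤ 2 ^ (d - r), c ≤ |pathR g H (i * 2 ^ r) y|}

/-- Paths along which `2^r |g|` is large before time `2^d`. -/
def jumpSet {𝒳 : Type*} (g : 𝒳 → ℝ) (d r : ℕ) (c : ℝ) : Set (ℕ → 𝒳) :=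
  {y | ∃ k < 2 ^ d, c ≤ 2 ^ r * |g (y (k + 1))|}

/-- Paths along which the martingale oscillates in one of the blocks of length `2^r` in
`[0, 2^d]`. -/
def blockSet {𝒳 : Type*} [MeasurableSpace 𝒳] (H : 𝒳 × 𝒳 → ℝ) (d r : ℕ) (c : ℝ) :
    Set (ℕ → 𝒳) :=
  {y | ∃ i < 2 ^ (d - r), ∃ t ≤ 2 ^ r, c ≤ |pathM H t fun k => y (i * 2 ^ r + k)|}

/-- R_j is the value of R at the block endpoint to the left of j, plus an increment of S, minus an
increment of M. If it reaches 3c, one of the three reaches c; fewer than 2^r terms of g enter the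
increment of S. -/
lemma pathMaxR_subset {𝒳 : Type*} [MeasurableSpace 𝒳] (g : 𝒳 → ℝ) (H : 𝒳 × 𝒳 → ℝ) {d r : ℕ}
    (hr : r ≤ d) {c : ℝ} (hc : 0 < c) :
    {y | 3 * c ≤ pathMaxR g H (2 ^ d) y}
      ⊆ coarseSet g H d r c ∪ (jumpSet g d r c ∪ blockSet H d r c) := by
  intro y hy
  simp only [Set.mem_ofPred_eq, pathMaxR, Finset.le_sup'_iff, Finset.mem_range] at hy
  obtain ⟨j, hj, hy⟩ := hy
  have hR : 3 * c ≤ |pathR g H j y| := hy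
  by_contra hcon
  simp only [Set.mem_union, not_or, coarseSet, jumpSet, blockSet, Set.mem_ofPred_eq, not_exists,
    not_and, not_le] at hcon
  obtain ⟨h1, h2, h3⟩ := hcon
  have hpow : 2 ^ d = 2 ^ (d - r) * 2 ^ r := by rw [← pow_add]; congr 1; omega
  have hpos : 0 < 2 ^ r := Nat.two_pow_pos r
  have hdm : j / 2 ^ r * 2 ^ r + j % 2 ^ r = j := by rw [mul_comm]; exact Nat.div_add_mod j _
  have hi : j / 2 ^ r ≤ 2 ^ (d - r) := by
    rw [Nat.div_le_iff_le_mul_add_pred hpos]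
    rw [mul_comm]; omega
  have hc1 := h1 _ hi
  -- If the quotient is 2^{d-r}, then j = 2^d is itself an endpoint and no block starts there.
  rcases hi.eq_or_lt with he | hlt
  · have hj0 : j % 2 ^ r = 0 := by rw [he] at hdm; omega
    rw [hj0, add_zero] at hdm
    rw [hdm] at hc1
    linarith
  · have hmod := Nat.mod_lt j hpos
    have hc3 := h3 _ hlt (j % 2 ^ r) hmod.le
    have hadd := pathR_add g H (j / 2 ^ r * 2 ^ r) (j % 2 ^ r) y
    rw [hdm] at hadd
    have hS : |pathS g (j % 2 ^ r) fun k => y (j / 2 ^ r * 2 ^ r + k)| ≤ c := by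
      have hk : ∀ k ∈ Finset.range (j % 2 ^ r),
          |g (y (j / 2 ^ r * 2 ^ r + (k + 1)))| ≤ c / 2 ^ r := by
        intro k hk
        have hk' := Finset.mem_range.1 hk
        rw [le_div_iff₀ (by positivity), mul_comm]
        refine (h2 (j / 2 ^ r * 2 ^ r + k) ?_).le
        omega
      rw [pathS_eq]
      refine (Finset.abs_sum_le_sum_abs _ _).trans ((Finset.sum_le_sum hk).trans ?_)
      rw [Finset.sum_const, Finset.card_range, nsmul_eq_mul, mul_div_left_comm]
      refine mul_le_of_le_one_right hc.le ?_
      rw [div_le_one (by positivity)]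
      exact_mod_cast hmod.le
    have hfin := abs_sub_abs_le_abs_sub (pathR g H j y) (pathR g H (j / 2 ^ r * 2 ^ r) y)
    rw [hadd] at hfin
    have := abs_sub (pathS g (j % 2 ^ r) fun k => y (j / 2 ^ r * 2 ^ r + k))
      (pathM H (j % 2 ^ r) fun k => y (j / 2 ^ r * 2 ^ r + k))
    simp only [pathR] at *
    linarith

namespace IsStationaryErgodicMarkovChain

variable {Ω 𝒳 : Type*} [MeasurableSpace Ω] [MeasurableSpace 𝒳] {P : Measure Ω}
  [IsProbabilityMeasure P] {X : ℤ → Ω → 𝒳} {Q : Kernel 𝒳 𝒳} [IsMarkovKernel Q]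
  {g : 𝒳 → ℝ} {H : 𝒳 × 𝒳 → ℝ} {q : ℝ}

lemma memLp_l2_pathR_sub (hX : IsStationaryErgodicMarkovChain P X Q) (hg : Measurable g)
    (hHm : Measurable H) (h2 : MemLp g 2 (P.map (X 0)))
    (hH : MemLp H 2 ((P.map (X 0)) ⊗ₘ Q)) (m n : ℕ) :
    MemLp (fun ω => pathR g H (m + n) (future X ω) - pathR g H m (future X ω)) 2 P ∧
    l2 P (fun ω => pathR g H (m + n) (future X ω) - pathR g H m (future X ω))
      = l2 P (fun ω => pathR g H n (future X ω)) := by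
  refine ⟨(hX.memLp_pathR h2 hH _).sub (hX.memLp_pathR h2 hH _), ?_⟩
  have h1 : MeasurePreserving (fun ω (k : ℕ) => X ((m + k : ℕ) : ℤ) ω) P (P.map (future X)) :=
    ⟨measurable_pi_lambda _ fun n => hX.measurable _, hX.map_future m⟩
  have h3 : MeasurePreserving (future X) P (P.map (future X)) := ⟨hX.measurable_future, rfl⟩
  have hm : AEStronglyMeasurable (pathR g H n) (P.map (future X)) :=
    (measurable_pathR hg hHm n).aestronglyMeasurable
  rw [l2_comp h3 hm, ← l2_comp h1 hm]
  simp only [pathR_add]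
  rfl

/-- By stationarity each of the 2^{d-s} squared increments has the same mean as R_{2^s}². -/
lemma memLp_l2_dyadicNorm (hX : IsStationaryErgodicMarkovChain P X Q) (hg : Measurable g)
    (hHm : Measurable H) (h2 : MemLp g 2 (P.map (X 0)))
    (hH : MemLp H 2 ((P.map (X 0)) ⊗ₘ Q)) (d s : ℕ) :
    MemLp (fun ω => dyadicNorm (fun n => pathR g H n (future X ω)) d s) 2 P ∧
    l2 P (fun ω => dyadicNorm (fun n => pathR g H n (future X ω)) d s)
      = √(2 ^ (d - s)) * l2 P (fun ω => pathR g H (2 ^ s) (future X ω)) := by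
  have hpm : ∀ n, Measurable fun ω => pathR g H n (future X ω) := fun n =>
    (measurable_pathR hg hHm n).comp hX.measurable_future
  have hi : ∀ i, Integrable (fun ω => (pathR g H (i * 2 ^ s + 2 ^ s) (future X ω)
      - pathR g H (i * 2 ^ s) (future X ω)) ^ 2) P := fun i =>
    (hX.memLp_l2_pathR_sub hg hHm h2 hH _ _).1.integrable_sq
  have hsq : (fun ω => dyadicNorm (fun n => pathR g H n (future X ω)) d s ^ 2)
      = fun ω => ∑ i ∈ Finset.range (2 ^ (d - s)), (pathR g H (i * 2 ^ s + 2 ^ s) (future X ω)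
        - pathR g H (i * 2 ^ s) (future X ω)) ^ 2 := by
    funext ω
    rw [dyadicNorm, Real.sq_sqrt (Finset.sum_nonneg fun _ _ => sq_nonneg _)]
  have hmem : MemLp (fun ω => dyadicNorm (fun n => pathR g H n (future X ω)) d s) 2 P := by
    refine (memLp_two_iff_integrable_sq ?_).2 ?_
    · refine Measurable.aestronglyMeasurable ?_
      unfold dyadicNorm
      fun_prop
    · rw [hsq]
      exact integrable_finsetSum _ fun i _ => hi i
  refine ⟨hmem, (pow_left_inj₀ (l2_nonneg _) (mul_nonneg (Real.sqrt_nonneg _) (l2_nonneg _))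
    two_ne_zero).1 ?_⟩
  rw [l2_sq hmem, hsq, integral_finsetSum _ fun i _ => hi i, mul_pow,
    Real.sq_sqrt (by positivity)]
  have : ∀ i, ∫ ω, (pathR g H (i * 2 ^ s + 2 ^ s) (future X ω)
      - pathR g H (i * 2 ^ s) (future X ω)) ^ 2 ∂P
      = l2 P (fun ω => pathR g H (2 ^ s) (future X ω)) ^ 2 := fun i => by
    obtain ⟨h, e⟩ := hX.memLp_l2_pathR_sub hg hHm h2 hH (i * 2 ^ s) (2 ^ s)
    rw [← l2_sq h, e]
  simp only [this]
  simp

/-- A Rademacher–Menshov type maximal inequality along multiples of `2^r`. -/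
lemma measure_coarseSet_le (hX : IsStationaryErgodicMarkovChain P X Q) (hg : Measurable g)
    (hHm : Measurable H) (h2 : MemLp g 2 (P.map (X 0)))
    (hH : MemLp H 2 ((P.map (X 0)) ⊗ₘ Q)) {d r : ℕ} (hr : r ≤ d) {ε : ℝ} (hε : 0 < ε) :
    P (future X ⁻¹' coarseSet g H d r (ε * √(2 ^ d))) ≤ ENNReal.ofReal ((∑ s ∈ Finset.Icc r d,
      l2 P (fun ω => pathR g H (2 ^ s) (future X ω)) / √(2 ^ s)) ^ 2 / ε ^ 2) := by
  have hN := hX.memLp_l2_dyadicNorm hg hHm h2 hH d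
  have hsum : MemLp (fun ω => ∑ s ∈ Finset.Icc r d,
      dyadicNorm (fun n => pathR g H n (future X ω)) d s) 2 P :=
    memLp_finsetSum _ fun s _ => (hN s).1
  have hc : 0 < ε * √(2 ^ d) := by positivity
  refine ((measure_mono fun ω => ?_).trans (measure_le_ofReal_l2_sq hsum hc)).trans
    (ENNReal.ofReal_le_ofReal ?_)
  · rintro ⟨i, hi, h⟩
    exact h.trans (abs_le_sum_dyadicNorm (fun n => pathR g H n (future X ω))
      (by simp [pathR, pathS_eq, pathM_eq]) hr i hi)
  · have hle : l2 P (fun ω => ∑ s ∈ Finset.Icc r d,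
        dyadicNorm (fun n => pathR g H n (future X ω)) d s) ≤ √(2 ^ d) * ∑ s ∈ Finset.Icc r d,
        l2 P (fun ω => pathR g H (2 ^ s) (future X ω)) / √(2 ^ s) := by
      refine (l2_sum_le (fun s => (hN s).1) _).trans ?_
      rw [Finset.mul_sum]
      refine Finset.sum_le_sum fun s hs => le_of_eq ?_
      rw [(hN s).2]
      have : (2 : ℝ) ^ d = 2 ^ (d - s) * 2 ^ s := by
        rw [← pow_add]; congr 1; have := Finset.mem_Icc.1 hs; omega
      rw [this, Real.sqrt_mul (by positivity)]
      field_simp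
    have h0 := l2_nonneg (μ := P) (fun ω => ∑ s ∈ Finset.Icc r d,
        dyadicNorm (fun n => pathR g H n (future X ω)) d s)
    calc _ ≤ (√(2 ^ d) * ∑ s ∈ Finset.Icc r d,
        l2 P (fun ω => pathR g H (2 ^ s) (future X ω)) / √(2 ^ s)) ^ 2 / (ε * √(2 ^ d)) ^ 2 := by
          gcongr
      _ = _ := by
          rw [mul_pow, mul_pow]
          field_simp

-- A union bound over 2^d times and Markov's inequality for |g|^p give 2^d · 2^{rp} · 2^{-dp/2} up
-- to constants, and rL ≤ d bounds 2^{rp} by 2^{dp/L}.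
omit [IsMarkovKernel Q] in
lemma measure_jumpSet_le (hX : IsStationaryErgodicMarkovChain P X Q) (hg : Measurable g) {p : ℝ}
    (hp : 0 < p) (hgp : MemLp g (ENNReal.ofReal p) (P.map (X 0))) {d r L : ℕ} (hL : 0 < L)
    (hr : r * L ≤ d) {ε : ℝ} (hε : 0 < ε) :
    P (future X ⁻¹' jumpSet g d r (ε * √(2 ^ d))) ≤ ENNReal.ofReal
      ((∫ x, |g x| ^ p ∂(P.map (X 0))) / ε ^ p * ((2 : ℝ) ^ (1 + p / L - p / 2)) ^ d) := by
  have := hX.isProbabilityMeasure_map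
  have hint : Integrable (fun x => |g x| ^ p) (P.map (X 0)) := by
    have := hgp.integrable_norm_rpow (by simpa using hp) (by simp)
    rwa [ENNReal.toReal_ofReal hp.le] at this
  set c := ε * √(2 ^ d) / 2 ^ r with hc
  have hc0 : 0 < c := by positivity
  have h1 : (P.map (X 0)) {x | c ≤ |g x|}
      ≤ ENNReal.ofReal ((∫ x, |g x| ^ p ∂(P.map (X 0))) / c ^ p) := by
    have h := mul_meas_ge_le_integral_of_nonneg (μ := P.map (X 0)) (f := fun x => |g x| ^ p)
      (Eventually.of_forall fun x => by positivity) hint (c ^ p)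
    rw [← ofReal_measureReal]
    refine ENNReal.ofReal_le_ofReal ?_
    rw [le_div_iff₀ (by positivity), mul_comm]
    refine le_trans ?_ h
    refine mul_le_mul_of_nonneg_left (measureReal_mono fun x (hx : c ≤ |g x|) => ?_)
      (by positivity)
    exact (by gcongr : c ^ p ≤ |g x| ^ p)
  have hsub : future X ⁻¹' jumpSet g d r (ε * √(2 ^ d))
      ⊆ ⋃ k ∈ Finset.range (2 ^ d), X ((k + 1 : ℕ) : ℤ) ⁻¹' {x | c ≤ |g x|} := by
    rintro ω ⟨k, hk, h⟩
    refine Set.mem_iUnion₂.2 ⟨k, Finset.mem_range.2 hk, ?_⟩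
    have h3 : c ≤ |g (future X ω (k + 1))| := by
      rw [hc, div_le_iff₀ (by positivity), mul_comm |g _|]; exact h
    exact h3
  have hms : MeasurableSet {x | c ≤ |g x|} := measurableSet_le measurable_const hg.abs
  refine ((measure_mono hsub).trans (measure_biUnion_finset_le _ _)).trans ?_
  have h4 : ∀ k : ℕ, P (X ((k + 1 : ℕ) : ℤ) ⁻¹' {x | c ≤ |g x|})
      = (P.map (X 0)) {x | c ≤ |g x|} := fun k =>
    (hX.measurePreserving (k + 1)).measure_preimage hms.nullMeasurableSet
  simp only [h4]
  rw [Finset.sum_const, Finset.card_range, nsmul_eq_mul]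
  refine (mul_le_mul_right h1 _).trans ?_
  have h2d : ((2 ^ d : ℕ) : ENNReal) = ENNReal.ofReal (2 ^ d) := by
    rw [← ENNReal.ofReal_natCast]; push_cast; rfl
  rw [h2d, ← ENNReal.ofReal_mul (by positivity)]
  refine ENNReal.ofReal_le_ofReal ?_
  have hI : 0 ≤ ∫ x, |g x| ^ p ∂(P.map (X 0)) := integral_nonneg fun x => by positivity
  have e1 : c ^ p = ε ^ p * (2 : ℝ) ^ ((d : ℝ) * (p / 2) - r * p) := by
    rw [hc, Real.div_rpow (by positivity) (by positivity), Real.mul_rpow hε.le (by positivity),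
      Real.sqrt_eq_rpow, ← Real.rpow_natCast 2 d, ← Real.rpow_natCast 2 r,
      ← Real.rpow_mul (by norm_num), ← Real.rpow_mul (by norm_num), ← Real.rpow_mul (by norm_num),
      Real.rpow_sub (by norm_num), mul_div_assoc]
    congr 3; ring
  have e2 : ((2 : ℝ) ^ (1 + p / L - p / 2)) ^ d
      = 2 ^ d * ((2 : ℝ) ^ ((d : ℝ) * (p / L) - d * (p / 2))) := by
    rw [← Real.rpow_natCast, ← Real.rpow_natCast, ← Real.rpow_mul (by norm_num),
      ← Real.rpow_add (by norm_num)]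
    congr 1; ring
  have hL' : (0 : ℝ) < L := by exact_mod_cast hL
  have h5 : (r : ℝ) * p ≤ d * (p / L) := by
    have : (r : ℝ) * L ≤ d := by exact_mod_cast hr
    rw [mul_div_assoc', le_div_iff₀ hL']
    nlinarith
  have h6 : ((2 : ℝ) ^ ((d : ℝ) * (p / 2) - r * p))⁻¹
      ≤ (2 : ℝ) ^ ((d : ℝ) * (p / L) - d * (p / 2)) := by
    rw [← Real.rpow_neg (by norm_num)]
    exact Real.rpow_le_rpow_of_exponent_le (by norm_num) (by linarith)
  rw [e1, e2]
  calc _ = (∫ x, |g x| ^ p ∂(P.map (X 0))) / ε ^ p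
        * (2 ^ d * ((2 : ℝ) ^ ((d : ℝ) * (p / 2) - r * p))⁻¹) := by
        rw [div_eq_mul_inv, mul_inv, div_eq_mul_inv]
        generalize ((2 : ℝ) ^ ((d : ℝ) * (p / 2) - r * p))⁻¹ = u
        ring
    _ ≤ _ := by gcongr

end IsStationaryErgodicMarkovChain

/-- Sums over long ranges of a sequence that is `o(s^{1-q})`. -/
lemma isLittleO_sum_Icc_sq {q : ℝ} (hq : 1 ≤ q) {a : ℕ → ℝ} (ha0 : ∀ s, 0 ≤ a s)
    (ha : a =o[atTop] fun s : ℕ => (s : ℝ) ^ (1 - q)) {L : ℕ} (hL : 0 < L) :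
    (fun d : ℕ => (∑ s ∈ Finset.Icc (d / L) d, a s) ^ 2)
      =o[atTop] fun d : ℕ => (d : ℝ) ^ (4 - 2 * q) := by
  have hL' : (0 : ℝ) < L := by exact_mod_cast hL
  have h1 : (fun d : ℕ => ∑ s ∈ Finset.Icc (d / L) d, a s)
      =o[atTop] fun d : ℕ => (d : ℝ) ^ (2 - q) := by
    refine isLittleO_iff.2 fun c hc => ?_
    -- Every index in the range is at least d/(2L), so each term is a small multiple of d^{1-q}; at
    -- most 2d terms then give d^{2-q}. Starting at d/L rather than 0 keeps the fixed initial terms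
    -- out.
    obtain ⟨K, hK⟩ := eventually_atTop.1 (ha.bound
      (c := c / (2 * ((2 * L : ℝ)⁻¹) ^ (1 - q))) (by positivity))
    filter_upwards [eventually_ge_atTop (L * (K + 2))] with d hd
    have hd1 : 1 ≤ d := by nlinarith
    have hd0 : (0 : ℝ) < d := by exact_mod_cast hd1
    have hKd : K + 2 ≤ d / L := by rw [Nat.le_div_iff_mul_le hL, mul_comm]; exact hd
    have hfl : (2 * L : ℝ)⁻¹ * d ≤ (d / L : ℕ) := by
      have h3 : d < L * (d / L + 1) := Nat.lt_mul_div_succ d hL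
      have h3' : (d : ℝ) < L * ((d / L : ℕ) + 1) := by exact_mod_cast h3
      have h4 : (2 : ℝ) ≤ (d / L : ℕ) := by exact_mod_cast (by omega : 2 ≤ d / L)
      rw [inv_mul_le_iff₀ (by positivity)]
      nlinarith
    have hterm : ∀ s ∈ Finset.Icc (d / L) d, a s ≤ c / 2 * (d : ℝ) ^ (1 - q) := by
      intro s hs
      obtain ⟨hs1, hs2⟩ := Finset.mem_Icc.1 hs
      have h5 := hK s (by omega)
      rw [Real.norm_of_nonneg (ha0 s), Real.norm_of_nonneg (by positivity)] at h5
      have h6 : (s : ℝ) ^ (1 - q) ≤ ((2 * L : ℝ)⁻¹ * d) ^ (1 - q) :=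
        Real.rpow_le_rpow_of_nonpos (by positivity)
          (hfl.trans (by exact_mod_cast hs1)) (by linarith)
      rw [Real.mul_rpow (by positivity) hd0.le] at h6
      calc a s ≤ _ := h5
        _ ≤ c / (2 * ((2 * L : ℝ)⁻¹) ^ (1 - q))
            * (((2 * L : ℝ)⁻¹) ^ (1 - q) * (d : ℝ) ^ (1 - q)) := by gcongr
        _ = _ := by
            have : ((2 * L : ℝ)⁻¹) ^ (1 - q) ≠ 0 := (by positivity)
            field_simp
    rw [Real.norm_of_nonneg (Finset.sum_nonneg fun s _ => ha0 s),
      Real.norm_of_nonneg (by positivity)]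
    refine (Finset.sum_le_sum hterm).trans ?_
    rw [Finset.sum_const, nsmul_eq_mul, Nat.card_Icc]
    have hcard : ((d + 1 - d / L : ℕ) : ℝ) ≤ 2 * d := by
      have : d + 1 - d / L ≤ 2 * d := by omega
      exact_mod_cast this
    calc _ ≤ 2 * d * (c / 2 * (d : ℝ) ^ (1 - q)) := by gcongr
      _ = c * ((d : ℝ) * (d : ℝ) ^ (1 - q)) := by ring
      _ = c * (d : ℝ) ^ (2 - q) := by
          rw [show 2 - q = 1 + (1 - q) by ring, Real.rpow_add hd0, Real.rpow_one]
  refine (h1.pow two_pos).congr_right fun d => ?_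
  rw [← Real.rpow_natCast, ← Real.rpow_mul (by positivity)]
  congr 1; push_cast; ring

namespace IsStationaryErgodicMarkovChain

variable {Ω 𝒳 : Type*} [MeasurableSpace Ω] [MeasurableSpace 𝒳] {P : Measure Ω}
  [IsProbabilityMeasure P] {X : ℤ → Ω → 𝒳} {Q : Kernel 𝒳 𝒳} [IsMarkovKernel Q]
  {g : 𝒳 → ℝ} {H : 𝒳 × 𝒳 → ℝ} {q : ℝ}

lemma isLittleO_l2_pathR_two_pow (hX : IsStationaryErgodicMarkovChain P X Q) (hg : Measurable g)
    (h2 : MemLp g 2 (P.map (X 0))) (hq : 2 ≤ q)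
    (ha : (fun n => l2 (P.map (X 0)) (orbitFun Q g n)) =o[atTop] logRate q)
    (hH : IsLimitDiff ((P.map (X 0)) ⊗ₘ Q) Q g H) :
    (fun s : ℕ => l2 P (fun ω => pathR g H (2 ^ s) (future X ω)) / √(2 ^ s))
      =o[atTop] fun s : ℕ => (s : ℝ) ^ (1 - q) := by
  have h := (hX.isLittleO_l2_pathR hg h2 hq ha hH).comp_tendsto
    (tendsto_pow_atTop_atTop_of_one_lt (one_lt_two : 1 < 2))
  have h1 := (isBigO_refl (fun s : ℕ => (√((2 : ℝ) ^ s))⁻¹) atTop).mul_isLittleO h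
  have hl2 := Real.log_pos one_lt_two
  have h3 : (fun s : ℕ => (√((2 : ℝ) ^ s))⁻¹ * ((fun n : ℕ => √(n : ℝ) * Real.log n ^ (1 - q)) ∘
      fun s => 2 ^ s) s) = fun s : ℕ => Real.log 2 ^ (1 - q) * (s : ℝ) ^ (1 - q) := by
    funext s
    have : √((2 : ℝ) ^ s) ≠ 0 := by positivity
    simp only [Function.comp, Nat.cast_pow, Nat.cast_ofNat, Real.log_pow]
    rw [Real.mul_rpow (by positivity) hl2.le]
    field_simp
  rw [h3] at h1
  refine (h1.trans_isBigO (isBigO_const_mul_self _ _ _)).congr_left fun s => ?_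
  rw [Function.comp, div_eq_inv_mul]

/-- Outside of the oscillation of the martingale in short blocks, large remainders have
probabilities that tend to `0`, and are summable along powers of `2` if `q > 5/2`. -/
lemma exists_bound_coarseSet_jumpSet (hX : IsStationaryErgodicMarkovChain P X Q)
    (hg : Measurable g) {p : ℝ} (hp : 2 < p) (hgp : MemLp g (ENNReal.ofReal p) (P.map (X 0)))
    (hq : 2 ≤ q) (ha : (fun n => l2 (P.map (X 0)) (orbitFun Q g n)) =o[atTop] logRate q)
    (hH : IsLimitDiff ((P.map (X 0)) ⊗ₘ Q) Q g H) :
    ∃ L : ℕ, 2 ≤ L ∧ ∀ ε : ℝ, 0 < ε → ∃ u : ℕ → ℝ, (∀ d, 0 ≤ u d) ∧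
      (∀ d, P (future X ⁻¹' (coarseSet g H d (d / L) (ε * √(2 ^ d))
        ∪ jumpSet g d (d / L) (ε * √(2 ^ d)))) ≤ ENNReal.ofReal (u d)) ∧
      Tendsto u atTop (𝓝 0) ∧ (5 / 2 < q → Summable u) := by
  have := hX.isProbabilityMeasure_map
  have h2 : MemLp g 2 (P.map (X 0)) := hgp.mono_exponent (by
    rw [← ENNReal.ofReal_ofNat]; exact ENNReal.ofReal_le_ofReal hp.le)
  -- L > p/(p/2 − 1) makes the geometric exponent 1 + p/L − p/2 negative, which is possible because
  -- p > 2.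
  obtain ⟨L, hL⟩ := exists_nat_gt (max (p / (p / 2 - 1)) 2)
  have hL2 : (2 : ℝ) < L := (le_max_right _ _).trans_lt hL
  have hLN : 2 < L := by exact_mod_cast hL2
  have hL0 : (0 : ℝ) < L := by linarith
  have hpL : 1 + p / L - p / 2 < 0 := by
    have h1 := (le_max_left _ _).trans_lt hL
    rw [div_lt_iff₀ (by linarith)] at h1
    have : p / L < p / 2 - 1 := by rw [div_lt_iff₀ hL0]; linarith
    linarith
  have hρ : (2 : ℝ) ^ (1 + p / L - p / 2) < 1 := Real.rpow_lt_one_of_one_lt_of_neg one_lt_two hpL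
  have hρ0 : 0 ≤ (2 : ℝ) ^ (1 + p / L - p / 2) := by positivity
  refine ⟨L, hLN.le, fun ε hε => ?_⟩
  set a : ℕ → ℝ := fun s => l2 P (fun ω => pathR g H (2 ^ s) (future X ω)) / √(2 ^ s) with hadef
  have ha0 : ∀ s, 0 ≤ a s := fun s => div_nonneg (l2_nonneg _) (Real.sqrt_nonneg _)
  have hlit := isLittleO_sum_Icc_sq (by linarith) ha0
    (hX.isLittleO_l2_pathR_two_pow hg h2 hq ha hH) (by omega : 0 < L)
  set C := (∫ x, |g x| ^ p ∂(P.map (X 0))) / ε ^ p with hC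
  have hC0 : 0 ≤ C := div_nonneg (integral_nonneg fun x => by positivity) (by positivity)
  refine ⟨fun d => (∑ s ∈ Finset.Icc (d / L) d, a s) ^ 2 / ε ^ 2
    + C * ((2 : ℝ) ^ (1 + p / L - p / 2)) ^ d, fun d => by positivity, fun d => ?_, ?_, fun hq5 => ?_⟩
  · rw [Set.preimage_union, ENNReal.ofReal_add (by positivity) (by positivity)]
    exact (measure_union_le _ _).trans (add_le_add
      (hX.measure_coarseSet_le hg hH.measurable h2 hH.memLp (Nat.div_le_self d L) hε)
      (hX.measure_jumpSet_le hg (by linarith) hgp (by omega) (Nat.div_mul_le_self d L) hε))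
  · have hb : (fun d : ℕ => (d : ℝ) ^ (4 - 2 * q)) =O[atTop] fun _ => (1 : ℝ) := by
      refine IsBigO.of_bound 1 ?_
      filter_upwards [eventually_ge_atTop 1] with d hd
      rw [Real.norm_of_nonneg (by positivity)]
      simpa using Real.rpow_le_one_of_one_le_of_nonpos (by exact_mod_cast hd) (by linarith)
    have h1 := (isLittleO_one_iff ℝ).1 (hlit.trans_isBigO hb)
    have h3 := (tendsto_pow_atTop_nhds_zero_of_lt_one hρ0 hρ).const_mul C
    simpa using (h1.div_const (ε ^ 2)).add h3
  · have h1 : Summable fun d : ℕ => (∑ s ∈ Finset.Icc (d / L) d, a s) ^ 2 :=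
      -- The condition 4 − 2q < −1 is exactly q > 5/2.
      summable_of_isBigO_nat (Real.summable_nat_rpow.2 (by linarith)) hlit.isBigO
    exact (h1.div_const _).add ((summable_geometric_of_lt_one hρ0 hρ).mul_left C)

end IsStationaryErgodicMarkovChain

/-! ### Truncated martingale differences. -/

section Truncation

variable {Ω : Type*} {mΩ : MeasurableSpace Ω} {P : Measure Ω} [IsProbabilityMeasure P]

/-- Centering by the conditional mean is an orthogonal projection, also after restriction to an
event of m: the difference of the two integrals is that of the squared conditional mean. -/
lemma setIntegral_sub_condExp_sq_le {m : MeasurableSpace Ω} (hm : m ≤ mΩ) {W : Ω → ℝ}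
    (hW : MemLp W 2 P) {B : Set Ω} (hB : MeasurableSet[m] B) :
    ∫ ω in B, (W ω - (P[W | m]) ω) ^ 2 ∂P ≤ ∫ ω in B, W ω ^ 2 ∂P := by
  have hY : MemLp (P[W | m]) 2 P := hW.condExp one_le_two
  have hD : MemLp (fun ω => W ω - (P[W | m]) ω) 2 P := hW.sub hY
  have h0 : P[fun ω => W ω - (P[W | m]) ω | m] =ᵐ[P] 0 := by
    refine (condExp_sub (hW.integrable one_le_two) integrable_condExp m).trans ?_
    filter_upwards [condExp_condExp_of_le (μ := P) (f := W) (le_refl m) hm] with ω hω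
    simp [hω]
  have hYB : MemLp (B.indicator (P[W | m])) 2 P := hY.indicator (hm _ hB)
  have h1 := integral_mul_eq_zero_of_condExp hm (Y := B.indicator (P[W | m]))
    (stronglyMeasurable_condExp.indicator hB) (hD.integrable one_le_two)
    (hYB.integrable_mul hD) h0
  have e : (fun ω => B.indicator (P[W | m]) ω * (W ω - (P[W | m]) ω))
      = B.indicator fun ω => (P[W | m]) ω * (W ω - (P[W | m]) ω) := by
    funext ω
    by_cases h : ω ∈ B <;> simp [h]
  rw [e, integral_indicator (hm _ hB)] at h1
  have hint : Integrable (fun ω => (P[W | m]) ω * (W ω - (P[W | m]) ω)) P := hY.integrable_mul hD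
  have h2 : ∫ ω in B, W ω ^ 2 ∂P - ∫ ω in B, (W ω - (P[W | m]) ω) ^ 2 ∂P
      = ∫ ω in B, (P[W | m]) ω ^ 2 ∂P := by
    rw [← integral_sub hW.integrable_sq.restrict hD.integrable_sq.restrict]
    have e2 : (fun ω => W ω ^ 2 - (W ω - (P[W | m]) ω) ^ 2)
        = fun ω => 2 * ((P[W | m]) ω * (W ω - (P[W | m]) ω)) + (P[W | m]) ω ^ 2 := by
      funext ω; ring
    rw [e2, integral_add (hint.const_mul 2).restrict hY.integrable_sq.restrict,
      integral_const_mul, h1, mul_zero, zero_add]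
  have h3 : 0 ≤ ∫ ω in B, (P[W | m]) ω ^ 2 ∂P := integral_nonneg fun ω => sq_nonneg _
  linarith

namespace IsMartingaleDiff

variable {𝓕 : Filtration ℕ mΩ} {D : ℕ → Ω → ℝ}

/-- Centering a sequence by its conditional means. -/
lemma centered {U : ℕ → Ω → ℝ} (hU : ∀ k, StronglyMeasurable[𝓕 (k + 1)] (U k))
    (hU2 : ∀ k, MemLp (U k) 2 P) :
    IsMartingaleDiff 𝓕 (fun k ω => U k ω - (P[U k | 𝓕 k]) ω) P where
  adapted k := (hU k).sub (stronglyMeasurable_condExp.mono (𝓕.mono (Nat.le_succ k)))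
  memLp k := (hU2 k).sub ((hU2 k).condExp one_le_two)
  condExp_eq k := by
    refine (condExp_sub ((hU2 k).integrable one_le_two) integrable_condExp _).trans ?_
    filter_upwards [condExp_condExp_of_le (μ := P) (f := U k) (le_refl (𝓕 k)) (𝓕.le k)] with ω hω
    simp [hω]

lemma sub {D' : ℕ → Ω → ℝ} (hD : IsMartingaleDiff 𝓕 D P) (hD' : IsMartingaleDiff 𝓕 D' P) :
    IsMartingaleDiff 𝓕 (fun k ω => D k ω - D' k ω) P where
  adapted k := (hD.adapted k).sub (hD'.adapted k)
  memLp k := (hD.memLp k).sub (hD'.memLp k)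
  condExp_eq k := by
    refine (condExp_sub (hD.integrable k) (hD'.integrable k) _).trans ?_
    filter_upwards [hD.condExp_eq k, hD'.condExp_eq k] with ω h1 h2
    simp [h1, h2]

lemma psum_indicator {D : ℕ → Ω → ℝ} {B : Set Ω} {ω : Ω} (hω : ω ∈ B) (n : ℕ) :
    psum (fun k => B.indicator (D k)) n ω = psum D n ω := by
  simp [psum, hω]

/-- A maximal inequality for a martingale with increments `D k`, obtained from the decomposition
`D k = U k + (D k - U k)` into a bounded part and a rest. -/
lemma measure_inter_exists_le_psum (hD : IsMartingaleDiff 𝓕 D P) {U : ℕ → Ω → ℝ} {c : ℝ}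
    (hc : 0 ≤ c) (hU : ∀ k, StronglyMeasurable[𝓕 (k + 1)] (U k)) (hUc : ∀ k ω, |U k ω| ≤ c)
    {B : Set Ω} (hB : MeasurableSet[𝓕 0] B) {r : ℝ} (hr : 0 < r) (n : ℕ) :
    P (B ∩ {ω | ∃ j ≤ n, 2 * r ≤ |psum D j ω|})
      ≤ ENNReal.ofReal (7 * (n : ℝ) ^ 2 * (2 * c) ^ 4 / r ^ 4) * P B
        + ENNReal.ofReal ((∑ k ∈ Finset.range n, ∫ ω in B, (D k ω - U k ω) ^ 2 ∂P) / r ^ 2) := by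
  have hB' : MeasurableSet B := 𝓕.le 0 _ hB
  have hBk : ∀ k, MeasurableSet[𝓕 k] B := fun k => 𝓕.mono (Nat.zero_le k) _ hB
  have hU2 : ∀ k, MemLp (U k) 2 P := fun k =>
    MemLp.of_bound ((hU k).mono (𝓕.le _)).aestronglyMeasurable c (Eventually.of_forall (hUc k))
  have hC := centered hU hU2
  have hT := hD.sub hC
  have hsub : B ∩ {ω | ∃ j ≤ n, 2 * r ≤ |psum D j ω|}
      ⊆ {ω | ∃ j ≤ n, r ≤ |psum (fun k => B.indicator fun ω => U k ω - (P[U k | 𝓕 k]) ω) j ω|}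
        ∪ {ω | ∃ j ≤ n, r ≤ |psum (fun k => B.indicator
          fun ω => D k ω - (U k ω - (P[U k | 𝓕 k]) ω)) j ω|} := by
    rintro ω ⟨hω, j, hj, h⟩
    by_contra hcon
    simp only [Set.mem_union, not_or, Set.mem_ofPred_eq, not_exists, not_and, not_le] at hcon
    have h1 := hcon.1 j hj
    have h2 := hcon.2 j hj
    rw [psum_indicator (D := fun k ω => U k ω - (P[U k | 𝓕 k]) ω) hω] at h1
    rw [psum_indicator (D := fun k ω => D k ω - (U k ω - (P[U k | 𝓕 k]) ω)) hω] at h2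
    have e : psum D j ω = psum (fun k ω => U k ω - (P[U k | 𝓕 k]) ω) j ω
        + psum (fun k ω => D k ω - (U k ω - (P[U k | 𝓕 k]) ω)) j ω := by
      simp only [psum, ← Finset.sum_add_distrib]
      exact Finset.sum_congr rfl fun k _ => by ring
    have h3 := abs_add_le (psum (fun k ω => U k ω - (P[U k | 𝓕 k]) ω) j ω)
      (psum (fun k ω => D k ω - (U k ω - (P[U k | 𝓕 k]) ω)) j ω)
    rw [← e] at h3
    linarith
  refine ((measure_mono hsub).trans (measure_union_le _ _)).trans (add_le_add ?_ ?_)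
  · refine (hC.indicator hB).measure_exists_le_psum_of_bounded (by positivity) hB' (fun k => ?_)
      hr n
    -- The conditional mean of U k is also bounded by c, so the centered variable is bounded by 2c.
    have hcb := ae_bdd_abs_condExp_of_ae_bdd_abs (m := 𝓕 k) (μ := P) (R := c) (f := U k)
      (Eventually.of_forall (hUc k))
    filter_upwards [hcb] with ω hω
    by_cases h : ω ∈ B
    · simp only [h, Set.indicator_of_mem]
      have h1 := abs_sub (U k ω) ((P[U k | 𝓕 k]) ω)
      have h2 : |(P[U k | 𝓕 k]) ω| ≤ c := hω
      linarith [hUc k ω]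
    · simp [h]
  · refine ((hT.indicator hB).measure_exists_le_psum hr n).trans (ENNReal.ofReal_le_ofReal ?_)
    gcongr with k hk
    have e1 : (fun ω => B.indicator (fun ω => D k ω - (U k ω - (P[U k | 𝓕 k]) ω)) ω ^ 2)
        = B.indicator fun ω => (D k ω - (U k ω - (P[U k | 𝓕 k]) ω)) ^ 2 := by
      funext ω
      by_cases h : ω ∈ B <;> simp [h]
    rw [e1, integral_indicator hB']
    -- As D k has conditional mean zero, the unbounded part is D k − U k centered by its own
    -- conditional mean, and centering does not increase the second moment on B.
    refine le_trans (le_of_eq ?_) (setIntegral_sub_condExp_sq_le (𝓕.le k)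
      ((hD.memLp k).sub (hU2 k)) (hBk k))
    refine setIntegral_congr_ae hB' ?_
    filter_upwards [condExp_sub (hD.integrable k) ((hU2 k).integrable one_le_two) (𝓕 k),
      hD.condExp_eq k] with ω h1 h2 _
    rw [h1]
    simp only [Pi.sub_apply, h2, Pi.zero_apply]
    ring

end IsMartingaleDiff

end Truncation

/-! ### Oscillation of the martingale inside blocks. -/

/-- The action `f ↦ ∫⁻ f(y) Q(·; dy)` of a kernel on nonnegative functions. -/
def lop {𝒳 : Type*} [MeasurableSpace 𝒳] (Q : Kernel 𝒳 𝒳) (f : 𝒳 → ENNReal) : 𝒳 → ENNReal :=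
  fun x => ∫⁻ y, f y ∂(Q x)

lemma measurable_lop {𝒳 : Type*} [MeasurableSpace 𝒳] (Q : Kernel 𝒳 𝒳) {f : 𝒳 → ENNReal}
    (hf : Measurable f) : Measurable (lop Q f) :=
  hf.lintegral_kernel

lemma measurable_lop_iterate {𝒳 : Type*} [MeasurableSpace 𝒳] (Q : Kernel 𝒳 𝒳) {f : 𝒳 → ENNReal}
    (hf : Measurable f) (k : ℕ) : Measurable ((lop Q)^[k] f) := by
  induction k with
  | zero => exact hf
  | succ k ih => rw [Function.iterate_succ_apply']; exact measurable_lop Q ih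

/-- The part of `H` where `|H| ≤ c`. -/
def truncFun {α : Type*} (H : α → ℝ) (c : ℝ) : α → ℝ := fun z => if |H z| ≤ c then H z else 0

lemma measurable_truncFun {α : Type*} [MeasurableSpace α] {H : α → ℝ} (hH : Measurable H) (c : ℝ) :
    Measurable (truncFun H c) :=
  Measurable.ite (measurableSet_le hH.abs measurable_const) hH measurable_const

lemma abs_truncFun_le {α : Type*} (H : α → ℝ) {c : ℝ} (hc : 0 ≤ c) (z : α) :
    |truncFun H c z| ≤ c := by
  unfold truncFun
  split_ifs with h
  · exact h
  · simpa using hc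

/-- The conditional second moment `∫ H(x, y)² 1_{|H(x, y)| > c} Q(x; dy)`. -/
def tailMoment {𝒳 : Type*} [MeasurableSpace 𝒳] (Q : Kernel 𝒳 𝒳) (H : 𝒳 × 𝒳 → ℝ) (c : ℝ) :
    𝒳 → ENNReal :=
  fun x => ∫⁻ y, ENNReal.ofReal ((H (x, y) - truncFun H c (x, y)) ^ 2) ∂(Q x)

lemma measurable_tailMoment {𝒳 : Type*} [MeasurableSpace 𝒳] (Q : Kernel 𝒳 𝒳) [IsMarkovKernel Q]
    {H : 𝒳 × 𝒳 → ℝ} (hH : Measurable H) (c : ℝ) : Measurable (tailMoment Q H c) :=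
  Measurable.lintegral_kernel_prod_right'
    (((hH.sub (measurable_truncFun hH c)).pow_const 2).ennreal_ofReal)

namespace IsStationaryErgodicMarkovChain

variable {Ω 𝒳 : Type*} [MeasurableSpace Ω] [MeasurableSpace 𝒳] {P : Measure Ω}
  [IsProbabilityMeasure P] {X : ℤ → Ω → 𝒳} {Q : Kernel 𝒳 𝒳} [IsMarkovKernel Q]
  {g : 𝒳 → ℝ} {H : 𝒳 × 𝒳 → ℝ} {q : ℝ}

lemma setLIntegral_comp_eq (hX : IsStationaryErgodicMarkovChain P X Q) {B : Set Ω}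
    (hB : MeasurableSet[past X 0] B) (k : ℕ) {f : 𝒳 → ENNReal} (hf : Measurable f) :
    ∫⁻ ω in B, f (X k ω) ∂P = ∫⁻ ω in B, ((lop Q)^[k] f) (X 0 ω) ∂P := by
  induction k generalizing f with
  | zero => simp
  | succ k ih =>
    rw [Function.iterate_succ_apply, ← ih (measurable_lop Q hf)]
    exact_mod_cast hX.setLIntegral_pair k (past_mono X (by positivity) B hB)
      (F := fun z => f z.2) (hf.comp measurable_snd)

omit [MeasurableSpace Ω] in
lemma measurableSet_past_preimage (X : ℤ → Ω → 𝒳) {B : Set 𝒳} (hB : MeasurableSet B) :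
    MeasurableSet[past X 0] (X 0 ⁻¹' B) := measurable_past X le_rfl hB

/-- Conditioning on X_k and then moving back to time 0 expresses the tail second moment at time k as
an integral over the initial state, so it can serve as a density in x. -/
lemma ofReal_setIntegral_tail (hX : IsStationaryErgodicMarkovChain P X Q) (hH : Measurable H)
    (hH2 : MemLp H 2 ((P.map (X 0)) ⊗ₘ Q)) {B : Set 𝒳} (hB : MeasurableSet B) {c : ℝ}
    (hc : 0 ≤ c) (k : ℕ) :
    ENNReal.ofReal (∫ ω in X 0 ⁻¹' B, (pairSeq X H k ω - pairSeq X (truncFun H c) k ω) ^ 2 ∂P)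
      = ∫⁻ x in B, ((lop Q)^[k] (tailMoment Q H c)) x ∂(P.map (X 0)) := by
  have := hX.isProbabilityMeasure_map
  have hm := measurable_truncFun hH c
  have hT2 : MemLp (truncFun H c) 2 ((P.map (X 0)) ⊗ₘ Q) :=
    MemLp.of_bound hm.aestronglyMeasurable c (Eventually.of_forall (abs_truncFun_le H hc))
  have hd : MemLp (fun ω => pairSeq X H k ω - pairSeq X (truncFun H c) k ω) 2 P :=
    (hX.memLp_pairSeq hH2 k).sub (hX.memLp_pairSeq hT2 k)
  have hB0 := measurableSet_past_preimage X hB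
  rw [ofReal_integral_eq_lintegral_ofReal hd.integrable_sq.restrict
    (Eventually.of_forall fun ω => sq_nonneg _)]
  refine (hX.setLIntegral_pair k (past_mono X (by positivity) _ hB0)
    (F := fun z => ENNReal.ofReal ((H z - truncFun H c z) ^ 2))
    (((hH.sub hm).pow_const 2).ennreal_ofReal)).trans ?_
  refine (hX.setLIntegral_comp_eq hB0 k (measurable_tailMoment Q hH c)).trans ?_
  rw [setLIntegral_map hB (measurable_lop_iterate Q (measurable_tailMoment Q hH c) k)
    (hX.measurable 0)]

lemma measure_block_le (hX : IsStationaryErgodicMarkovChain P X Q) (hH : Measurable H)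
    (hH2 : MemLp H 2 ((P.map (X 0)) ⊗ₘ Q))
    (hD : IsMartingaleDiff (pastFiltration X hX.measurable) (pairSeq X H) P)
    {B : Set 𝒳} (hB : MeasurableSet B) {c : ℝ} (hc : 0 ≤ c) {r : ℝ} (hr : 0 < r) (j n : ℕ) :
    P (X 0 ⁻¹' B ∩ {ω | ∃ t ≤ n, 2 * r ≤ |pathM H t fun k => future X ω (j + k)|})
      ≤ ENNReal.ofReal (7 * (n : ℝ) ^ 2 * (2 * c) ^ 4 / r ^ 4) * (P.map (X 0)) B
        + ENNReal.ofReal (1 / r ^ 2) * ∑ k ∈ Finset.range n,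
          ∫⁻ x in B, ((lop Q)^[j + k] (tailMoment Q H c)) x ∂(P.map (X 0)) := by
  have hm := measurable_truncFun hH c
  have hB0 : MeasurableSet[shiftFiltration (pastFiltration X hX.measurable) j 0] (X 0 ⁻¹' B) :=
    past_mono X (by positivity) _ (measurableSet_past_preimage X hB)
  have h := (hD.shift j).measure_inter_exists_le_psum hc
    (U := fun k => pairSeq X (truncFun H c) (j + k))
    (fun k => hX.stronglyMeasurable_pairSeq hm (j + k)) (fun k ω => abs_truncFun_le H hc _)
    hB0 hr n
  have e : ∀ t ω, (pathM H t fun k => future X ω (j + k))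
      = psum (fun k => pairSeq X H (j + k)) t ω := fun t ω => by
    rw [pathM_eq]
    simp [psum, pairSeq, future, add_assoc]
  simp only [e]
  refine h.trans (add_le_add (by rw [Measure.map_apply (hX.measurable 0) hB]) (le_of_eq ?_))
  rw [div_eq_inv_mul, ENNReal.ofReal_mul (by positivity), one_div,
    ENNReal.ofReal_sum_of_nonneg fun k _ => integral_nonneg fun ω => sq_nonneg _]
  simp only [hX.ofReal_setIntegral_tail hH hH2 hB hc]

/-- Summing over 2^{d-r} blocks, the bounded parts give 2^{d-r} · 7 · 2^{2r}(2c)⁴/(ε⁴ 2^{2d}),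
whence 112 = 7 · 2⁴ and the small factor 2^r/2^d. The tails of all blocks combine into one average
over the times below 2^d. -/
lemma measure_blockSet_le (hX : IsStationaryErgodicMarkovChain P X Q) (hH : Measurable H)
    (hH2 : MemLp H 2 ((P.map (X 0)) ⊗ₘ Q))
    (hD : IsMartingaleDiff (pastFiltration X hX.measurable) (pairSeq X H) P)
    {B : Set 𝒳} (hB : MeasurableSet B) {c : ℝ} (hc : 0 ≤ c) {ε : ℝ} (hε : 0 < ε) {d r : ℕ}
    (hrd : r ≤ d) :
    P (X 0 ⁻¹' B ∩ future X ⁻¹' blockSet H d r (2 * ε * √(2 ^ d)))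
      ≤ ∫⁻ x in B, (ENNReal.ofReal (112 * c ^ 4 / ε ^ 4 * (2 ^ r / 2 ^ d))
        + ENNReal.ofReal (1 / ε ^ 2) * ((∑ k ∈ Finset.range (2 ^ d),
          ((lop Q)^[k] (tailMoment Q H c)) x) / 2 ^ d)) ∂(P.map (X 0)) := by
  have := hX.isProbabilityMeasure_map
  have hs : 0 < ε * √(2 ^ d) := by positivity
  have hpow : 2 ^ d = 2 ^ (d - r) * 2 ^ r := by rw [← pow_add]; congr 1; omega
  have hpowR : (2 : ℝ) ^ d = 2 ^ (d - r) * 2 ^ r := by exact_mod_cast hpow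
  have hLm : ∀ k, Measurable ((lop Q)^[k] (tailMoment Q H c)) := fun k =>
    measurable_lop_iterate Q (measurable_tailMoment Q hH c) k
  have hsub : X 0 ⁻¹' B ∩ future X ⁻¹' blockSet H d r (2 * ε * √(2 ^ d))
      ⊆ ⋃ i ∈ Finset.range (2 ^ (d - r)), (X 0 ⁻¹' B ∩ {ω | ∃ t ≤ 2 ^ r,
        2 * (ε * √(2 ^ d)) ≤ |pathM H t fun k => future X ω (i * 2 ^ r + k)|}) := by
    rintro ω ⟨hω, i, hi, t, ht, h⟩
    exact Set.mem_iUnion₂.2 ⟨i, Finset.mem_range.2 hi, hω, t, ht, by rwa [← mul_assoc]⟩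
  refine ((measure_mono hsub).trans (measure_biUnion_finset_le _ _)).trans ?_
  refine (Finset.sum_le_sum fun i _ => hX.measure_block_le hH hH2 hD hB hc hs _ _).trans ?_
  rw [Finset.sum_add_distrib, Finset.sum_const, Finset.card_range, ← Finset.mul_sum,
    lintegral_add_left measurable_const, setLIntegral_const,
    lintegral_const_mul _ ((Finset.measurable_fun_sum _ fun k _ => hLm k).div_const _)]
  refine add_le_add (le_of_eq ?_) (le_of_eq ?_)
  · rw [nsmul_eq_mul, ← mul_assoc]
    congr 1
    rw [← ENNReal.ofReal_natCast, ← ENNReal.ofReal_mul (by positivity)]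
    congr 1
    push_cast
    have h4 : √((2 : ℝ) ^ d) ^ 4 = (2 ^ d) ^ 2 := by
      rw [show 4 = 2 * 2 from rfl, pow_mul, Real.sq_sqrt (by positivity)]
    rw [mul_pow ε, h4, hpowR]
    field_simp
    ring
  · simp only [div_eq_mul_inv]
    rw [lintegral_mul_const _ (Finset.measurable_fun_sum _ fun k _ => hLm k),
      lintegral_finsetSum _ fun k _ => hLm k, mul_comm (∑ k ∈ Finset.range (2 ^ d), _), ← mul_assoc]
    congr 1
    · rw [mul_pow, Real.sq_sqrt (by positivity), mul_inv, ← mul_assoc, one_mul,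
        ENNReal.ofReal_mul (by positivity), ENNReal.ofReal_inv_of_pos (by positivity : (0:ℝ) < 2 ^ d),
        ENNReal.ofReal_pow (by norm_num), ENNReal.ofReal_ofNat]
    · rw [hpow]
      generalize 2 ^ (d - r) = N
      induction N with
      | zero => simp
      | succ N ih => rw [Finset.sum_range_succ, ih, Nat.succ_mul, Finset.sum_range_add]

end IsStationaryErgodicMarkovChain

/-! ### The maximal ergodic inequality for the kernel. -/

section MaximalErgodic

variable {𝒳 : Type*} [MeasurableSpace 𝒳]

/-- The partial sums `f + Q f + ⋯ + Q^{n-1} f`, for nonnegative `f`. -/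
def lopSum (Q : Kernel 𝒳 𝒳) (f : 𝒳 → ENNReal) (n : ℕ) : 𝒳 → ENNReal :=
  fun x => ∑ k ∈ Finset.range n, ((lop Q)^[k] f) x

lemma measurable_lopSum (Q : Kernel 𝒳 𝒳) {f : 𝒳 → ENNReal} (hf : Measurable f) (n : ℕ) :
    Measurable (lopSum Q f n) :=
  Finset.measurable_fun_sum _ fun k _ => measurable_lop_iterate Q hf k

lemma lopSum_succ (Q : Kernel 𝒳 𝒳) {f : 𝒳 → ENNReal} (hf : Measurable f) (n : ℕ) (x : 𝒳) :
    lopSum Q f (n + 1) x = f x + lop Q (lopSum Q f n) x := by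
  rw [lopSum, Finset.sum_range_succ', add_comm]
  congr 1
  simp only [lop, lopSum]
  rw [lintegral_finsetSum _ fun k _ => measurable_lop_iterate Q hf k]
  refine Finset.sum_congr rfl fun k _ => ?_
  rw [Function.iterate_succ_apply']
  rfl

variable {Q : Kernel 𝒳 𝒳} {π : Measure 𝒳}

lemma lintegral_lop (hQ : Kernel.Invariant Q π) {f : 𝒳 → ENNReal} (hf : Measurable f) :
    ∫⁻ x, lop Q f x ∂π = ∫⁻ x, f x ∂π := by
  conv_rhs => rw [← hQ.def]
  exact (Measure.lintegral_bind Q.aemeasurable hf.aemeasurable).symm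

lemma lintegral_lop_iterate (hQ : Kernel.Invariant Q π) {f : 𝒳 → ENNReal} (hf : Measurable f)
    (k : ℕ) : ∫⁻ x, ((lop Q)^[k] f) x ∂π = ∫⁻ x, f x ∂π := by
  induction k with
  | zero => rfl
  | succ k ih =>
    rw [Function.iterate_succ_apply', lintegral_lop hQ (measurable_lop_iterate Q hf k), ih]

lemma lintegral_lopSum (hQ : Kernel.Invariant Q π) {f : 𝒳 → ENNReal} (hf : Measurable f) (n : ℕ) :
    ∫⁻ x, lopSum Q f n x ∂π = n * ∫⁻ x, f x ∂π := by
  simp only [lopSum]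
  rw [lintegral_finsetSum _ fun k _ => measurable_lop_iterate Q hf k]
  simp [lintegral_lop_iterate hQ hf]

variable [IsMarkovKernel Q]

/-- Garsia's argument. Let G be the maximum over n ≤ N of the partial sums minus nt; truncated
subtraction makes it a maximum of positive parts. Then G + t 1_E ≤ f + QG, and integrating against
the invariant π cancels G. -/
lemma mul_measure_exists_le_lt_lopSum_le (hQ : Kernel.Invariant Q π) {f : 𝒳 → ENNReal}
    (hf : Measurable f) (hfi : ∫⁻ x, f x ∂π ≠ ⊤) {t : ENNReal} (ht : t ≠ ⊤) (N : ℕ) :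
    t * π {x | ∃ n ≤ N, n * t < lopSum Q f n x} ≤ ∫⁻ x, f x ∂π := by
  set G : 𝒳 → ENNReal := fun x =>
    (Finset.range (N + 1)).sup' Finset.nonempty_range_add_one fun n => lopSum Q f n x - n * t with hG
  have hGm : Measurable G := Finset.measurable_range_sup'' fun n _ =>
    (measurable_lopSum Q hf n).sub measurable_const
  set E := {x | ∃ n ≤ N, n * t < lopSum Q f n x} with hE
  have hEm : MeasurableSet E := by
    refine measurableSet_setOfPred.2 (Measurable.exists fun n => Measurable.and measurable_const ?_)
    exact measurableSet_setOfPred.1 (measurableSet_lt measurable_const (measurable_lopSum Q hf n))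
  have hleG : ∀ n ≤ N, ∀ x, lopSum Q f n x ≤ G x + n * t := fun n hn x => by
    rw [← tsub_le_iff_right]
    exact Finset.le_sup' (fun n => lopSum Q f n x - n * t) (Finset.mem_range.2 (by omega))
  -- On E the maximum is positive, hence attained at some m + 1, and the sum there is f plus Q of
  -- the m-th sum, which is at most f + QG + mt. Off E, G vanishes.
  have hpt : ∀ x, G x + E.indicator (fun _ => t) x ≤ f x + lop Q G x := by
    intro x
    obtain ⟨n, hn, hGn⟩ := Finset.exists_mem_eq_sup' (s := Finset.range (N + 1))
      Finset.nonempty_range_add_one fun n => lopSum Q f n x - n * t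
    have hGx : G x = lopSum Q f n x - n * t := hGn
    by_cases hx : x ∈ E
    · have hxE := hx
      obtain ⟨j, hj, hjt⟩ := hx
      have hpos : 0 < G x := by
        have h1 : 0 < lopSum Q f j x - j * t := tsub_pos_of_lt hjt
        exact h1.trans_le (Finset.le_sup' (fun n => lopSum Q f n x - n * t)
          (Finset.mem_range.2 (by omega)))
      rw [hGx, tsub_pos_iff_lt] at hpos
      rw [Set.indicator_of_mem hxE, hGx]
      obtain _ | m := n
      · simp [lopSum] at hpos
      have hmt : (m : ENNReal) * t ≠ ⊤ := ENNReal.mul_ne_top (by simp) ht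
      have h2 : lop Q (lopSum Q f m) x ≤ lop Q G x + m * t := by
        calc lop Q (lopSum Q f m) x ≤ ∫⁻ y, (G y + m * t) ∂(Q x) :=
              lintegral_mono fun y => hleG m (by have := Finset.mem_range.1 hn; omega) y
          _ = _ := by rw [lintegral_add_right _ measurable_const]; simp [lop]
      have h3 : lopSum Q f (m + 1) x ≤ f x + lop Q G x + m * t := by
        rw [lopSum_succ Q hf, add_assoc]; gcongr
      have hcast : ((m + 1 : ℕ) : ENNReal) * t = m * t + t := by push_cast; ring
      rw [hcast] at hpos ⊢
      rw [← tsub_tsub, tsub_add_cancel_of_le]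
      · rwa [tsub_le_iff_right]
      · exact ENNReal.le_sub_of_add_le_left hmt hpos.le
    · have h0 : G x = 0 := by
        rw [hGx, tsub_eq_zero_iff_le]
        by_contra hcon
        exact hx ⟨n, by have := Finset.mem_range.1 hn; omega, not_le.1 hcon⟩
      simp [h0, hx]
  -- Finiteness is needed to cancel ∫ G on both sides in `ENNReal`.
  have hGfin : ∫⁻ x, G x ∂π ≠ ⊤ := by
    refine ne_top_of_le_ne_top ?_ (lintegral_mono fun x => (?_ : G x ≤ lopSum Q f N x))
    · rw [lintegral_lopSum hQ hf]; exact ENNReal.mul_ne_top (by simp) hfi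
    · refine Finset.sup'_le _ _ fun n hn => tsub_le_self.trans ?_
      exact Finset.sum_le_sum_of_subset (Finset.range_subset_range.2 (by
        have := Finset.mem_range.1 hn; omega))
  have hint := lintegral_mono (μ := π) hpt
  rw [lintegral_add_left hGm, lintegral_add_left hf, lintegral_lop hQ hGm,
    lintegral_indicator_const hEm, add_comm] at hint
  exact (ENNReal.add_le_add_iff_right hGfin).1 hint

/-- The maximal ergodic inequality for a Markov kernel with an invariant measure. -/
lemma mul_measure_exists_lt_lopSum_le (hQ : Kernel.Invariant Q π) {f : 𝒳 → ENNReal}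
    (hf : Measurable f) (hfi : ∫⁻ x, f x ∂π ≠ ⊤) {t : ENNReal} (ht : t ≠ ⊤) :
    t * π {x | ∃ n : ℕ, n * t < lopSum Q f n x} ≤ ∫⁻ x, f x ∂π := by
  have hU : {x | ∃ n : ℕ, n * t < lopSum Q f n x}
      = ⋃ N : ℕ, {x | ∃ n ≤ N, n * t < lopSum Q f n x} := by
    ext x
    simp only [Set.mem_ofPred_eq, Set.mem_iUnion]
    exact ⟨fun ⟨n, hn⟩ => ⟨n, n, le_rfl, hn⟩, fun ⟨_, n, _, hn⟩ => ⟨n, hn⟩⟩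
  have hmono : Monotone fun N : ℕ => {x | ∃ n ≤ N, n * t < lopSum Q f n x} :=
    fun N N' h x ⟨n, hn, hx⟩ => ⟨n, hn.trans h, hx⟩
  rw [hU, hmono.measure_iUnion, ENNReal.mul_iSup]
  exact iSup_le fun N => mul_measure_exists_le_lt_lopSum_le hQ hf hfi ht N

variable [IsProbabilityMeasure π]

lemma tendsto_lintegral_tailMoment {H : 𝒳 × 𝒳 → ℝ} (hH : Measurable H)
    (hH2 : MemLp H 2 (π ⊗ₘ Q)) :
    Tendsto (fun c : ℕ => ∫⁻ x, tailMoment Q H c x ∂π) atTop (𝓝 0) := by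
  have hm : ∀ c : ℝ, Measurable fun z => ENNReal.ofReal ((H z - truncFun H c z) ^ 2) := fun c =>
    ((hH.sub (measurable_truncFun hH c)).pow_const 2).ennreal_ofReal
  have e : ∀ c : ℕ, ∫⁻ x, tailMoment Q H c x ∂π
      = ∫⁻ z, ENNReal.ofReal ((H z - truncFun H c z) ^ 2) ∂(π ⊗ₘ Q) := fun c =>
    (Measure.lintegral_compProd (hm c)).symm
  simp only [e]
  have hlim := tendsto_lintegral_of_dominated_convergence (μ := π ⊗ₘ Q)
    (F := fun (c : ℕ) z => ENNReal.ofReal ((H z - truncFun H c z) ^ 2)) (f := fun _ => 0)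
    (fun z => ENNReal.ofReal (H z ^ 2)) (fun c => hm c)
    (fun c => Eventually.of_forall fun z => ?_) ?_ (Eventually.of_forall fun z => ?_)
  · simpa using hlim
  · refine ENNReal.ofReal_le_ofReal ?_
    unfold truncFun
    split_ifs <;> simp [sq_nonneg]
  · exact hH2.integrable_sq.lintegral_lt_top.ne
  · refine tendsto_const_nhds.congr' ?_
    obtain ⟨N, hN⟩ := exists_nat_ge |H z|
    filter_upwards [eventually_ge_atTop N] with c hc
    have : |H z| ≤ c := hN.trans (by exact_mod_cast hc)
    simp [truncFun, this]

/-- Averages of the conditional tail moments are uniformly small at almost every point. -/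
lemma ae_exists_lopSum_tailMoment_le (hQ : Kernel.Invariant Q π) {H : 𝒳 × 𝒳 → ℝ}
    (hH : Measurable H) (hH2 : MemLp H 2 (π ⊗ₘ Q)) :
    ∀ᵐ x ∂π, ∀ t : ℝ, 0 < t → ∃ c : ℕ, ∀ n : ℕ,
      lopSum Q (tailMoment Q H c) n x ≤ n * ENNReal.ofReal t := by
  have hlim := tendsto_lintegral_tailMoment hH hH2
  have key : ∀ t : ℝ, 0 < t → ∀ᵐ x ∂π, ∃ c : ℕ, ∀ n : ℕ,
      lopSum Q (tailMoment Q H c) n x ≤ n * ENNReal.ofReal t := by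
    intro t ht
    have ht0 : ENNReal.ofReal t ≠ 0 := by simpa using ht
    rw [ae_iff]
    set S := {x | ¬ ∃ c : ℕ, ∀ n : ℕ, lopSum Q (tailMoment Q H c) n x ≤ n * ENNReal.ofReal t}
    -- S lies in the exceedance set of every level c, so the maximal inequality applies with each c,
    -- and the right side tends to 0.
    have hS : ∀ᶠ c : ℕ in atTop, ENNReal.ofReal t * π S ≤ ∫⁻ x, tailMoment Q H c x ∂π := by
      filter_upwards [hlim.eventually_lt_const ENNReal.zero_lt_top] with c hc
      refine le_trans ?_ (mul_measure_exists_lt_lopSum_le hQ (measurable_tailMoment Q hH c) hc.ne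
        (ENNReal.ofReal_ne_top (r := t)))
      gcongr
      intro x hx
      simp only [S, Set.mem_ofPred_eq, not_exists, not_forall, not_le] at hx
      exact hx c
    have h0 : ENNReal.ofReal t * π S ≤ 0 := ge_of_tendsto hlim hS
    exact (mul_eq_zero.1 (le_antisymm h0 zero_le)).resolve_left ht0
  have hall : ∀ᵐ x ∂π, ∀ j : ℕ, ∃ c : ℕ, ∀ n : ℕ,
      lopSum Q (tailMoment Q H c) n x ≤ n * ENNReal.ofReal (1 / (j + 1)) :=
    ae_all_iff.2 fun j => key _ (by positivity)
  filter_upwards [hall] with x hx t ht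
  obtain ⟨j, hj⟩ := exists_nat_one_div_lt ht
  obtain ⟨c, hc⟩ := hx j
  refine ⟨c, fun n => (hc n).trans ?_⟩
  gcongr

end MaximalErgodic

/-! ### From powers of two to all n. -/

section PathSets

variable {𝒳 : Type*} [MeasurableSpace 𝒳] {g : 𝒳 → ℝ} {H : 𝒳 × 𝒳 → ℝ}

lemma measurableSet_coarseSet (hg : Measurable g) (hH : Measurable H) (d r : ℕ) (c : ℝ) :
    MeasurableSet (coarseSet g H d r c) :=
  measurableSet_setOfPred.2 (Measurable.exists fun i => Measurable.and measurable_const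
    (measurableSet_setOfPred.1 (measurableSet_le measurable_const
      (measurable_pathR hg hH (i * 2 ^ r)).abs)))

lemma measurableSet_jumpSet (hg : Measurable g) (d r : ℕ) (c : ℝ) :
    MeasurableSet (jumpSet g d r c) :=
  measurableSet_setOfPred.2 (Measurable.exists fun k => Measurable.and measurable_const
    (measurableSet_setOfPred.1 (measurableSet_le measurable_const
      (((hg.comp (measurable_pi_apply (k + 1))).abs).const_mul _))))

lemma measurableSet_blockSet (hH : Measurable H) (d r : ℕ) (c : ℝ) :
    MeasurableSet (blockSet H d r c) :=
  measurableSet_setOfPred.2 (Measurable.exists fun i => Measurable.and measurable_const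
    (Measurable.exists fun t => Measurable.and measurable_const
      (measurableSet_setOfPred.1 (measurableSet_le measurable_const
        ((measurable_pathM hH t).comp
          (measurable_pi_lambda _ fun k => measurable_pi_apply (i * 2 ^ r + k))).abs))))

omit [MeasurableSpace 𝒳] in
lemma pathMaxR_mono (g : 𝒳 → ℝ) (H : 𝒳 × 𝒳 → ℝ) {m n : ℕ} (h : m ≤ n) (y : ℕ → 𝒳) :
    pathMaxR g H m y ≤ pathMaxR g H n y :=
  Finset.sup'_mono _ (Finset.range_subset_range.2 (by omega)) _

/-- Passage from powers of `2` to all `n`. -/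
lemma tendsto_measure_pathMaxR {α : Type*} [MeasurableSpace α] {μ : Measure α} {φ : α → ℕ → 𝒳}
    {L : ℕ} (h : ∀ ε : ℝ, 0 < ε → Tendsto (fun d : ℕ => μ (φ ⁻¹' (coarseSet g H d (d / L)
      (2 * ε * √(2 ^ d)) ∪ jumpSet g d (d / L) (2 * ε * √(2 ^ d))))
        + μ (φ ⁻¹' blockSet H d (d / L) (2 * ε * √(2 ^ d)))) atTop (𝓝 0)) {ε : ℝ} (hε : 0 < ε) :
    Tendsto (fun n : ℕ => μ {a | ε * √(n : ℝ) ≤ pathMaxR g H n (φ a)}) atTop (𝓝 0) := by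
  -- With 2^d ≤ 2n one has √(2^d) ≤ 2√n, so the threshold 3 · 2 · (ε/12) · √(2^d) is at most ε√n.
  have h0 := h (ε / 12) (by positivity)
  have hclog : Tendsto (fun n : ℕ => Nat.clog 2 n) atTop atTop := by
    refine tendsto_atTop.2 fun b => ?_
    filter_upwards [eventually_ge_atTop (2 ^ b)] with n hn
    have := Nat.le_pow_clog (b := 2) (by norm_num) n
    exact (Nat.pow_le_pow_iff_right (by norm_num)).1 (hn.trans this)
  refine tendsto_of_tendsto_of_tendsto_of_le_of_le' tendsto_const_nhds (h0.comp hclog)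
    (Eventually.of_forall fun _ => zero_le) ?_
  filter_upwards [eventually_ge_atTop 2] with n hn
  simp only [Function.comp]
  set d := Nat.clog 2 n with hd
  have hnd : n ≤ 2 ^ d := Nat.le_pow_clog (by norm_num) n
  have hd2 : 2 ^ d ≤ 2 * n := by
    have h1 : 2 ^ (d - 1) < n := Nat.pow_pred_clog_lt_self (by norm_num) (by omega)
    have h2 : 0 < d := Nat.clog_pos (by norm_num) hn
    have h3 : 2 ^ d = 2 * 2 ^ (d - 1) := by rw [← pow_succ']; congr 1; omega
    omega
  refine (measure_mono ?_).trans (measure_union_le _ _)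
  intro a ha
  have hs : √((2 : ℝ) ^ d) ≤ 2 * √(n : ℝ) := by
    rw [Real.sqrt_le_left (by positivity), mul_pow, Real.sq_sqrt (by positivity)]
    have : (2 : ℝ) ^ d ≤ 2 * n := by exact_mod_cast hd2
    linarith [(Nat.cast_nonneg n : (0 : ℝ) ≤ n)]
  have hmem : 3 * (2 * (ε / 12) * √(2 ^ d)) ≤ pathMaxR g H (2 ^ d) (φ a) := by
    have h1 : ε * √(n : ℝ) ≤ pathMaxR g H n (φ a) := ha
    have h2 := pathMaxR_mono g H hnd (φ a)
    nlinarith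
  rcases pathMaxR_subset g H (Nat.div_le_self d L) (by positivity) hmem with h1 | h1 | h1
  · exact Or.inl (Or.inl h1)
  · exact Or.inl (Or.inr h1)
  · exact Or.inr h1

end PathSets

lemma tendsto_two_pow_div (L : ℕ) (hL : 2 ≤ L) :
    Tendsto (fun d : ℕ => (2 : ℝ) ^ (d / L) / 2 ^ d) atTop (𝓝 0) := by
  have h1 : Tendsto (fun d : ℕ => ((1 : ℝ) / 2) ^ (d / 2)) atTop (𝓝 0) :=
    (tendsto_pow_atTop_nhds_zero_of_lt_one (by norm_num) (by norm_num)).comp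
      (Nat.tendsto_div_const_atTop (by norm_num))
  refine squeeze_zero (fun d => by positivity) (fun d => ?_) h1
  have h2 : d / L ≤ d / 2 := Nat.div_le_div_left hL (by norm_num)
  have h3 : (2 : ℝ) ^ (d / L + d / 2) ≤ 2 ^ d := pow_le_pow_right₀ (by norm_num) (by omega)
  rw [pow_add] at h3
  rw [div_le_iff₀ (by positivity), div_pow, one_pow, one_div, inv_mul_eq_div,
    le_div_iff₀ (by positivity)]
  exact h3

/-- A bound by vanishing terms plus an arbitrarily small constant. -/
lemma tendsto_zero_of_forall_le {f : ℕ → ENNReal} {a : ℕ → ℝ} (ha : Tendsto a atTop (𝓝 0))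
    {K : ℝ} (hK : 0 < K)
    (h : ∀ t : ℝ, 0 < t → ∃ C : ℝ, ∀ d, f d ≤ ENNReal.ofReal (C * a d)
      + ENNReal.ofReal K * ENNReal.ofReal t) : Tendsto f atTop (𝓝 0) := by
  refine ENNReal.tendsto_nhds_zero.2 fun ε hε => ?_
  by_cases hεt : ε = ⊤
  · simp [hεt]
  have hε0 : 0 < ε.toReal := ENNReal.toReal_pos hε.ne' hεt
  obtain ⟨C, hC⟩ := h (ε.toReal / (2 * K)) (by positivity)
  have h1 : ∀ᶠ d in atTop, C * a d < ε.toReal / 2 :=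
    (by simpa using ha.const_mul C : Tendsto (fun d => C * a d) atTop (𝓝 0)).eventually_lt_const
      (by positivity)
  filter_upwards [h1] with d hd
  refine (hC d).trans ?_
  rw [← ENNReal.ofReal_mul hK.le]
  calc _ ≤ ENNReal.ofReal (ε.toReal / 2) + ENNReal.ofReal (ε.toReal / 2) := by
        gcongr
        apply le_of_eq
        field_simp
    _ = ENNReal.ofReal ε.toReal := by
        rw [← ENNReal.ofReal_add (by positivity) (by positivity)]; congr 1; ring
    _ = ε := ENNReal.ofReal_toReal hεt

/-- The disintegration that transfers bounds localized on {X_0 ∈ B} to P^x. -/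
lemma IsRegularCondLaw.setLIntegral_eq {Ω 𝒳 : Type*} [MeasurableSpace Ω] [MeasurableSpace 𝒳]
    {P : Measure Ω} [IsProbabilityMeasure P] {X : ℤ → Ω → 𝒳} {Px : Kernel 𝒳 (ℕ → 𝒳)}
    [IsMarkovKernel Px] (h : IsRegularCondLaw P X Px) (hX : ∀ n, Measurable (X n))
    {A : Set (ℕ → 𝒳)} (hA : MeasurableSet A) {B : Set 𝒳} (hB : MeasurableSet B) :
    ∫⁻ x in B, Px x A ∂(P.map (X 0)) = P (X 0 ⁻¹' B ∩ future X ⁻¹' A) := by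
  have hf : Measurable (future X) := measurable_pi_lambda _ fun _ => hX _
  have := Measure.isProbabilityMeasure_map (μ := P) (hX 0).aemeasurable
  have h1 := congrArg (fun μ => μ (B ×ˢ A)) h
  rw [Measure.compProd_apply_prod hB hA, Measure.map_apply ((hX 0).prodMk hf) (hB.prod hA)] at h1
  exact h1

/-! ### Negligibility of the remainder under P and under P^x. -/

namespace IsStationaryErgodicMarkovChain

variable {Ω 𝒳 : Type*} [MeasurableSpace Ω] [MeasurableSpace 𝒳] {P : Measure Ω}
  [IsProbabilityMeasure P] {X : ℤ → Ω → 𝒳} {Q : Kernel 𝒳 𝒳} [IsMarkovKernel Q]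
  {g : 𝒳 → ℝ} {H : 𝒳 × 𝒳 → ℝ} {q : ℝ}

/-- By invariance the integrated tail average is ∫ `tailMoment`, whatever d is; choose c to make it
small, then let d → ∞ to remove the bounded part. -/
lemma tendsto_measure_blockSet (hX : IsStationaryErgodicMarkovChain P X Q) (hH : Measurable H)
    (hH2 : MemLp H 2 ((P.map (X 0)) ⊗ₘ Q))
    (hD : IsMartingaleDiff (pastFiltration X hX.measurable) (pairSeq X H) P) {L : ℕ} (hL : 2 ≤ L)
    {ε : ℝ} (hε : 0 < ε) :
    Tendsto (fun d : ℕ => P (future X ⁻¹' blockSet H d (d / L) (2 * ε * √(2 ^ d)))) atTop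
      (𝓝 0) := by
  have := hX.isProbabilityMeasure_map
  refine tendsto_zero_of_forall_le (tendsto_two_pow_div L hL) (K := 1 / ε ^ 2) (by positivity)
    fun t ht => ?_
  obtain ⟨c, hc⟩ := ((tendsto_lintegral_tailMoment hH hH2).eventually_le_const
    (ENNReal.ofReal_pos.2 ht)).exists
  refine ⟨112 * (c : ℝ) ^ 4 / ε ^ 4, fun d => ?_⟩
  have h := hX.measure_blockSet_le hH hH2 hD MeasurableSet.univ (Nat.cast_nonneg c) hε
    (Nat.div_le_self d L)
  rw [Set.preimage_univ, Set.univ_inter, setLIntegral_univ] at h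
  refine h.trans ?_
  have hm := measurable_lopSum Q (measurable_tailMoment Q hH c) (2 ^ d)
  have hS := lintegral_lopSum hX.invariant (measurable_tailMoment Q hH c) (2 ^ d)
  rw [lintegral_add_left measurable_const, lintegral_const, measure_univ, mul_one]
  gcongr
  change ∫⁻ x, ENNReal.ofReal (1 / ε ^ 2) * (lopSum Q (tailMoment Q H c) (2 ^ d) x / 2 ^ d)
    ∂(P.map (X 0)) ≤ _
  rw [lintegral_const_mul _ (hm.div_const _)]
  simp only [div_eq_mul_inv]
  rw [lintegral_mul_const _ hm, hS]
  gcongr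
  push_cast
  rw [mul_right_comm, ENNReal.mul_inv_cancel (by simp) (by simp), one_mul]
  exact hc

/-- The block bound on all events {X_0 ∈ B} is an inequality between integrals over arbitrary B,
hence holds pointwise for almost every x. The maximal ergodic inequality then supplies a c that
works for all times at once. -/
lemma ae_tendsto_blockSet (hX : IsStationaryErgodicMarkovChain P X Q) (hH : Measurable H)
    (hH2 : MemLp H 2 ((P.map (X 0)) ⊗ₘ Q))
    (hD : IsMartingaleDiff (pastFiltration X hX.measurable) (pairSeq X H) P) {L : ℕ} (hL : 2 ≤ L)
    {ε : ℝ} (hε : 0 < ε) {Px : Kernel 𝒳 (ℕ → 𝒳)} [IsMarkovKernel Px]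
    (hPx : IsRegularCondLaw P X Px) :
    ∀ᵐ x ∂(P.map (X 0)), Tendsto (fun d : ℕ => Px x (blockSet H d (d / L) (2 * ε * √(2 ^ d))))
      atTop (𝓝 0) := by
  have := hX.isProbabilityMeasure_map
  have hA : ∀ d : ℕ, MeasurableSet (blockSet H d (d / L) (2 * ε * √(2 ^ d))) := fun d =>
    measurableSet_blockSet hH _ _ _
  have hle : ∀ᵐ x ∂(P.map (X 0)), ∀ c d : ℕ, Px x (blockSet H d (d / L) (2 * ε * √(2 ^ d)))
      ≤ ENNReal.ofReal (112 * (c : ℝ) ^ 4 / ε ^ 4 * (2 ^ (d / L) / 2 ^ d))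
        + ENNReal.ofReal (1 / ε ^ 2) * (lopSum Q (tailMoment Q H c) (2 ^ d) x / 2 ^ d) := by
    refine ae_all_iff.2 fun c => ae_all_iff.2 fun d => ?_
    refine ae_le_of_forall_setLIntegral_le_of_sigmaFinite (Px.measurable_coe (hA d))
      fun B hB _ => ?_
    rw [hPx.setLIntegral_eq hX.measurable (hA d) hB]
    exact hX.measure_blockSet_le hH hH2 hD hB (Nat.cast_nonneg c) hε (Nat.div_le_self d L)
  filter_upwards [hle, ae_exists_lopSum_tailMoment_le hX.invariant hH hH2] with x h1 h2
  refine tendsto_zero_of_forall_le (tendsto_two_pow_div L hL) (K := 1 / ε ^ 2) (by positivity)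
    fun t ht => ?_
  obtain ⟨c, hc⟩ := h2 t ht
  refine ⟨112 * (c : ℝ) ^ 4 / ε ^ 4, fun d => (h1 c d).trans ?_⟩
  gcongr
  have := hc (2 ^ d)
  push_cast at this
  exact ENNReal.div_le_of_le_mul' this

-- The integral of ∑ P^x(A_d) over π is ∑ P(A_d) < ∞, so for almost every x the series converges and
-- its terms vanish.
omit [IsMarkovKernel Q] in
lemma ae_tendsto_of_summable (hX : IsStationaryErgodicMarkovChain P X Q)
    {Px : Kernel 𝒳 (ℕ → 𝒳)} [IsMarkovKernel Px] (hPx : IsRegularCondLaw P X Px)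
    {A : ℕ → Set (ℕ → 𝒳)} (hA : ∀ d, MeasurableSet (A d)) {u : ℕ → ℝ} (hu : Summable u)
    (hAu : ∀ d, P (future X ⁻¹' A d) ≤ ENNReal.ofReal (u d)) :
    ∀ᵐ x ∂(P.map (X 0)), Tendsto (fun d : ℕ => Px x (A d)) atTop (𝓝 0) := by
  have hm : ∀ d, Measurable fun x => Px x (A d) := fun d => Px.measurable_coe (hA d)
  have hsum : ∫⁻ x, ∑' d, Px x (A d) ∂(P.map (X 0)) ≠ ⊤ := by
    rw [lintegral_tsum fun d => (hm d).aemeasurable]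
    refine ne_top_of_le_ne_top (hu.tsum_ofReal_ne_top) (ENNReal.tsum_le_tsum fun d => ?_)
    have h := hPx.setLIntegral_eq hX.measurable (hA d) MeasurableSet.univ
    rw [Set.preimage_univ, Set.univ_inter, setLIntegral_univ] at h
    rw [h]
    exact hAu d
  filter_upwards [ae_lt_top (Measurable.tsum hm) hsum] with x hx
  exact ENNReal.tendsto_atTop_zero_of_tsum_ne_top hx.ne

end IsStationaryErgodicMarkovChain

namespace IsStationaryErgodicMarkovChain

variable {Ω 𝒳 : Type*} [MeasurableSpace Ω] [MeasurableSpace 𝒳] {P : Measure Ω}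
  [IsProbabilityMeasure P] {X : ℤ → Ω → 𝒳} {Q : Kernel 𝒳 𝒳} [IsMarkovKernel Q]
  {g : 𝒳 → ℝ} {H : 𝒳 × 𝒳 → ℝ} {q : ℝ}

/-- The remainder is uniformly negligible in probability. -/
lemma tendsto_measure_pathMaxR (hX : IsStationaryErgodicMarkovChain P X Q)
    (hg : Measurable g) {p : ℝ} (hp : 2 < p) (hgp : MemLp g (ENNReal.ofReal p) (P.map (X 0)))
    (h2 : MemLp g 2 (P.map (X 0)))
    (hq : 2 ≤ q) (ha : (fun n => l2 (P.map (X 0)) (orbitFun Q g n)) =o[atTop] logRate q)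
    (hH : IsLimitDiff ((P.map (X 0)) ⊗ₘ Q) Q g H) {ε : ℝ} (hε : 0 < ε) :
    Tendsto (fun n : ℕ => P {ω | ε * √(n : ℝ) ≤ pathMaxR g H n (future X ω)}) atTop (𝓝 0) := by
  obtain ⟨L, hL, h⟩ := hX.exists_bound_coarseSet_jumpSet hg hp hgp hq ha hH
  refine MartApprox.tendsto_measure_pathMaxR (L := L) (fun ε hε => ?_) hε
  obtain ⟨u, -, hu, hu0, -⟩ := h (2 * ε) (by positivity)
  have h1 : Tendsto (fun d : ℕ => ENNReal.ofReal (u d)) atTop (𝓝 0) := by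
    simpa using ENNReal.tendsto_ofReal hu0
  have h3 := tendsto_of_tendsto_of_tendsto_of_le_of_le tendsto_const_nhds h1
    (fun _ => zero_le) hu
  simpa using h3.add (hX.tendsto_measure_blockSet hH.measurable hH.memLp
    (hX.isMartingaleDiff hg h2 hH) hL hε)

/-- The remainder is uniformly negligible in probability under almost every `P^x`. -/
lemma ae_tendsto_pathMaxR (hX : IsStationaryErgodicMarkovChain P X Q)
    (hg : Measurable g) {p : ℝ} (hp : 2 < p) (hgp : MemLp g (ENNReal.ofReal p) (P.map (X 0)))
    (h2 : MemLp g 2 (P.map (X 0)))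
    (hq : 5 / 2 < q) (ha : (fun n => l2 (P.map (X 0)) (orbitFun Q g n)) =o[atTop] logRate q)
    (hH : IsLimitDiff ((P.map (X 0)) ⊗ₘ Q) Q g H) {Px : Kernel 𝒳 (ℕ → 𝒳)} [IsMarkovKernel Px]
    (hPx : IsRegularCondLaw P X Px) :
    ∀ᵐ x ∂(P.map (X 0)), ∀ ε : ℝ, 0 < ε → Tendsto
      (fun n : ℕ => Px x {y | ε * √(n : ℝ) ≤ pathMaxR g H n y}) atTop (𝓝 0) := by
  obtain ⟨L, hL, h⟩ := hX.exists_bound_coarseSet_jumpSet hg hp hgp (by linarith) ha hH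
  have key : ∀ ε : ℝ, 0 < ε → ∀ᵐ x ∂(P.map (X 0)),
      Tendsto (fun d : ℕ => Px x (coarseSet g H d (d / L) (2 * ε * √(2 ^ d))
        ∪ jumpSet g d (d / L) (2 * ε * √(2 ^ d)))
        + Px x (blockSet H d (d / L) (2 * ε * √(2 ^ d)))) atTop (𝓝 0) := by
    intro ε hε
    obtain ⟨u, -, hu, -, hus⟩ := h (2 * ε) (by positivity)
    have h1 := hX.ae_tendsto_of_summable hPx (fun d => (measurableSet_coarseSet hg hH.measurable d
      (d / L) (2 * ε * √(2 ^ d))).union (measurableSet_jumpSet hg d (d / L) (2 * ε * √(2 ^ d))))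
      (hus hq) hu
    filter_upwards [h1, hX.ae_tendsto_blockSet hH.measurable hH.memLp
      (hX.isMartingaleDiff hg h2 hH) hL hε hPx] with x hx1 hx2
    simpa using hx1.add hx2
  -- Only countably many thresholds enter the null set; the events shrink as ε grows, so 1/(j+1) < δ
  -- handles every δ.
  filter_upwards [ae_all_iff.2 fun j : ℕ => key (1 / (j + 1)) (by positivity)] with x hx
  intro ε hε
  refine MartApprox.tendsto_measure_pathMaxR (φ := id) (L := L) (fun δ hδ => ?_) hε
  obtain ⟨j, hj⟩ := exists_nat_one_div_lt hδ
  refine tendsto_of_tendsto_of_tendsto_of_le_of_le tendsto_const_nhds (hx j)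
    (fun _ => zero_le) fun d => ?_
  have hle : 2 * (1 / ((j : ℝ) + 1)) * √(2 ^ d) ≤ 2 * δ * √(2 ^ d) := by gcongr
  refine add_le_add (measure_mono (Set.union_subset_union ?_ ?_)) (measure_mono ?_)
  · rintro y ⟨i, hi, hy⟩
    exact ⟨i, hi, hle.trans hy⟩
  · rintro y ⟨i, hi, hy⟩
    exact ⟨i, hi, hle.trans hy⟩
  · rintro y ⟨i, hi, t, ht, hy⟩
    exact ⟨i, hi, t, ht, hle.trans hy⟩

end IsStationaryErgodicMarkovChain

end MartApprox

end

theorem theorem3 {Ω 𝒳 : Type*} [MeasurableSpace Ω] [MeasurableSpace 𝒳]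
    (P : Measure Ω) [IsProbabilityMeasure P] (X : ℤ → Ω → 𝒳)
    (Q : Kernel 𝒳 𝒳) [IsMarkovKernel Q]
    (hX : MartApprox.IsStationaryErgodicMarkovChain P X Q)
    (g : 𝒳 → ℝ) (hg : Measurable g) (hg_mean : ∫ x, g x ∂(P.map (X 0)) = 0)
    (p : ENNReal) (hp : 2 < p) (hgp : MemLp g p (P.map (X 0)))
    (q : ℝ) (hq : 2 ≤ q)
    (hrate : (fun n : ℕ =>
        (eLpNorm (P[fun ω => MartApprox.pathS g n (MartApprox.future X ω) |
          MeasurableSpace.comap (X 0) inferInstance]) 2 P).toReal)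
      =o[atTop] fun n : ℕ => √(n : ℝ) * Real.log n ^ (-q)) :
    -- the limit of `σ_n² / n` exists
    (∃ σ2 : ℝ, Tendsto
      (fun n : ℕ => (∫ ω, MartApprox.pathS g n (MartApprox.future X ω) ^ 2 ∂P) / (n : ℝ))
      atTop (𝓝 σ2)) ∧
    -- `H = lim H_n` exists in `L²(π₁)`
    (∃ H : 𝒳 × 𝒳 → ℝ,
      MartApprox.IsLimitDiff (P.map fun ω => (X 0 ω, X 1 ω)) Q g H) ∧
    ∀ H : 𝒳 × 𝒳 → ℝ,
      MartApprox.IsLimitDiff (P.map fun ω => (X 0 ω, X 1 ω)) Q g H →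
      -- `M_n` is a martingale with stationary increments, close to `S_n` in `L²`
      Martingale (fun (n : ℕ) ω => MartApprox.pathM H n (MartApprox.future X ω))
        (MartApprox.pastFiltration X hX.measurable) P ∧
      MartApprox.HasStationaryIncrements P
        (fun (n : ℕ) ω => MartApprox.pathM H n (MartApprox.future X ω)) ∧
      ((fun n : ℕ =>
        (eLpNorm (fun ω => MartApprox.pathS g n (MartApprox.future X ω)
          - MartApprox.pathM H n (MartApprox.future X ω)) 2 P).toReal)
        =o[atTop] fun n : ℕ => √(n : ℝ) * Real.log n ^ (1 - q)) ∧
      -- the remainder is uniformly negligible in probability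
      (∀ ε : ℝ, 0 < ε → Tendsto
        (fun n : ℕ =>
          P {ω | ε * √(n : ℝ) ≤ MartApprox.pathMaxR g H n (MartApprox.future X ω)})
        atTop (𝓝 0)) ∧
      -- and, if `q > 5/2`, also in probability under `P^x`, for almost every `x`
      (5 / 2 < q → ∀ (Px : Kernel 𝒳 (ℕ → 𝒳)) [IsMarkovKernel Px],
        MartApprox.IsRegularCondLaw P X Px →
        ∀ᵐ x ∂(P.map (X 0)), ∀ ε : ℝ, 0 < ε → Tendsto
          (fun n : ℕ => Px x {y | ε * √(n : ℝ) ≤ MartApprox.pathMaxR g H n y})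
          atTop (𝓝 0)) := by
  have hprob := hX.isProbabilityMeasure_map
  obtain ⟨p', hp', hgp'⟩ : ∃ p' : ℝ, 2 < p' ∧ MemLp g (ENNReal.ofReal p') (P.map (X 0)) := by
    -- Capping p at 3 gives a finite real exponent above 2, also when p = ⊤.
    have h3 : min p 3 ≠ ⊤ := ne_top_of_le_ne_top (by simp) (min_le_right p 3)
    refine ⟨(min p 3).toReal, ?_, hgp.mono_exponent ?_⟩
    · have h2 : (2 : ENNReal) < min p 3 := lt_min hp (by norm_num)
      simpa using (ENNReal.toReal_lt_toReal (by simp) h3).2 h2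
    · rw [ENNReal.ofReal_toReal h3]
      exact min_le_left _ _
  have h2 : MemLp g 2 (P.map (X 0)) := hgp.mono_exponent hp.le
  have ha : (fun n => MartApprox.l2 (P.map (X 0)) (MartApprox.orbitFun Q g n))
      =o[atTop] MartApprox.logRate q :=
    hrate.congr_left fun n => hX.l2_condExp_pathS hg h2 n
  rw [hX.map_pair_zero]
  obtain ⟨H₀, hH₀⟩ := MartApprox.exists_isLimitDiff hX.invariant hg h2 hq ha
  refine ⟨⟨_, hX.tendsto_integral_pathS_sq hg h2 hq ha hH₀⟩, ⟨H₀, hH₀⟩, fun H hH =>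
    ⟨hX.martingale_pathM hg h2 hH, hX.hasStationaryIncrements hH.measurable,
      hX.isLittleO_l2_pathR hg h2 hq ha hH,
      fun ε hε => hX.tendsto_measure_pathMaxR hg hp' hgp' h2 hq ha hH hε,
      fun hq5 Px _ hPx => hX.ae_tendsto_pathMaxR hg hp' hgp' h2 hq5 ha hH hPx⟩⟩
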